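/- **Setting.** Let $G=(V,E)$ be a finite connected undirected graph with $n$ vertices, the processors, which have distinct IDs in $\{1,\dots,n^{c}\}$ for a constant $c$ (a processor is identified with its ID, and one of them has ID $1$). Let $\omega:E\to\mathbb{N}_{\ge 1}$ be edge weights and $\emptyset\ne S\subseteq V$. A processor initially knows its ID, whether it is in $S$, and its neighbours with the weights of the edges to them, in some fixed order. Computation proceeds in synchronous rounds; in each round every processor can send one message over each incident edge, and local computation is free. Exploring an edge $e$ takes $\ell(e)$ time slots, where either (a) $\ell=\omega$ (the weights are the edge traversal times), or (b) $\omega$ is constant and $\ell=1$ (uniform weights). For $H\subseteq G$ let $\omega_H(u,v)$ be the least weight of a $(u,v)$-path in $H$, $D_\omega=\max_{u,v\in V}\omega_G(u,v)$, and $RC_S(H)=\sum_{u,v\in S}\omega_H(u,v)$ (sum over ordered pairs). An SP-tree rooted in $v$ is a spanning tree $T$ of $G$ with $\omega_T(v,u)=\omega_G(v,u)$ for all $u\in V$. **The algorithm.** *Set-up.* By a breadth-first search from processor $1$, in which traversing $e$ takes $\ell(e)$ slots, followed by an echo, processor $1$ computes $D'=\max_{u}\omega_G(1,u)$ and $|S|$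 and broadcasts them with a common starting round. Put $K=|S|+2D'$. In the next two parts an edge $e$ with $\ell(e)>1$ is a line of $\ell(e)$ unit steps of weight $\omega(e)/\ell(e)$ each; its $\ell(e)-1$ inner nodes run the same code (they are not in $S$) and are simulated by the endpoint of $e$ with the smaller ID. Below, $u$ is a processor or such an inner node and $u_1,u_2,\dots$ are its neighbours, joined to it by unit steps of weight $\omega(u,u_i)$. *Part 1 (trees), slots $t=1,\dots,K$.* Node $u$ keeps sets $L$, $L_{delay}$, $L_i$ (one for each neighbour $u_i$) and arrays $\tau,\omega_u,parent$. Initially $L=L_i=\{u\}$ and $\tau[u]=\omega_u[u]=0$ if $u\in S$, and $L=L_i=\emptyset$ otherwise; $L_{delay}=\emptyset$, and $\tau=\infty$ elsewhere. In each slot, with $l_i=\min(L_i\setminus L_{delay})$ (where $\min\emptyset=\infty$), $u$ sends $(l_i,\omega_u[l_i]+\omega(u,u_i))$ to $u_i$ if $l_i<\infty$ and receives $(r_i,\omega_i)$ from $u_i$ ($r_i=\infty$ if nothing arrives). Let $R=\{r_i: r_i<l_i\}\setminus L$ and $s=\min L_{delay}$. If $s\le\min R$ and $s<\infty$, then $s$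 is removed from $L_{delay}$. Every $r\in R$ is added to $L$; with $i$ the first index such that $r=r_i<l_i$ one sets $\tau[r]=t$, $\omega_u[r]=\omega_i$, $parent[r]=u_i$; $r$ is added to all $L_j$; and it is added to $L_{delay}$ if $\min R<r$ or $s<r$. For every $i$: if $r_i<l_i$ then $r_i$ is removed from $L_i$ (it need not be sent back), otherwise the old $l_i$ is removed from $L_i$. *Part 2 (costs), slots $t=1,\dots,K$.* Node $u$ keeps arrays $rc$, initially $0$, and $z$, initially $1$ everywhere if $u\in S$ and $0$ everywhere otherwise. In slot $t$, for each $v\in L$ with $t=K-\tau[v]$, it sends $(v,rc[v],z[v])$ to $parent[v]$ (if this is defined); for each $(v,r,z')$ received from a neighbour $u_i$ it adds $r+2\,\omega(u,u_i)\,z'\,(|S|-z')$ to $rc[v]$ and then $z'$ to $z[v]$. Let $T_v$ be the graph on $V$ in which each processor $u$ with a defined $parent[v]$ is joined to the neighbour in $G$ towards which it points. **Theorem.** There is an absolute constant $C$ such that in every such network all processors have halted after at most $C\,(|S|+D_\omega)$ rounds (set-up included), and then for every $v\in S$ the graph $T_v$ is an SP-tree of $G$ rooted in $v$, and the entry $rc[v]$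 stored in processor $v$ equals $RC_S(T_v)$. At most one message is sent over each edge in each direction in each round, and each message has $O(\log n+\log W)$ bits if all weights are at most $W$ (the implied constant depends only on $c$); in particular it has $O(\log n)$ bits if the weights are polynomial in $n$. -/

import Mathlib

/-! ## Weighted distances, routing cost, shortest-path trees -/

/-- Weighted distance `ω_H(u, v)`: the least total weight of a `(u, v)`-walk in `H`
(`⊤` if there is none). -/
noncomputable def wdist {U : Type} (H : SimpleGraph U) (ω : Sym2 U → ℕ) (u v : U) : ℕ∞ :=
  ⨅ p : H.Walk u v, (((p.edges.map ω).sum : ℕ) : ℕ∞)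

/-- Weighted diameter `D_ω(H)`. -/
noncomputable def wdiam {U : Type} (H : SimpleGraph U) (ω : Sym2 U → ℕ) : ℕ∞ :=
  ⨆ u : U, ⨆ v : U, wdist H ω u v

/-- `S`-routing cost `RC_S(H)`: sum over all ordered pairs of elements of `S`. -/
noncomputable def routingCost {U : Type} (H : SimpleGraph U) (ω : Sym2 U → ℕ)
    (S : Finset U) : ℕ∞ :=
  ∑ u ∈ S, ∑ v ∈ S, wdist H ω u v

/-- `T` is a shortest-path tree of `G` rooted in `v` (spanning all vertices of `G`). -/
def IsSPTree {U : Type} (G : SimpleGraph U) (ω : Sym2 U → ℕ) (T : SimpleGraph U) (v : U) :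
    Prop :=
  T ≤ G ∧ T.IsTree ∧ ∀ u, wdist T ω v u = wdist G ω v u

/-- The element satisfying `p` with the least index `f`, if there is one. -/
noncomputable def firstBy {α : Type} (f : α → ℕ) (p : α → Prop) : Option α :=
  open Classical in
  if h : ∃ y, p y ∧ ∀ z, p z → f y ≤ f z then some h.choose else none

/-! ## The network -/

/-- Input data of the distributed algorithm. Processors are identified with their IDs, so the
set of processors is a finite set `V` of natural numbers. Processor `a` initially knows only its
own ID, whether it belongs to `S`, its neighbours, and the weight, the traversal time and the
port number of each edge incident to it. -/
structure Net (V : Finset ℕ) where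
  /-- the communication graph -/
  graph : SimpleGraph V
  /-- the weight `ω(e)` of an edge -/
  weight : Sym2 V → ℕ
  /-- the number of time slots that the exploration of a tree needs to traverse an edge -/
  slots : Sym2 V → ℕ
  /-- `port a b` is the index of the neighbour `b` in the list of neighbours of `a` -/
  port : V → V → ℕ
  /-- the set `S` -/
  S : Finset V

/-- Messages. One message per round can be sent over each edge in each direction.
`explore`, `echo` and `plan` serve the computation and the broadcast of `D'`; `wave v d` is the
message `(v, d)` by which the tree `T_v` is grown; `cost v rc z` is the message by which partial
routing costs are aggregated in `T_v`. -/
inductive Msg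
  | explore (d : ℕ) (child : Bool)
  | echo (ecc count : ℕ)
  | plan (ecc count start : ℕ)
  | wave (v d : ℕ)
  | cost (v rc z : ℕ)

/-- Length of the binary encoding of a message: three bits for the kind of the message, and
its fields in binary. -/
def Msg.bits : Msg → ℕ
  | .explore d _ => 3 + Nat.size d + 1
  | .echo e c => 3 + Nat.size e + Nat.size c
  | .plan e c s => 3 + Nat.size e + Nat.size c + Nat.size s
  | .wave v d => 3 + Nat.size v + Nat.size d
  | .cost v rc z => 3 + Nat.size v + Nat.size rc + Nat.size z

namespace Net

variable {V : Finset ℕ} (N : Net V)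

/-! ## Set-up: the processor with ID 1 computes and broadcasts `D' = ecc(1)`

This is delayed breadth-first search with echo. The leader starts an exploration; a processor
reached at time `t` tells this to all its neighbours in the next round (together with its distance,
and with the information which neighbour is its parent), and the exploration is considered to arrive
at a neighbour `b` at time `t + slots`. When a processor has heard from all its neighbours and has
received the reports of all its children it reports the largest distance and the number of elements
of `S` in its subtree to its parent. Finally the leader broadcasts `D'`, `|S|` and the round in which
everybody starts to construct the trees. -/

/-- Local memory during the set-up. -/
structure Lead (V : Finset ℕ) where
  /-- distance from the leader, once reached -/
  dist : Option ℕ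
  /-- parent in the leader's tree -/
  up : Option V
  /-- whether `explore` has been sent -/
  sent : Bool
  /-- for a neighbour from which `explore` was received: the time at which the exploration arrives
  via this neighbour, the length of the corresponding path, and whether the neighbour is a child -/
  heard : V → Option (ℕ × ℕ × Bool)
  /-- the reports received -/
  echo : V → Option (ℕ × ℕ)
  /-- `D'`, `|S|` and the starting round of the construction of the trees, once known -/
  plan : Option (ℕ × ℕ × ℕ)

def leadInit (a : V) : Lead V where
  dist := if (a : ℕ) = 1 then some 0 else none
  up := none
  sent := false
  heard _ := none
  echo _ := none
  plan := none

/-- All neighbours have been heard and all children have reported. -/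
def leadReady (s : Lead V) (a : V) : Prop :=
  s.sent = true ∧ ∀ b, N.graph.Adj a b →
    ∃ t d c, s.heard b = some (t, d, c) ∧ (c = true → s.echo b ≠ none)

/-- The children in the leader's tree. -/
noncomputable def leadKids (s : Lead V) (a : V) : Finset V :=
  open Classical in
  Finset.univ.filter fun b => N.graph.Adj a b ∧ ∃ t d, s.heard b = some (t, d, true)

/-- Largest distance from the leader in the subtree of `a`. -/
noncomputable def leadEcc (s : Lead V) (a : V) : ℕ :=
  max (s.dist.getD 0) ((N.leadKids s a).sup fun b => ((s.echo b).getD (0, 0)).1)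

/-- Number of elements of `S` in the subtree of `a`. -/
noncomputable def leadCount (s : Lead V) (a : V) : ℕ :=
  (if a ∈ N.S then 1 else 0) + ∑ b ∈ N.leadKids s a, ((s.echo b).getD (0, 0)).2

/-- The set-up message of `a` to its neighbour `b` when `r` rounds have been completed. -/
noncomputable def leadSend (r : ℕ) (s : Lead V) (a b : V) : Option Msg :=
  open Classical in
  match s.plan with
  | some (D, k, start) => if r < start then some (.plan D k start) else none
  | none =>
    if s.sent = false then s.dist.map fun d => .explore d (decide (s.up = some b))
    else if N.leadReady s a ∧ s.up = some b then
      some (.echo (N.leadEcc s a) (N.leadCount s a))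
    else none

/-- Local computation of `a` in the set-up, in the round after `r` completed rounds. -/
noncomputable def leadRecv (r : ℕ) (s : Lead V) (a : V) (inbox : V → Option Msg) : Lead V :=
  open Classical in
  let heard : V → Option (ℕ × ℕ × Bool) := fun b =>
    match inbox b with
    | some (.explore d c) => some (r + N.slots s(a, b), d + N.weight s(a, b), c)
    | _ => s.heard b
  let src : Option V := firstBy (N.port a) fun b => ∃ d c, heard b = some (r + 1, d, c)
  let s' : Lead V :=
    { dist := if s.dist = none then (src.bind heard).map (fun q => q.2.1) else s.dist
      up := if s.dist = none then src else s.up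
      sent := s.sent || s.dist.isSome
      heard := heard
      echo := fun b =>
        match inbox b with
        | some (.echo e c) => some (e, c)
        | _ => s.echo b
      plan := s.plan }
  let received : Option (ℕ × ℕ × ℕ) :=
    (firstBy (N.port a) fun b => ∃ D k start, inbox b = some (.plan D k start)).bind fun b =>
      match inbox b with
      | some (.plan D k start) => some (D, k, start)
      | _ => none
  { s' with
    plan :=
      if s.plan ≠ none then s.plan
      else if (a : ℕ) = 1 ∧ N.leadReady s' a then
        some (N.leadEcc s' a, N.leadCount s' a, r + N.leadEcc s' a + 2)
      else received }

/-- Memory of all processors after `r` rounds (the part used by the set-up). -/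
noncomputable def lead : ℕ → V → Lead V
  | 0 => leadInit
  | r + 1 => fun a =>
    open Classical in
    N.leadRecv r (lead r a) a fun b =>
      if N.graph.Adj a b then N.leadSend r (lead r b) b a else none

/-- What a processor does in a round. `tree t` is slot `t` of the construction of the trees,
`cost K k t` is slot `t` of the aggregation of the costs, where `k = |S|` and `K = |S| + 2 D'`
(the length of both parts). -/
inductive Phase
  | setup
  | tree (t : ℕ)
  | cost (K k t : ℕ)
  | halted

/-- What processor `a` does in the round after `r` completed rounds. -/
noncomputable def phase (r : ℕ) (a : V) : Phase :=
  match (N.lead r a).plan with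
  | none => .setup
  | some (D, k, start) =>
    if r < start then .setup
    else if r < start + (k + 2 * D) then .tree (r - start + 1)
    else if r < start + 2 * (k + 2 * D) then .cost (k + 2 * D) k (r - start - (k + 2 * D) + 1)
    else .halted

/-! ## Sites: edges that take several slots

An edge `e` that takes `slots e` time slots is a line of `slots e` unit steps, with
`slots e - 1` relays between them, which execute the same code as the processors do (and do not
belong to `S`). The relays are not additional processors: those of `e` are simulated by the
endpoint of `e` with the smaller ID, so that exactly one unit step of `e` is a real transmission
between two processors. If `slots e = 1` there are no relays on `e`. -/

/-- Processors and relays. -/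
abbrev Site : Type :=
  V ⊕ (Σ e : N.graph.edgeSet, Fin (N.slots e - 1))

noncomputable instance : Fintype N.Site := Fintype.ofFinite _

/-- The processor that executes the code of a site. -/
def host : N.Site → V
  | .inl a => a
  | .inr ⟨e, _⟩ => (e : Sym2 V).inf

/-- Unit steps between sites. Relay `i` of `e` is at distance `i + 1` from the smaller
endpoint of `e`. -/
def SiteAdj : N.Site → N.Site → Prop
  | .inl a, .inl b => N.graph.Adj a b ∧ N.slots s(a, b) = 1
  | .inl a, .inr ⟨e, i⟩ =>
    (a = (e : Sym2 V).inf ∧ (i : ℕ) = 0) ∨ (a = (e : Sym2 V).sup ∧ (i : ℕ) + 2 = N.slots e)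
  | .inr ⟨e, i⟩, .inl a =>
    (a = (e : Sym2 V).inf ∧ (i : ℕ) = 0) ∨ (a = (e : Sym2 V).sup ∧ (i : ℕ) + 2 = N.slots e)
  | .inr ⟨e, i⟩, .inr ⟨f, j⟩ => e = f ∧ ((i : ℕ) + 1 = j ∨ (j : ℕ) + 1 = i)

/-- The edge of the network to which a unit step belongs. -/
def stepEdge : N.Site → N.Site → Sym2 V
  | .inl a, .inl b => s(a, b)
  | .inr ⟨e, _⟩, _ => e
  | .inl _, .inr ⟨e, _⟩ => e

/-- The weight of a unit step: the weight of an edge is divided evenly among its steps. -/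
def stepWeight (x y : N.Site) : ℕ :=
  N.weight (N.stepEdge x y) / N.slots (N.stepEdge x y)

/-- The endpoint other than `a` of the edge on which the site `y` next to `a` lies. -/
def across (a : V) : N.Site → V
  | .inl b => b
  | .inr ⟨e, _⟩ => if a = (e : Sym2 V).inf then (e : Sym2 V).sup else (e : Sym2 V).inf

/-- Index of the neighbouring site `y` at `x`. -/
def sitePort : N.Site → N.Site → ℕ
  | .inl a, y => N.port a (N.across a y)
  | .inr ⟨e, _⟩, .inl b => if b = (e : Sym2 V).inf then 0 else 1
  | .inr ⟨_, i⟩, .inr ⟨_, j⟩ => if (j : ℕ) < i then 0 else 1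

/-- Local memory of a site `u`. All arrays are indexed by the IDs of the roots of the trees. -/
structure SiteState where
  /-- `L`: the IDs that have arrived -/
  L : Finset ℕ
  /-- `L_i`: the IDs that still have to be forwarded to neighbour `i` -/
  todo : N.Site → Finset ℕ
  /-- `L_delay` -/
  delay : Finset ℕ
  /-- `τ[v]`: the slot in which `v` arrived -/
  tau : ℕ → ℕ∞
  /-- `ω_u[v]`: the distance to `v` -/
  om : ℕ → ℕ
  /-- `parent_in_T_v` -/
  par : ℕ → Option N.Site
  /-- `rc_S[v]`: the partial routing cost -/
  rc : ℕ → ℕ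
  /-- `z[v]`: the number of elements of `S` counted in the subtree of `u` in `T_v` -/
  z : ℕ → ℕ

noncomputable def siteInit : N.Site → N.SiteState
  | .inl a =>
    if a ∈ N.S then
      { L := {(a : ℕ)}, todo := fun _ => {(a : ℕ)}, delay := ∅,
        tau := fun v => if v = a then 0 else ⊤, om := fun _ => 0, par := fun _ => none,
        rc := fun _ => 0, z := fun _ => 1 }
    else
      { L := ∅, todo := fun _ => ∅, delay := ∅, tau := fun _ => ⊤, om := fun _ => 0,
        par := fun _ => none, rc := fun _ => 0, z := fun _ => 0 }
  | .inr _ =>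
    { L := ∅, todo := fun _ => ∅, delay := ∅, tau := fun _ => ⊤, om := fun _ => 0,
      par := fun _ => none, rc := fun _ => 0, z := fun _ => 0 }

/-- The ID `l_i` offered to neighbour `y` (`⊤` if there is none). -/
noncomputable def offer {N : Net V} (s : N.SiteState) (y : N.Site) : WithTop ℕ :=
  (s.todo y \ s.delay).min

/-- The message of site `x` to the neighbouring site `y`. In slot `t` of the aggregation it is
the partial routing cost for the tree `T_v` with `t = |S| + 2 D' - τ[v]` in which `y` is the
parent of `x`. -/
noncomputable def siteSend (ph : Phase) (s : N.SiteState) (x y : N.Site) : Option Msg :=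
  open Classical in
  match ph with
  | .tree _ =>
    if h : (s.todo y \ s.delay).Nonempty then
      some (.wave ((s.todo y \ s.delay).min' h)
        (s.om ((s.todo y \ s.delay).min' h) + N.stepWeight x y))
    else none
  | .cost K _ t =>
    let A : Finset ℕ := s.L.filter fun v => s.par v = some y ∧ (t : ℕ∞) + s.tau v = K
    if h : A.Nonempty then some (.cost (A.min' h) (s.rc (A.min' h)) (s.z (A.min' h))) else none
  | _ => none

/-- One slot of the construction of the trees at site `x`. An ID `r_i` received from neighbour
`i` has been transmitted successfully if it is smaller than the ID `l_i` that was sent to `i` in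
the same slot; otherwise `l_i` has been transmitted successfully. -/
noncomputable def treeStep (t : ℕ) (s : N.SiteState) (x : N.Site)
    (inbox : N.Site → Option Msg) : N.SiteState :=
  open Classical in
  -- the ID successfully received from `y`, if any
  let got : N.Site → Finset ℕ := fun y =>
    match inbox y with
    | some (.wave v _) => if (v : WithTop ℕ) < offer s y then {v} else ∅
    | _ => ∅
  -- the set `R` of the IDs received for the first time
  let R : Finset ℕ := (Finset.univ.biUnion got) \ s.L
  let m : WithTop ℕ := s.delay.min
  let src : ℕ → Option N.Site := fun v => firstBy (N.sitePort x) fun y => v ∈ got y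
  { s with
    L := s.L ∪ R
    todo := fun y =>
      ((if got y = ∅ then (s.todo y).filter fun v => (v : WithTop ℕ) ≠ offer s y
        else s.todo y) ∪ R) \ got y
    delay :=
      (s.delay.filter fun v => ¬ ((v : WithTop ℕ) = m ∧ m ≤ R.min)) ∪
        R.filter fun v => R.min < v ∨ m < v
    tau := fun v => if v ∈ R then t else s.tau v
    om := fun v =>
      if v ∈ R then
        match (src v).bind inbox with
        | some (.wave _ d) => d
        | _ => 0
      else s.om v
    par := fun v => if v ∈ R then src v else s.par v }

/-- One slot of the aggregation of the costs at site `x`, where `k = |S|`. -/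
noncomputable def costStep (k : ℕ) (s : N.SiteState) (x : N.Site)
    (inbox : N.Site → Option Msg) : N.SiteState :=
  { s with
    rc := fun v => s.rc v + ∑ y, match inbox y with
      | some (.cost v' r z) => if v' = v then r + 2 * N.stepWeight x y * z * (k - z) else 0
      | _ => 0
    z := fun v => s.z v + ∑ y, match inbox y with
      | some (.cost v' _ z) => if v' = v then z else 0
      | _ => 0 }

/-- Memory of all sites after `r` rounds. -/
noncomputable def site : ℕ → N.Site → N.SiteState
  | 0 => N.siteInit
  | r + 1 => fun x =>
    open Classical in
    let inbox : N.Site → Option Msg := fun y =>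
      if N.SiteAdj x y then N.siteSend (N.phase r (N.host y)) (site r y) y x else none
    match N.phase r (N.host x) with
    | .tree t => N.treeStep t (site r x) x inbox
    | .cost _ k _ => N.costStep k (site r x) x inbox
    | _ => site r x

/-! ## What the run yields -/

/-- All processors have finished after `r` rounds. -/
def Halted (r : ℕ) : Prop := ∀ a, N.phase r a = .halted

/-- The tree `T_v` after `r` rounds: every processor is joined to the neighbour to which its
entry `parent_in_T_v` points. -/
def builtTree (r : ℕ) (v : V) : SimpleGraph V :=
  SimpleGraph.fromRel fun a b => ((N.site r (.inl a)).par v).map (N.across a) = some b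

/-- The output of processor `v` after `r` rounds: its entry `rc_S[v]`. -/
noncomputable def output (r : ℕ) (v : V) : ℕ := (N.site r (.inl v)).rc v

/-- The site executed by `a` that is an end of the one unit step of the edge `{a, b}` between
sites executed by different processors. -/
noncomputable def gate (a b : V) : N.Site :=
  open Classical in
  if h : N.graph.Adj a b ∧ a < b ∧ 2 ≤ N.slots s(a, b) then
    .inr ⟨⟨s(a, b), h.1⟩, ⟨N.slots s(a, b) - 2, Nat.sub_lt_sub_left h.2.2 one_lt_two⟩⟩
  else .inl a

/-- The message that processor `a` sends to its neighbour `b` in the round after `r` completed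
rounds. -/
noncomputable def transmission (r : ℕ) (a b : V) : Option Msg :=
  match N.phase r a with
  | .setup => N.leadSend r (N.lead r a) a b
  | ph => N.siteSend ph (N.site r (N.gate a b)) (N.gate a b) (N.gate b a)

end Net

/-! The run of the tree construction has a closed form. Refine every edge into unit steps, so that
waves travel one hop per slot when undisturbed, and let `d x v` be the hop distance of the site `x`
from the root `v`. At each site, and separately at each unit step, assign slots greedily in the
order of priority: wave `v` takes the free slot of index `d x v`, respectively `edgeDist d x y v`,
left over by the smaller IDs. The site slot is the moment at which `x` releases `v` from `L_delay`,
and the edge slot is the moment at which `v` crosses the step. These assignments depend only on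
distances, not on the run.

The assignments fit together because the distance of an edge and that of its ends differ by at most
one, and greedy assignments depend on the indices monotonically and with shift at most one
(`freeSlots_compare`). Hence the nearer end has released a wave before it crosses, and the wave has
crossed before the farther end releases it (`WaveDist.released_of_crossed`,
`WaveDist.crossed_of_released`). An idle but permitted wave is always explained by a smaller one
holding the slot (`WaveDist.edge_busy`, `WaveDist.node_busy`), so the local rules "send the least
released ID" and "release the least waiting ID" reproduce the assignment exactly
(`Proportional.treeInv_step`). A first arrival therefore always comes from a neighbour one hop
closer, which gives shortest paths, and each wave loses at most one slot to every smaller ID, which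
gives the length of the schedule.

The aggregation is this run in reverse. IDs with the same parent at a site crossed the same step in
different slots, so their reports do not collide; children arrive after their parents, so every
subtree is complete when it is reported (`Schedule.siteSend_iff`, `Schedule.costInv`). A unit step
with `z` elements of `S` below it separates `2 z (|S| - z)` ordered pairs, and summing over the
steps gives the routing cost (`sum_ancDist`, `Schedule.partCost_root`). The passage from sites back
to processors is `SiteTree`: pointers that enter an edge leave it at the other end.

The set-up is analysed through its own invariant, `LeadInv`. Its eccentricity bounds all distances
by the triangle inequality through the leader. Both cases of traversal times are covered by
`Proportional`: weights are a constant multiple of the times. -/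

/-! ## Slot assignment by priorities

Jobs are natural numbers, smaller jobs having priority. Job `v` is assigned the free slot with
index `d v` among the slots which are not assigned to smaller jobs. -/

/-- The number of elements below a free slot after the slot with index `a` has been removed. -/
def squeeze (a x : ℕ) : ℕ := if x ≤ a then x else x - 1

/-- The number of slots smaller than `t` which are not assigned to jobs of `I` smaller than `n`. -/
def freeSlots (I : Finset ℕ) (d : ℕ → ℕ) : ℕ → ℕ → ℕ
  | 0, t => t
  | n + 1, t => if n ∈ I then squeeze (d n) (freeSlots I d n t) else freeSlots I d n t

section Slots

variable {I : Finset ℕ} {a b d : ℕ → ℕ}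

theorem freeSlots_zero_right (n : ℕ) : freeSlots I d n 0 = 0 := by
  induction n with
  | zero => rfl
  | succ n ih => simp [freeSlots, ih, squeeze]

theorem freeSlots_step (n t : ℕ) :
    freeSlots I d n t ≤ freeSlots I d n (t + 1) ∧
      freeSlots I d n (t + 1) ≤ freeSlots I d n t + 1 := by
  induction n with
  | zero => simp [freeSlots]
  | succ n ih => simp only [freeSlots, squeeze]; split_ifs <;> omega

theorem freeSlots_mono (n : ℕ) : Monotone (freeSlots I d n) :=
  monotone_nat_of_le_succ fun t => (freeSlots_step n t).1

/-- The count of free slots stalls at `t` precisely when some smaller job owns slot `t`; the two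
inequalities on the right say that `t` is free for `w` and has index `d w` there. -/
theorem freeSlots_eq_succ_iff (n t : ℕ) :
    freeSlots I d n t = freeSlots I d n (t + 1) ↔
      ∃ w < n, w ∈ I ∧ freeSlots I d w t ≤ d w ∧ d w < freeSlots I d w (t + 1) := by
  induction n with
  | zero => simp [freeSlots]
  | succ n ih =>
    have h := freeSlots_step (I := I) (d := d) n t
    constructor
    · intro he
      by_cases h1 : freeSlots I d n t = freeSlots I d n (t + 1)
      · obtain ⟨w, hw, h2⟩ := ih.1 h1
        exact ⟨w, by omega, h2⟩
      · refine ⟨n, by omega, ?_⟩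
        simp only [freeSlots, squeeze] at he
        split_ifs at he with h2 h3 h4
        · omega
        · exact ⟨h2, h3, by omega⟩
        · omega
        · omega
        · omega
    · rintro ⟨w, hw, h1, h2, h3⟩
      by_cases hwn : w = n
      · subst hwn
        simp only [freeSlots, squeeze]
        split_ifs <;> omega
      · simp only [freeSlots]
        rw [ih.2 ⟨w, by omega, h1, h2, h3⟩]

/-- A slot is assigned to at most one job. -/
theorem freeSlots_unique {v w t : ℕ} (hv : v ∈ I) (hw : w ∈ I)
    (hv1 : freeSlots I d v t ≤ d v) (hv2 : d v < freeSlots I d v (t + 1))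
    (hw1 : freeSlots I d w t ≤ d w) (hw2 : d w < freeSlots I d w (t + 1)) : v = w := by
  rcases lt_trichotomy v w with h | h | h
  · have := (freeSlots_eq_succ_iff w t).2 ⟨v, h, hv, hv1, hv2⟩
    omega
  · exact h
  · have := (freeSlots_eq_succ_iff v t).2 ⟨w, h, hw, hw1, hw2⟩
    omega

/-- Raising every index by at most one delays each removed slot, but by a controlled amount, so the
two counts stay within one time step of each other. Applied to an edge (`b`) and one of its ends
(`a`), this is what makes edge and site schedules compatible. -/
theorem freeSlots_compare (h : ∀ w ∈ I, b w ≤ a w ∧ a w ≤ b w + 1) (n t : ℕ) :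
    freeSlots I b n t ≤ freeSlots I a n t ∧
      freeSlots I a n (t + 1) ≤ freeSlots I b n t + 1 := by
  induction n with
  | zero => simp [freeSlots]
  | succ n ih =>
    simp only [freeSlots, squeeze]
    by_cases hn : n ∈ I
    · have := h n hn
      have := freeSlots_step (I := I) (d := a) n t
      simp only [hn, if_true]
      split_ifs <;> omega
    · simpa only [hn, if_false] using ih

/-- Each smaller job removes at most one slot; this yields the additive `|S|` in the running time.
-/
theorem le_freeSlots_add (n t : ℕ) :
    t ≤ freeSlots I d n t + (I.filter (· < n)).card := by
  induction n with
  | zero => simp [freeSlots]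
  | succ n ih =>
    by_cases hn : n ∈ I
    · have : I.filter (· < n + 1) = insert n (I.filter (· < n)) := by
        ext x; simp only [Finset.mem_filter, Finset.mem_insert]
        constructor
        · rintro ⟨h1, h2⟩
          by_cases hx : x = n
          · exact .inl hx
          · exact .inr ⟨h1, by omega⟩
        · rintro (rfl | ⟨h1, h2⟩)
          · exact ⟨hn, by omega⟩
          · exact ⟨h1, by omega⟩
      rw [this, Finset.card_insert_of_notMem (by simp)]
      simp only [freeSlots, squeeze, hn, if_true]
      split_ifs <;> omega
    · have : I.filter (· < n + 1) = I.filter (· < n) := by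
        ext x; simp only [Finset.mem_filter]
        constructor
        · rintro ⟨h1, h2⟩
          exact ⟨h1, lt_of_le_of_ne (by omega) (by rintro rfl; exact hn h1)⟩
        · rintro ⟨h1, h2⟩
          exact ⟨h1, by omega⟩
      rw [this]
      simpa only [freeSlots, hn, if_false] using ih

end Slots

/-! ## Prioritized flooding -/

/-- Hop distances `d u v` of the nodes `u` of a graph from the origins of the waves `v ∈ I`. -/
structure WaveDist {U : Type} (adj : U → U → Prop) (I : Finset ℕ) (d : U → ℕ → ℕ) : Prop where
  symm : ∀ {x y}, adj x y → adj y x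
  le_succ : ∀ {x y}, adj x y → ∀ v ∈ I, d y v ≤ d x v + 1
  pred : ∀ x, ∀ v ∈ I, d x v ≠ 0 → ∃ y, adj x y ∧ d x v = d y v + 1
  zero_unique : ∀ x, ∀ v ∈ I, ∀ w ∈ I, d x v = 0 → d x w = 0 → v = w

/-- Distance of the edge between `x` and `y` from the origin of the wave `v`. -/
def edgeDist {U : Type} (d : U → ℕ → ℕ) (x y : U) (v : ℕ) : ℕ := min (d x v) (d y v)

/-- After slot `t` the wave `v` may be forwarded by `x`. -/
def Released {U : Type} (I : Finset ℕ) (d : U → ℕ → ℕ) (x : U) (v t : ℕ) : Prop :=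
  d x v < freeSlots I (d x) v (t + 1)

/-- After slot `t` the wave `v` has been transmitted over the edge between `x` and `y`. -/
def Crossed {U : Type} (I : Finset ℕ) (d : U → ℕ → ℕ) (x y : U) (v t : ℕ) : Prop :=
  edgeDist d x y v < freeSlots I (edgeDist d x y) v t

/-- After slot `t` the wave `v` has arrived at `x`. -/
def Arrived {U : Type} (adj : U → U → Prop) (I : Finset ℕ) (d : U → ℕ → ℕ) (x : U) (v t : ℕ) :
    Prop :=
  d x v = 0 ∨ ∃ y, adj x y ∧ Crossed I d x y v t

section Flooding

variable {U : Type} {adj : U → U → Prop} {I : Finset ℕ} {d : U → ℕ → ℕ} {x y : U} {v w t s : ℕ}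

theorem edgeDist_comm (d : U → ℕ → ℕ) (x y : U) : edgeDist d x y = edgeDist d y x := by
  funext v; exact min_comm _ _

theorem crossed_comm : Crossed I d x y v t ↔ Crossed I d y x v t := by
  unfold Crossed; rw [edgeDist_comm]

theorem Released.mono (h : Released I d x v t) (hts : t ≤ s) : Released I d x v s :=
  lt_of_lt_of_le h (freeSlots_mono _ (by omega))

theorem Crossed.mono (h : Crossed I d x y v t) (hts : t ≤ s) : Crossed I d x y v s :=
  lt_of_lt_of_le h (freeSlots_mono _ hts)

theorem Arrived.mono (h : Arrived adj I d x v t) (hts : t ≤ s) : Arrived adj I d x v s := by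
  rcases h with h | ⟨y, hy, h⟩
  · exact .inl h
  · exact .inr ⟨y, hy, h.mono hts⟩

theorem not_crossed_zero : ¬ Crossed I d x y v 0 := by
  simp [Crossed, freeSlots_zero_right]

theorem arrived_zero_iff : Arrived adj I d x v 0 ↔ d x v = 0 := by
  simp [Arrived, not_crossed_zero]

namespace WaveDist

variable (hd : WaveDist adj I d)
include hd

theorem edgeDist_compare (hxy : adj x y) :
    ∀ w ∈ I, edgeDist d x y w ≤ d x w ∧ d x w ≤ edgeDist d x y w + 1 := by
  intro w hw
  have := hd.le_succ (hd.symm hxy) w hw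
  unfold edgeDist
  omega

/-- The nearer end has the same index for `v` as the edge, and the first half of `freeSlots_compare`
says that the site has at least as many free slots. The shift by one reflects that a wave released
after slot `t - 1` can be sent in slot `t`. -/
theorem released_of_crossed (hxy : adj x y) (hle : d x v ≤ d y v)
    (h : Crossed I d x y v t) : Released I d x v (t - 1) := by
  have h1 := freeSlots_compare (hd.edgeDist_compare hxy) v t
  have ht : t ≠ 0 := by rintro rfl; exact not_crossed_zero h
  obtain ⟨t, rfl⟩ := Nat.exists_eq_succ_of_ne_zero ht
  unfold Released Crossed at *
  simp only [edgeDist, min_eq_left hle, Nat.succ_eq_add_one, Nat.add_sub_cancel] at *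
  omega

/-- The farther end has an index larger by one than the edge, and the second half of
`freeSlots_compare` loses exactly that one. So a wave is never released at a site which it has not
reached. -/
theorem crossed_of_released (hxy : adj x y) (hlt : d x v = d y v + 1)
    (h : Released I d x v t) : Crossed I d x y v t := by
  have h1 := freeSlots_compare (hd.edgeDist_compare hxy) v t
  unfold Released Crossed at *
  have : edgeDist d x y v = d y v := by unfold edgeDist; omega
  omega

/-- Only another wave of index `0` could hold the very first slot, and a site is the origin of at
most one wave. -/
theorem released_zero (hv : v ∈ I) (h : d x v = 0) : Released I d x v 0 := by
  unfold Released
  by_contra hcon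
  have h0 := freeSlots_zero_right (I := I) (d := d x) v
  have h1 := freeSlots_step (I := I) (d := d x) v 0
  obtain ⟨w, hw, hwI, h2, h3⟩ := (freeSlots_eq_succ_iff (I := I) (d := d x) v 0).1 (by omega)
  have h4 := freeSlots_step (I := I) (d := d x) w 0
  have h5 := freeSlots_zero_right (I := I) (d := d x) w
  have := hd.zero_unique x v hv w hwI h (by omega)
  omega

theorem arrived_of_released (hv : v ∈ I) (h : Released I d x v t) : Arrived adj I d x v t := by
  by_cases h0 : d x v = 0
  · exact .inl h0
  · obtain ⟨y, hy, hxy⟩ := hd.pred x v hv h0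
    exact .inr ⟨y, hy, hd.crossed_of_released hy hxy h⟩

/-- If a released wave is not transmitted in a slot, then the edge is occupied by a smaller one. -/
theorem edge_busy (hxy : adj x y) (hv : v ∈ I) (h : Released I d x v t)
    (hc : ¬ Crossed I d x y v (t + 1)) :
    ∃ w < v, w ∈ I ∧ ¬ Crossed I d x y w t ∧ Crossed I d x y w (t + 1) := by
  have hle : d x v ≤ d y v := by
    by_contra hcon
    have := hd.le_succ (hd.symm hxy) v hv
    exact hc ((hd.crossed_of_released hxy (by omega) h).mono (by omega))
  have h1 := freeSlots_compare (hd.edgeDist_compare hxy) v t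
  have h2 := freeSlots_step (I := I) (d := edgeDist d x y) v t
  unfold Released Crossed at *
  have he : edgeDist d x y v = d x v := by unfold edgeDist; omega
  obtain ⟨w, hw, hwI, h3, h4⟩ :=
    (freeSlots_eq_succ_iff (I := I) (d := edgeDist d x y) v t).1 (by omega)
  exact ⟨w, hw, hwI, by omega, h4⟩

/-- If a wave which has arrived is not released in a slot, then a smaller one is. -/
theorem node_busy (hv : v ∈ I) (h : Arrived adj I d x v (t + 1))
    (hr : ¬ Released I d x v (t + 1)) :
    ∃ w < v, w ∈ I ∧ ¬ Released I d x w t ∧ Released I d x w (t + 1) := by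
  rcases h with h | ⟨y, hxy, h⟩
  · exact absurd ((hd.released_zero hv h).mono (by omega)) hr
  · have hlt : d x v = d y v + 1 := by
      by_contra hcon
      have := hd.le_succ (hd.symm hxy) v hv
      exact hr ((hd.released_of_crossed hxy (by omega) h).mono (by omega))
    have h1 := freeSlots_compare (hd.edgeDist_compare hxy) v (t + 1)
    have h2 := freeSlots_step (I := I) (d := d x) v (t + 1)
    unfold Released Crossed at *
    have he : edgeDist d x y v = d y v := by unfold edgeDist; omega
    obtain ⟨w, hw, hwI, h3, h4⟩ :=
      (freeSlots_eq_succ_iff (I := I) (d := d x) v (t + 1)).1 (by omega)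
    exact ⟨w, hw, hwI, by omega, h4⟩

-- A unit step carries one wave per slot, both directions together. Besides driving the tree
-- construction, this is why the reversed run has no collisions.
omit hd in
theorem edge_unique (hv : v ∈ I) (hw : w ∈ I)
    (hv1 : ¬ Crossed I d x y v t) (hv2 : Crossed I d x y v (t + 1))
    (hw1 : ¬ Crossed I d x y w t) (hw2 : Crossed I d x y w (t + 1)) : v = w := by
  unfold Crossed at *
  exact freeSlots_unique hv hw (by omega) hv2 (by omega) hw2

omit hd in
theorem node_unique (hv : v ∈ I) (hw : w ∈ I)
    (hv1 : ¬ Released I d x v t) (hv2 : Released I d x v (t + 1))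
    (hw1 : ¬ Released I d x w t) (hw2 : Released I d x w (t + 1)) : v = w := by
  unfold Released at *
  exact freeSlots_unique hv hw (by omega) hv2 (by omega) hw2

-- At most `|I| - 1` smaller waves can postpone the release beyond the distance.
omit hd in
theorem released_of_le (hv : v ∈ I) (ht : d x v + I.card ≤ t + 1) : Released I d x v t := by
  unfold Released
  have h1 := le_freeSlots_add (I := I) (d := d x) v (t + 1)
  have h2 : (I.filter (· < v)).card < I.card := by
    apply Finset.card_lt_card
    rw [Finset.filter_ssubset]
    exact ⟨v, hv, by simp⟩
  omega

end WaveDist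

end Flooding

/-! ## Weighted distances -/

section WDist

variable {U : Type} {H : SimpleGraph U} {ω : Sym2 U → ℕ}

theorem exists_walk_of_wdist {u v : U} (h : H.Reachable u v) :
    ∃ p : H.Walk u v, (((p.edges.map ω).sum : ℕ) : ℕ∞) = wdist H ω u v := by
  have : Nonempty (H.Walk u v) := h
  exact ciInf_mem fun p : H.Walk u v => (((p.edges.map ω).sum : ℕ) : ℕ∞)

theorem wdist_le_walk {u v : U} (p : H.Walk u v) :
    wdist H ω u v ≤ (((p.edges.map ω).sum : ℕ) : ℕ∞) :=
  iInf_le _ p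

theorem wdist_comm (u v : U) : wdist H ω u v = wdist H ω v u := by
  have key : ∀ u v, wdist H ω u v ≤ wdist H ω v u := by
    intro u v
    refine le_iInf fun p => (wdist_le_walk p.reverse).trans ?_
    simp [List.sum_reverse]
  exact le_antisymm (key u v) (key v u)

theorem le_add_walk {f : U → ℕ} (hf : ∀ a b, H.Adj a b → f b ≤ f a + ω s(a, b))
    {u v : U} (p : H.Walk u v) : f v ≤ f u + (p.edges.map ω).sum := by
  induction p with
  | nil => simp
  | cons h p ih =>
    have := hf _ _ h
    simp only [SimpleGraph.Walk.edges_cons, List.map_cons, List.sum_cons]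
    omega

/-- Following predecessors terminates because positive weights make the potential drop strictly. -/
theorem exists_walk_sum_eq {f : U → ℕ} {u : U} (h0 : f u = 0)
    (hω : ∀ a b, H.Adj a b → 1 ≤ ω s(a, b))
    (hpred : ∀ a, a ≠ u → ∃ b, H.Adj a b ∧ f a = f b + ω s(a, b)) (a : U) :
    ∃ p : H.Walk a u, (p.edges.map ω).sum = f a := by
  induction hn : f a using Nat.strong_induction_on generalizing a with
  | _ n ih =>
    by_cases ha : a = u
    · subst ha
      exact ⟨.nil, by simp; omega⟩
    · obtain ⟨b, hab, hfb⟩ := hpred a ha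
      have := hω a b hab
      obtain ⟨p, hp⟩ := ih (f b) (by omega) b rfl
      exact ⟨.cons hab p, by simp [hp]; omega⟩

/-- A potential which satisfies the recursion of shortest paths is the weighted distance. -/
theorem wdist_eq_of_potential {f : U → ℕ} {u : U} (h0 : f u = 0)
    (hω : ∀ a b, H.Adj a b → 1 ≤ ω s(a, b))
    (hf : ∀ a b, H.Adj a b → f b ≤ f a + ω s(a, b))
    (hpred : ∀ a, a ≠ u → ∃ b, H.Adj a b ∧ f a = f b + ω s(a, b)) (a : U) :
    wdist H ω u a = f a := by
  apply le_antisymm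
  · obtain ⟨p, hp⟩ := exists_walk_sum_eq h0 hω hpred a
    rw [wdist_comm, ← hp]
    exact wdist_le_walk p
  · refine le_iInf fun p => ?_
    have := le_add_walk hf p
    rw [h0, zero_add] at this
    exact_mod_cast this

end WDist

/-! ### Networks with traversal times proportional to the weights -/

namespace Net

variable {V : Finset ℕ}

/-- The traversal times are positive and proportional to the weights. -/
structure Proportional (N : Net V) (κ : ℕ) : Prop where
  connected : N.graph.Connected
  factor_pos : 1 ≤ κ
  slots_pos : ∀ a b, N.graph.Adj a b → 1 ≤ N.slots s(a, b)
  weight_eq : ∀ a b, N.graph.Adj a b → N.weight s(a, b) = κ * N.slots s(a, b)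

/-- Distance with respect to the traversal times. -/
noncomputable def slotDist (N : Net V) (u v : V) : ℕ := (wdist N.graph N.slots u v).toNat

theorem mk_inf_sup (e : Sym2 V) : s(e.inf, e.sup) = e := by
  induction e with
  | _ a b =>
    rcases le_total a b with h | h <;> simp [h, Sym2.eq_swap]

section Distances

variable {N : Net V} {κ : ℕ} (hN : N.Proportional κ)
include hN

theorem Proportional.coe_slotDist (u v : V) : (N.slotDist u v : ℕ∞) = wdist N.graph N.slots u v := by
  obtain ⟨p, hp⟩ := exists_walk_of_wdist (ω := N.slots) (hN.connected u v)
  rw [slotDist, ← hp]; rfl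

omit hN in
theorem slotDist_comm (u v : V) : N.slotDist u v = N.slotDist v u := by
  rw [slotDist, wdist_comm, slotDist]

omit hN in
theorem slotDist_self (u : V) : N.slotDist u u = 0 := by
  have : wdist N.graph N.slots u u ≤ 0 := by
    simpa using wdist_le_walk (ω := N.slots) (SimpleGraph.Walk.nil : N.graph.Walk u u)
  simp [slotDist, nonpos_iff_eq_zero.1 this]

theorem Proportional.slotDist_le_walk {u v : V} (p : N.graph.Walk u v) :
    N.slotDist u v ≤ (p.edges.map N.slots).sum := by
  have := wdist_le_walk (ω := N.slots) p
  rw [← hN.coe_slotDist] at this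
  exact_mod_cast this

theorem Proportional.exists_walk_slotDist (u v : V) :
    ∃ p : N.graph.Walk u v, (p.edges.map N.slots).sum = N.slotDist u v := by
  obtain ⟨p, hp⟩ := exists_walk_of_wdist (ω := N.slots) (hN.connected u v)
  rw [← hN.coe_slotDist] at hp
  exact ⟨p, by exact_mod_cast hp⟩

theorem Proportional.slotDist_triangle (u v w : V) :
    N.slotDist u w ≤ N.slotDist u v + N.slotDist v w := by
  obtain ⟨p, hp⟩ := hN.exists_walk_slotDist u v
  obtain ⟨q, hq⟩ := hN.exists_walk_slotDist v w
  have := hN.slotDist_le_walk (p.append q)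
  simpa [hp, hq] using this

theorem Proportional.slotDist_adj {a b : V} (h : N.graph.Adj a b) :
    N.slotDist a b ≤ N.slots s(a, b) := by
  simpa using hN.slotDist_le_walk (SimpleGraph.Walk.cons h .nil)

theorem Proportional.slotDist_le_add (v : V) {a b : V} (h : N.graph.Adj a b) :
    N.slotDist v b ≤ N.slotDist v a + N.slots s(a, b) :=
  (hN.slotDist_triangle v a b).trans (by have := hN.slotDist_adj h; omega)

theorem Proportional.exists_pred (v : V) {a : V} (h : a ≠ v) :
    ∃ b, N.graph.Adj a b ∧ N.slotDist v a = N.slotDist v b + N.slots s(a, b) := by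
  obtain ⟨p, hp⟩ := hN.exists_walk_slotDist a v
  cases p with
  | nil => exact absurd rfl h
  | @cons _ b _ hab p =>
    refine ⟨b, hab, le_antisymm ?_ ?_⟩
    · have := hN.slotDist_le_add v hab.symm
      rwa [Sym2.eq_swap] at this
    · have := hN.slotDist_le_walk p
      simp only [SimpleGraph.Walk.edges_cons, List.map_cons, List.sum_cons] at hp
      rw [slotDist_comm v b, slotDist_comm v a]
      omega

theorem Proportional.slotDist_eq_zero {u v : V} : N.slotDist u v = 0 ↔ v = u := by
  constructor
  · intro h
    by_contra hne
    obtain ⟨b, hb, he⟩ := hN.exists_pred u hne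
    have := hN.slots_pos _ _ hb
    omega
  · rintro rfl; exact slotDist_self _

theorem Proportional.wdist_weight (u v : V) :
    wdist N.graph N.weight u v = ((κ * N.slotDist u v : ℕ) : ℕ∞) := by
  refine wdist_eq_of_potential (f := fun v => κ * N.slotDist u v) (by simp [slotDist_self])
    ?_ ?_ ?_ v
  · intro a b h
    rw [hN.weight_eq a b h]
    exact Nat.mul_pos hN.factor_pos (hN.slots_pos a b h)
  · intro a b h
    rw [hN.weight_eq a b h, ← Nat.mul_add]
    exact Nat.mul_le_mul_left _ (hN.slotDist_le_add u h)
  · intro a ha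
    obtain ⟨b, hb, he⟩ := hN.exists_pred u ha
    exact ⟨b, hb, by rw [hN.weight_eq a b hb, ← Nat.mul_add, he]⟩

theorem Proportional.le_wdiam (u v : V) :
    ((κ * N.slotDist u v : ℕ) : ℕ∞) ≤ wdiam N.graph N.weight := by
  rw [← hN.wdist_weight]
  exact le_iSup_of_le u (le_iSup (fun v => wdist N.graph N.weight u v) v)

/-- A simple path has fewer edges than there are vertices. The bound serves only the message
lengths. -/
theorem Proportional.slotDist_mul_le {W : ℕ} (hW : ∀ e ∈ N.graph.edgeSet, N.weight e ≤ W)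
    (u v : V) : κ * N.slotDist u v ≤ V.card * W := by
  classical
  obtain ⟨p, hp⟩ := hN.connected.exists_isPath u v
  have h1 := wdist_le_walk (ω := N.weight) p
  rw [hN.wdist_weight] at h1
  have h2 : κ * N.slotDist u v ≤ (p.edges.map N.weight).sum := by exact_mod_cast h1
  refine h2.trans ?_
  have h3 : (p.edges.map N.weight).sum ≤ (p.edges.map N.weight).length • W := by
    apply List.sum_le_card_nsmul
    intro x hx
    obtain ⟨e, he, rfl⟩ := List.mem_map.1 hx
    exact hW e (p.edges_subset_edgeSet he)
  have h4 := hp.length_lt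
  simp only [List.length_map, SimpleGraph.Walk.length_edges, smul_eq_mul, Fintype.card_coe] at h3 h4
  exact h3.trans (Nat.mul_le_mul_right _ h4.le)

end Distances

end Net

namespace Net

variable {V : Finset ℕ}

/-! ## Distances of sites -/

section Sites

variable {N : Net V} {κ : ℕ}

theorem inf_ne_sup (e : N.graph.edgeSet) : (e : Sym2 V).inf ≠ (e : Sym2 V).sup := by
  obtain ⟨e, he⟩ := e
  induction e with
  | _ a b =>
    have := N.graph.ne_of_adj he
    rcases le_total a b with h | h <;> simpa [h] using by tauto

theorem adj_inf_sup (e : N.graph.edgeSet) :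
    N.graph.Adj (e : Sym2 V).inf (e : Sym2 V).sup := by
  rw [← SimpleGraph.mem_edgeSet, mk_inf_sup]; exact e.2

/-- Distance of a site from the processor `v` in unit steps. -/
noncomputable def siteDist (N : Net V) (v : V) : N.Site → ℕ
  | .inl a => N.slotDist v a
  | .inr ⟨e, i⟩ =>
    min (N.slotDist v (e : Sym2 V).inf + (i + 1))
      (N.slotDist v (e : Sym2 V).sup + (N.slots e - (i + 1)))

theorem siteAdj_symm {x y : N.Site} (h : N.SiteAdj x y) : N.SiteAdj y x := by
  rcases x with a | ⟨e, i⟩ <;> rcases y with b | ⟨f, j⟩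
  · exact ⟨h.1.symm, by rw [Sym2.eq_swap]; exact h.2⟩
  · exact h
  · exact h
  · exact ⟨h.1.symm, h.2.symm⟩

section

variable (hN : N.Proportional κ)
include hN

theorem Proportional.slotDist_inf_sup (v : V) (e : N.graph.edgeSet) :
    N.slotDist v (e : Sym2 V).sup ≤ N.slotDist v (e : Sym2 V).inf + N.slots e ∧
      N.slotDist v (e : Sym2 V).inf ≤ N.slotDist v (e : Sym2 V).sup + N.slots e := by
  have h1 := hN.slotDist_le_add v (adj_inf_sup e)
  have h2 := hN.slotDist_le_add v (adj_inf_sup e).symm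
  rw [mk_inf_sup] at h1
  rw [Sym2.eq_swap, mk_inf_sup] at h2
  exact ⟨h1, h2⟩

theorem Proportional.siteDist_le_succ (v : V) {x y : N.Site} (h : N.SiteAdj x y) :
    N.siteDist v y ≤ N.siteDist v x + 1 := by
  rcases x with a | ⟨e, i⟩ <;> rcases y with b | ⟨f, j⟩
  · have := hN.slotDist_le_add v h.1
    rw [h.2] at this
    exact this
  · simp only [siteDist]
    rcases h with ⟨rfl, h⟩ | ⟨rfl, h⟩ <;> omega
  · have := hN.slotDist_inf_sup v e
    simp only [siteDist]
    rcases h with ⟨rfl, h⟩ | ⟨rfl, h⟩ <;> omega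
  · obtain ⟨rfl, h⟩ := h
    simp only [siteDist]
    omega

theorem Proportional.siteDist_eq_zero (v : V) {x : N.Site} :
    N.siteDist v x = 0 ↔ x = .inl v := by
  rcases x with a | ⟨e, i⟩
  · simp [siteDist, hN.slotDist_eq_zero]
  · simp only [siteDist, reduceCtorEq, iff_false]
    omega

theorem Proportional.exists_siteAdj_lt (v : V) {x : N.Site} (hx : N.siteDist v x ≠ 0) :
    ∃ y, N.SiteAdj x y ∧ N.siteDist v x = N.siteDist v y + 1 := by
  -- The opposite inequality is the Lipschitz bound. It remains to step towards `v`: from a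
  -- processor onto the edge to a predecessor, from a relay towards the end attaining the minimum in
  -- `siteDist`.
  suffices h : ∃ y, N.SiteAdj x y ∧ N.siteDist v y + 1 ≤ N.siteDist v x by
    obtain ⟨y, hy, h⟩ := h
    exact ⟨y, hy, le_antisymm (hN.siteDist_le_succ v (siteAdj_symm hy)) h⟩
  rcases x with a | ⟨e, i⟩
  · have hav : a ≠ v := by
      rintro rfl
      exact hx ((hN.siteDist_eq_zero _).2 rfl)
    obtain ⟨b, hab, he⟩ := hN.exists_pred v hav
    have hs := hN.slots_pos a b hab
    by_cases h1 : N.slots s(a, b) = 1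
    · exact ⟨.inl b, ⟨hab, h1⟩, by simp only [siteDist]; omega⟩
    · rcases lt_or_gt_of_ne hab.ne with hlt | hlt
      · refine ⟨.inr ⟨⟨s(a, b), hab⟩, ⟨0, by simp only; omega⟩⟩, .inl ⟨?_, rfl⟩, ?_⟩
        · simp [hlt.le]
        · simp only [siteDist, Sym2.inf_mk, Sym2.sup_mk, inf_eq_left.2 hlt.le,
            sup_eq_right.2 hlt.le]
          omega
      · refine ⟨.inr ⟨⟨s(a, b), hab⟩, ⟨N.slots s(a, b) - 2, by simp only; omega⟩⟩,
          .inr ⟨?_, ?_⟩, ?_⟩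
        · simp [hlt.le]
        · simp only; omega
        · simp only [siteDist, Sym2.inf_mk, Sym2.sup_mk, inf_eq_right.2 hlt.le,
            sup_eq_left.2 hlt.le]
          omega
  · have hi := i.2
    by_cases hmin : N.slotDist v (e : Sym2 V).inf + (i + 1) ≤
        N.slotDist v (e : Sym2 V).sup + (N.slots e - (i + 1))
    · by_cases h0 : (i : ℕ) = 0
      · exact ⟨.inl (e : Sym2 V).inf, .inl ⟨rfl, h0⟩, by simp only [siteDist]; omega⟩
      · refine ⟨.inr ⟨e, ⟨i - 1, by omega⟩⟩, ⟨rfl, .inr ?_⟩, ?_⟩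
        · simp only; omega
        · simp only [siteDist]; omega
    · by_cases h0 : (i : ℕ) + 2 = N.slots e
      · exact ⟨.inl (e : Sym2 V).sup, .inr ⟨rfl, h0⟩, by simp only [siteDist]; omega⟩
      · refine ⟨.inr ⟨e, ⟨i + 1, by omega⟩⟩, ⟨rfl, .inl rfl⟩, ?_⟩
        simp only [siteDist]; omega

end

theorem stepEdge_mem {x y : N.Site} (h : N.SiteAdj x y) : N.stepEdge x y ∈ N.graph.edgeSet := by
  rcases x with a | ⟨e, i⟩ <;> rcases y with b | ⟨f, j⟩
  · exact h.1
  · exact f.2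
  · exact e.2
  · exact e.2

theorem Proportional.stepWeight_eq (hN : N.Proportional κ) {x y : N.Site}
    (h : N.stepEdge x y ∈ N.graph.edgeSet) : N.stepWeight x y = κ := by
  unfold stepWeight
  generalize N.stepEdge x y = e at h
  induction e with
  | _ a b =>
    rw [hN.weight_eq a b h]
    exact Nat.mul_div_cancel _ (hN.slots_pos a b h)

theorem across_spec {a : V} {y : N.Site} (h : N.SiteAdj (.inl a) y) :
    N.graph.Adj a (N.across a y) ∧ N.stepEdge (.inl a) y = s(a, N.across a y) := by
  rcases y with b | ⟨e, i⟩
  · exact ⟨h.1, rfl⟩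
  · have h1 := adj_inf_sup e
    simp only [across, stepEdge]
    rcases h with ⟨rfl, h⟩ | ⟨rfl, h⟩
    · rw [if_pos rfl]
      exact ⟨h1, (mk_inf_sup _).symm⟩
    · rw [if_neg (inf_ne_sup e).symm]
      exact ⟨h1.symm, by rw [Sym2.eq_swap, mk_inf_sup]⟩

/-- The neighbours of a relay lie on its edge. -/
theorem relay_adj {e : N.graph.edgeSet} {i : Fin (N.slots e - 1)} {y : N.Site}
    (h : N.SiteAdj (.inr ⟨e, i⟩) y) :
    y = .inl (e : Sym2 V).inf ∨ y = .inl (e : Sym2 V).sup ∨ ∃ j, y = .inr ⟨e, j⟩ := by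
  rcases y with b | ⟨f, j⟩
  · rcases h with ⟨rfl, h⟩ | ⟨rfl, h⟩ <;> simp
  · obtain ⟨rfl, h⟩ := h
    exact .inr (.inr ⟨j, rfl⟩)

/-- A relay has at most two neighbours. -/
theorem relay_adj_unique {r : Σ e : N.graph.edgeSet, Fin (N.slots e - 1)} {y y' : N.Site}
    (h : N.SiteAdj (.inr r) y) (h' : N.SiteAdj (.inr r) y')
    (hp : N.sitePort (.inr r) y = N.sitePort (.inr r) y') : y = y' := by
  obtain ⟨e, i⟩ := r
  have hne := inf_ne_sup e
  have hi := i.2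
  rcases y with b | ⟨f, j⟩ <;> rcases y' with b' | ⟨f', j'⟩
  · simp only [sitePort] at hp
    rcases h with ⟨rfl, h⟩ | ⟨rfl, h⟩ <;> rcases h' with ⟨rfl, h'⟩ | ⟨rfl, h'⟩ <;>
      simp_all
  · obtain ⟨rfl, h'⟩ := h'
    simp only [sitePort] at hp
    have := j'.2
    rcases h with ⟨rfl, h⟩ | ⟨rfl, h⟩
    · simp at hp; omega
    · simp [hne.symm] at hp; omega
  · obtain ⟨rfl, h⟩ := h
    simp only [sitePort] at hp
    have := j.2
    rcases h' with ⟨rfl, h'⟩ | ⟨rfl, h'⟩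
    · simp at hp; omega
    · simp [hne.symm] at hp; omega
  · obtain ⟨rfl, h⟩ := h
    obtain ⟨rfl, h'⟩ := h'
    simp only [sitePort] at hp
    have : (j : ℕ) = j' := by
      split_ifs at hp <;> omega
    rw [Fin.ext this]

theorem sitePort_relay_lt (r : Σ e : N.graph.edgeSet, Fin (N.slots e - 1)) (y : N.Site) :
    N.sitePort (.inr r) y < 2 := by
  obtain ⟨e, i⟩ := r
  rcases y with b | ⟨f, j⟩ <;> simp only [sitePort] <;> split_ifs <;> omega

/-- Ports of a relay take two values and determine the neighbour, so excluding one neighbour leaves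
one choice. -/
theorem relay_adj_third {r : Σ e : N.graph.edgeSet, Fin (N.slots e - 1)} {p y y' : N.Site}
    (hp : N.SiteAdj (.inr r) p) (h : N.SiteAdj (.inr r) y) (h' : N.SiteAdj (.inr r) y')
    (hy : y ≠ p) (hy' : y' ≠ p) : y = y' := by
  have h1 := mt (relay_adj_unique h hp) hy
  have h2 := mt (relay_adj_unique h' hp) hy'
  have := sitePort_relay_lt r y
  have := sitePort_relay_lt r y'
  have := sitePort_relay_lt r p
  exact relay_adj_unique h h' (by omega)

/-- The IDs of the elements of `S`. -/
noncomputable def ids (N : Net V) : Finset ℕ := N.S.image Subtype.val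

/-- Distance of a site from the processor with ID `v`. -/
noncomputable def idDist (N : Net V) (x : N.Site) (v : ℕ) : ℕ :=
  if h : v ∈ V then N.siteDist ⟨v, h⟩ x else 0

@[simp] theorem idDist_coe (x : N.Site) (v : V) : N.idDist x v = N.siteDist v x := by
  simp [idDist]

theorem mem_ids {v : ℕ} : v ∈ N.ids ↔ ∃ a ∈ N.S, (a : ℕ) = v := by
  simp [ids]

theorem coe_mem_ids {a : V} : (a : ℕ) ∈ N.ids ↔ a ∈ N.S := by
  simp [ids]

theorem card_ids : N.ids.card = N.S.card :=
  Finset.card_image_of_injective _ Subtype.val_injective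

/-- This is the only input about the network that the abstract analysis of flooding needs; from here
on a relay and a processor are treated alike. -/
theorem Proportional.waveDist (hN : N.Proportional κ) : WaveDist N.SiteAdj N.ids N.idDist where
  symm := siteAdj_symm
  le_succ := by
    intro x y h v hv
    obtain ⟨a, -, rfl⟩ := mem_ids.1 hv
    simpa using hN.siteDist_le_succ a h
  pred := by
    intro x v hv h
    obtain ⟨a, -, rfl⟩ := mem_ids.1 hv
    simpa using hN.exists_siteAdj_lt a (by simpa using h)
  zero_unique := by
    intro x v hv w hw h1 h2
    obtain ⟨a, -, rfl⟩ := mem_ids.1 hv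
    obtain ⟨b, -, rfl⟩ := mem_ids.1 hw
    rw [idDist_coe, hN.siteDist_eq_zero] at h1 h2
    simpa [h1] using h2

end Sites

end Net

/-! ## Auxiliary facts -/

theorem firstBy_spec {α : Type} {f : α → ℕ} {p : α → Prop} {y : α} (h : firstBy f p = some y) :
    p y := by
  unfold firstBy at h
  split_ifs at h with hex
  cases h
  exact hex.choose_spec.1

theorem exists_firstBy {α : Type} (f : α → ℕ) {p : α → Prop} (h : ∃ y, p y) :
    ∃ y, firstBy f p = some y ∧ p y := by
  classical
  have hex : ∃ y, p y ∧ ∀ z, p z → f y ≤ f z := by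
    have h' : ∃ n y, p y ∧ f y = n := by
      obtain ⟨y, hy⟩ := h
      exact ⟨_, y, hy, rfl⟩
    obtain ⟨y, hy, he⟩ := Nat.find_spec h'
    exact ⟨y, hy, fun z hz => he ▸ Nat.find_min' h' ⟨z, hz, rfl⟩⟩
  have : firstBy f p = some hex.choose := by
    unfold firstBy
    rw [dif_pos hex]
  exact ⟨_, this, firstBy_spec this⟩

theorem Finset.coe_lt_min_iff {A : Finset ℕ} {v : ℕ} :
    (v : WithTop ℕ) < A.min ↔ ∀ w ∈ A, v < w := by
  constructor
  · intro h w hw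
    exact WithTop.coe_lt_coe.1 (h.trans_le (Finset.min_le hw))
  · intro h
    rcases A.eq_empty_or_nonempty with rfl | hA
    · simp
    · rw [← Finset.coe_min' hA]
      exact WithTop.coe_lt_coe.2 (h _ (A.min'_mem hA))

theorem Finset.min_lt_coe_iff {A : Finset ℕ} {v : ℕ} :
    A.min < (v : WithTop ℕ) ↔ ∃ w ∈ A, w < v := by
  constructor
  · intro h
    by_contra! hcon
    exact absurd h (not_lt.2 (Finset.le_min fun w hw => WithTop.coe_le_coe.2 (hcon w hw)))
  · rintro ⟨w, hw, h⟩
    exact (Finset.min_le hw).trans_lt (WithTop.coe_lt_coe.2 h)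

theorem Finset.coe_eq_min_iff {A : Finset ℕ} {v : ℕ} :
    (v : WithTop ℕ) = A.min ↔ v ∈ A ∧ ∀ w ∈ A, v ≤ w := by
  constructor
  · intro h
    exact ⟨Finset.mem_of_min h.symm,
      fun w hw => WithTop.coe_le_coe.1 (h.trans_le (Finset.min_le hw))⟩
  · rintro ⟨h1, h2⟩
    exact le_antisymm (Finset.le_min fun w hw => WithTop.coe_le_coe.2 (h2 w hw))
      (Finset.min_le h1)

namespace Net

variable {V : Finset ℕ} {N : Net V} {κ : ℕ}

/-! ## The construction of the trees -/

/-- The slot in which the ID `v` arrives at the site `x`. -/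
noncomputable def arrival (N : Net V) (x : N.Site) (v : ℕ) : ℕ :=
  sInf {t | Arrived N.SiteAdj N.ids N.idDist x v t}

theorem arrival_le {x : N.Site} {v t : ℕ} (h : Arrived N.SiteAdj N.ids N.idDist x v t) :
    N.arrival x v ≤ t :=
  Nat.sInf_le h

theorem arrived_arrival {x : N.Site} {v t : ℕ} (h : Arrived N.SiteAdj N.ids N.idDist x v t) :
    Arrived N.SiteAdj N.ids N.idDist x v (N.arrival x v) :=
  Nat.sInf_mem (s := {t | Arrived N.SiteAdj N.ids N.idDist x v t}) ⟨t, h⟩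

theorem arrival_eq_succ {x : N.Site} {v t : ℕ}
    (h : Arrived N.SiteAdj N.ids N.idDist x v (t + 1))
    (h' : ¬ Arrived N.SiteAdj N.ids N.idDist x v t) : N.arrival x v = t + 1 := by
  refine le_antisymm (arrival_le h) ?_
  by_contra hcon
  exact h' ((arrived_arrival h).mono (by omega))

/-- One if the site is an element of `S`, and zero otherwise. -/
noncomputable def ind (N : Net V) : N.Site → ℕ
  | .inl a => if a ∈ N.S then 1 else 0
  | .inr _ => 0

/-- The memory of a site after `t` slots of the construction of the trees. -/
structure TreeInv (N : Net V) (κ t : ℕ) (x : N.Site) (s : N.SiteState) : Prop where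
  L : ∀ v, v ∈ s.L ↔ v ∈ N.ids ∧ Arrived N.SiteAdj N.ids N.idDist x v t
  todo : ∀ y, N.SiteAdj x y → ∀ v, v ∈ s.todo y ↔
    v ∈ N.ids ∧ Arrived N.SiteAdj N.ids N.idDist x v t ∧ ¬ Crossed N.ids N.idDist x y v t
  delay : ∀ v, v ∈ s.delay ↔
    v ∈ N.ids ∧ Arrived N.SiteAdj N.ids N.idDist x v t ∧ ¬ Released N.ids N.idDist x v t
  tau : ∀ v ∈ N.ids, Arrived N.SiteAdj N.ids N.idDist x v t → s.tau v = (N.arrival x v : ℕ∞)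
  om : ∀ v ∈ N.ids, Arrived N.SiteAdj N.ids N.idDist x v t → s.om v = κ * N.idDist x v
  par_none : ∀ v ∈ N.ids, N.idDist x v = 0 → s.par v = none
  -- Apart from the decrease of the distance, the pointer remembers that the wave crossed this very
  -- step by its arrival slot and that the parent was reached strictly earlier; the reversed run
  -- uses both.
  par : ∀ v ∈ N.ids, Arrived N.SiteAdj N.ids N.idDist x v t → N.idDist x v ≠ 0 →
    ∃ y, s.par v = some y ∧ N.SiteAdj x y ∧ N.idDist x v = N.idDist y v + 1 ∧
      Crossed N.ids N.idDist x y v (N.arrival x v) ∧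
      Arrived N.SiteAdj N.ids N.idDist y v (N.arrival y v) ∧ N.arrival y v < N.arrival x v
  rc : ∀ v, s.rc v = 0
  z : ∀ v, s.z v = N.ind x

section

variable (hN : N.Proportional κ)
include hN

theorem Proportional.treeInv_init (x : N.Site) : N.TreeInv κ 0 x (N.siteInit x) := by
  have hd := hN.waveDist
  have key : ∀ v ∈ N.ids, (Arrived N.SiteAdj N.ids N.idDist x v 0 ↔
      ∃ a ∈ N.S, (a : ℕ) = v ∧ x = .inl a) := by
    intro v hv
    obtain ⟨a, ha, rfl⟩ := mem_ids.1 hv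
    rw [arrived_zero_iff, idDist_coe, hN.siteDist_eq_zero]
    constructor
    · intro h; exact ⟨a, ha, rfl, h⟩
    · rintro ⟨b, hb, he, hx⟩
      rw [hx, Subtype.ext he]
  have harr : ∀ v, N.idDist x v = 0 → N.arrival x v = 0 := fun v h =>
    Nat.le_zero.1 (arrival_le (arrived_zero_iff.2 h))
  have key2 : ∀ v, (v ∈ N.ids ∧ Arrived N.SiteAdj N.ids N.idDist x v 0) ↔
      ∃ a ∈ N.S, (a : ℕ) = v ∧ x = .inl a := by
    intro v
    constructor
    · rintro ⟨h, h'⟩; exact (key v h).1 h'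
    · rintro ⟨a, ha, rfl, hx⟩
      exact ⟨coe_mem_ids.2 ha, (key _ (coe_mem_ids.2 ha)).2 ⟨a, ha, rfl, hx⟩⟩
  have hom : ∀ v, (N.siteInit x).om v = 0 := by
    intro v
    rcases x with a | ⟨e, i⟩
    · simp only [siteInit]; split_ifs <;> rfl
    · rfl
  have hL : ∀ v, v ∈ (N.siteInit x).L ↔ ∃ a ∈ N.S, (a : ℕ) = v ∧ x = .inl a := by
    intro v
    rcases x with a | ⟨e, i⟩
    · simp only [siteInit, Sum.inl.injEq]
      split_ifs with h
      · simp only [Finset.mem_singleton]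
        exact ⟨fun he => ⟨a, h, he.symm, rfl⟩, by rintro ⟨b, -, rfl, rfl⟩; rfl⟩
      · simp only [Finset.notMem_empty, false_iff]
        rintro ⟨b, hb, -, rfl⟩
        exact h hb
    · simp [siteInit]
  constructor
  · intro v
    rw [hL, key2]
  · intro y _ v
    have : (N.siteInit x).todo y = (N.siteInit x).L := by
      rcases x with a | ⟨e, i⟩
      · simp only [siteInit]; split_ifs <;> rfl
      · rfl
    rw [this, hL, ← and_assoc, key2, and_iff_left not_crossed_zero]
  · intro v
    have : (N.siteInit x).delay = ∅ := by
      rcases x with a | ⟨e, i⟩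
      · simp only [siteInit]; split_ifs <;> rfl
      · rfl
    rw [this]
    simp only [Finset.notMem_empty, false_iff]
    rintro ⟨h1, h2, h3⟩
    exact h3 (hd.released_zero h1 (arrived_zero_iff.1 h2))
  · intro v hv h
    rw [harr v (arrived_zero_iff.1 h)]
    obtain ⟨a, ha, rfl, rfl⟩ := (key v hv).1 h
    simp [siteInit, ha]
  · intro v hv h
    rw [hom, arrived_zero_iff.1 h, mul_zero]
  · intro v hv h
    rcases x with a | ⟨e, i⟩
    · simp only [siteInit]; split_ifs <;> rfl
    · rfl
  · intro v hv h h'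
    exact absurd (arrived_zero_iff.1 h) h'
  · intro v
    rcases x with a | ⟨e, i⟩
    · simp only [siteInit]; split_ifs <;> rfl
    · rfl
  · intro v
    rcases x with a | ⟨e, i⟩
    · simp only [siteInit, ind]; split_ifs <;> rfl
    · rfl

end

/-! ### One slot of the tree construction, field by field -/

open Classical in
/-- The IDs successfully received from `y` in a slot of the construction of the trees. -/
noncomputable def received (s : N.SiteState) (inbox : N.Site → Option Msg) (y : N.Site) :
    Finset ℕ :=
  match inbox y with
  | some (.wave v _) => if (v : WithTop ℕ) < offer s y then {v} else ∅
  | _ => ∅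

open Classical in
/-- The IDs received for the first time in a slot of the construction of the trees. -/
noncomputable def receivedNew (s : N.SiteState) (inbox : N.Site → Option Msg) : Finset ℕ :=
  (Finset.univ.biUnion (received s inbox)) \ s.L

theorem mem_received {s : N.SiteState} {inbox : N.Site → Option Msg} {y : N.Site} {v : ℕ} :
    v ∈ received s inbox y ↔
      (∃ d, inbox y = some (.wave v d)) ∧ (v : WithTop ℕ) < offer s y := by
  unfold received
  split
  · next w d h =>
    split_ifs with hlt
    · rw [Finset.mem_singleton]
      constructor
      · rintro rfl; exact ⟨⟨d, h⟩, hlt⟩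
      · rintro ⟨⟨d', h'⟩, -⟩
        rw [h] at h'
        simp only [Option.some.injEq, Msg.wave.injEq] at h'
        exact h'.1.symm
    · simp only [Finset.notMem_empty, false_iff]
      rintro ⟨⟨d', h'⟩, h2⟩
      rw [h] at h'
      simp only [Option.some.injEq, Msg.wave.injEq] at h'
      exact hlt (h'.1 ▸ h2)
  · next h =>
    simp only [Finset.notMem_empty, false_iff]
    rintro ⟨⟨d', h'⟩, -⟩
    exact h _ _ h'

theorem mem_receivedNew {s : N.SiteState} {inbox : N.Site → Option Msg} {v : ℕ} :
    v ∈ receivedNew s inbox ↔ (∃ y, v ∈ received s inbox y) ∧ v ∉ s.L := by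
  simp [receivedNew]

section

variable {t : ℕ} {x : N.Site} {s : N.SiteState} {inbox : N.Site → Option Msg} {v : ℕ}

theorem mem_treeStep_L :
    v ∈ (N.treeStep t s x inbox).L ↔ v ∈ s.L ∨ v ∈ receivedNew s inbox :=
  Finset.mem_union

theorem mem_treeStep_todo {y : N.Site} :
    v ∈ (N.treeStep t s x inbox).todo y ↔
      ((v ∈ s.todo y ∧ (received s inbox y = ∅ → (v : WithTop ℕ) ≠ offer s y)) ∨
        v ∈ receivedNew s inbox) ∧ v ∉ received s inbox y := by
  refine Finset.mem_sdiff.trans (and_congr (Finset.mem_union.trans (or_congr ?_ Iff.rfl)) Iff.rfl)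
  change v ∈ (if received s inbox y = ∅ then _ else _) ↔ _
  split_ifs with h
  · simp [h]
  · simp [h]

theorem mem_treeStep_delay :
    v ∈ (N.treeStep t s x inbox).delay ↔
      (v ∈ s.delay ∧ ¬ ((v : WithTop ℕ) = s.delay.min ∧ s.delay.min ≤ (receivedNew s inbox).min)) ∨
        (v ∈ receivedNew s inbox ∧ ((receivedNew s inbox).min < v ∨ s.delay.min < v)) :=
  Finset.mem_union.trans (or_congr Finset.mem_filter Finset.mem_filter)

open Classical in
theorem treeStep_tau :
    (N.treeStep t s x inbox).tau v = if v ∈ receivedNew s inbox then (t : ℕ∞) else s.tau v := by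
  rfl

open Classical in
theorem treeStep_om :
    (N.treeStep t s x inbox).om v = if v ∈ receivedNew s inbox then
      (match (firstBy (N.sitePort x) fun y => v ∈ received s inbox y).bind inbox with
        | some (.wave _ d) => d
        | _ => 0)
      else s.om v := by
  rfl

open Classical in
theorem treeStep_par :
    (N.treeStep t s x inbox).par v = if v ∈ receivedNew s inbox then
      firstBy (N.sitePort x) (fun y => v ∈ received s inbox y) else s.par v := by
  rfl

end

/-! ### The local rules follow the slot assignment -/

section Step

variable {t : ℕ} {x : N.Site} {s : N.SiteState} {st : N.Site → N.SiteState}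
  {inbox : N.Site → Option Msg}

/-- Arrival can be dropped from the description of the candidates for transmission, since a released
wave has arrived. -/
theorem TreeInv.mem_offer (h : N.TreeInv κ t x s) (hd : WaveDist N.SiteAdj N.ids N.idDist)
    {y : N.Site} (hxy : N.SiteAdj x y) {v : ℕ} :
    v ∈ s.todo y \ s.delay ↔
      v ∈ N.ids ∧ Released N.ids N.idDist x v t ∧ ¬ Crossed N.ids N.idDist x y v t := by
  rw [Finset.mem_sdiff, h.todo y hxy, h.delay]
  constructor
  · rintro ⟨⟨h1, h2, h3⟩, h4⟩
    exact ⟨h1, by tauto, h3⟩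
  · rintro ⟨h1, h2, h3⟩
    exact ⟨⟨h1, hd.arrived_of_released h1 h2, h3⟩, by tauto⟩

theorem siteSend_tree {t' : ℕ} {y : N.Site} {m : Msg}
    (h : N.siteSend (.tree t') s x y = some m) :
    ∃ v ∈ s.todo y \ s.delay, (∀ w ∈ s.todo y \ s.delay, v ≤ w) ∧
      m = .wave v (s.om v + N.stepWeight x y) := by
  unfold siteSend at h
  simp only at h
  split_ifs at h with hne
  exact ⟨_, Finset.min'_mem _ hne, fun w hw => Finset.min'_le _ _ hw, by simpa using h.symm⟩

theorem siteSend_tree_eq {t' : ℕ} {y : N.Site} {v : ℕ} (h : v ∈ s.todo y \ s.delay)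
    (h' : ∀ w ∈ s.todo y \ s.delay, v ≤ w) :
    N.siteSend (.tree t') s x y = some (.wave v (s.om v + N.stepWeight x y)) := by
  have hne : (s.todo y \ s.delay).Nonempty := ⟨v, h⟩
  have hv : (s.todo y \ s.delay).min' hne = v :=
    le_antisymm (Finset.min'_le _ _ h) (h' _ (Finset.min'_mem _ hne))
  unfold siteSend
  simp only [dif_pos hne, hv]

variable (hN : N.Proportional κ) (hst : ∀ x, N.TreeInv κ t x (st x))
  {t' : ℕ} (hin : ∀ y, N.SiteAdj x y → inbox y = N.siteSend (.tree t') (st y) y x)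
  (hin' : ∀ y, ¬ N.SiteAdj x y → inbox y = none)
include hN hst hin hin'

/-- An ID is successfully received from `y` if it is transmitted over the edge and has not yet been
released. -/
theorem Proportional.mem_received_iff {y : N.Site} {v : ℕ} :
    v ∈ received (st x) inbox y ↔ N.SiteAdj x y ∧ v ∈ N.ids ∧
      ¬ Crossed N.ids N.idDist x y v t ∧ Crossed N.ids N.idDist x y v (t + 1) ∧
      ¬ Released N.ids N.idDist x v t := by
  have hd := hN.waveDist
  rw [mem_received]
  constructor
  · rintro ⟨⟨d, h⟩, hlt⟩
    have hxy : N.SiteAdj x y := by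
      by_contra hcon
      rw [hin' y hcon] at h
      cases h
    rw [hin y hxy] at h
    obtain ⟨v', h1, h2, h3⟩ := siteSend_tree h
    cases h3
    rw [(hst y).mem_offer hd (siteAdj_symm hxy), crossed_comm] at h1
    rw [offer, Finset.coe_lt_min_iff] at hlt
    have hr : ¬ Released N.ids N.idDist x v t := fun hr =>
      lt_irrefl v (hlt v (((hst x).mem_offer hd hxy).2 ⟨h1.1, hr, h1.2.2⟩))
    refine ⟨hxy, h1.1, h1.2.2, ?_, hr⟩
    -- Otherwise the step belongs to a smaller wave `w` in this slot. The end nearer to the origin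
    -- of `w` has released it and would offer it: `y` would have sent `w` instead of `v`, or `x`
    -- would have offered an ID below `v`.
    by_contra hc
    obtain ⟨w, hw, hwI, hw1, hw2⟩ :=
      hd.edge_busy (siteAdj_symm hxy) h1.1 h1.2.1 (by rwa [crossed_comm])
    rcases le_total (N.idDist x w) (N.idDist y w) with hle | hle
    · have := hd.released_of_crossed hxy hle (crossed_comm.1 hw2)
      have := hlt w (((hst x).mem_offer hd hxy).2 ⟨hwI, this, by rwa [crossed_comm]⟩)
      omega
    · have := hd.released_of_crossed (siteAdj_symm hxy) hle hw2
      have := h2 w (((hst y).mem_offer hd (siteAdj_symm hxy)).2 ⟨hwI, this, hw1⟩)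
      omega
  · rintro ⟨hxy, hv, hc, hc', hr⟩
    have hyx := siteAdj_symm hxy
    have hry : Released N.ids N.idDist y v t := by
      rcases le_total (N.idDist x v) (N.idDist y v) with hle | hle
      · exact absurd (hd.released_of_crossed hxy hle hc') hr
      · exact hd.released_of_crossed hyx hle (crossed_comm.1 hc')
    have hmem : v ∈ (st y).todo x \ (st y).delay :=
      ((hst y).mem_offer hd hyx).2 ⟨hv, hry, by rwa [crossed_comm]⟩
    -- The wave owning the slot is the least among all candidates at either end, because any other
    -- candidate is blocked by a smaller wave, which by uniqueness is `v`.
    have hle : ∀ w ∈ N.ids, ¬ Crossed N.ids N.idDist x y w t →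
        (Released N.ids N.idDist x w t ∨ Released N.ids N.idDist y w t) → v ≤ w := by
      intro w hw hcw hrw
      by_cases hcw' : Crossed N.ids N.idDist x y w (t + 1)
      · exact (WaveDist.edge_unique hv hw hc hc' hcw hcw').le
      · have : ∃ w' < w, w' ∈ N.ids ∧ ¬ Crossed N.ids N.idDist x y w' t ∧
            Crossed N.ids N.idDist x y w' (t + 1) := by
          rcases hrw with hrw | hrw
          · exact hd.edge_busy hxy hw hrw hcw'
          · have := hd.edge_busy hyx hw hrw (by rwa [crossed_comm])
            simpa only [crossed_comm (x := y) (y := x)] using this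
        obtain ⟨w', hlt, hw', h1, h2⟩ := this
        exact (WaveDist.edge_unique hv hw' hc hc' h1 h2).trans_lt hlt |>.le
    constructor
    · refine ⟨_, (hin y hxy).trans (siteSend_tree_eq hmem fun w hw => ?_)⟩
      obtain ⟨h1, h2, h3⟩ := ((hst y).mem_offer hd hyx).1 hw
      exact hle w h1 (by rwa [crossed_comm]) (.inr h2)
    · rw [offer, Finset.coe_lt_min_iff]
      intro w hw
      obtain ⟨h1, h2, h3⟩ := ((hst x).mem_offer hd hxy).1 hw
      refine lt_of_le_of_ne (hle w h1 h3 (.inl h2)) ?_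
      rintro rfl
      exact hr h2

/-- A wave that has not arrived cannot have been released, so the extra condition in the description
of successful receptions is automatic for first arrivals. -/
theorem Proportional.mem_receivedNew_iff {v : ℕ} :
    v ∈ receivedNew (st x) inbox ↔ v ∈ N.ids ∧ ¬ Arrived N.SiteAdj N.ids N.idDist x v t ∧
      Arrived N.SiteAdj N.ids N.idDist x v (t + 1) := by
  have hd := hN.waveDist
  rw [mem_receivedNew, (hst x).L]
  simp only [hN.mem_received_iff hst hin hin']
  constructor
  · rintro ⟨⟨y, hxy, hv, h1, h2, h3⟩, h4⟩
    exact ⟨hv, fun h => h4 ⟨hv, h⟩, .inr ⟨y, hxy, h2⟩⟩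
  · rintro ⟨hv, h1, h2⟩
    refine ⟨?_, fun h => h1 h.2⟩
    rcases h2 with h2 | ⟨y, hxy, h2⟩
    · exact absurd (.inl h2) h1
    · exact ⟨y, hxy, hv, fun h => h1 (.inr ⟨y, hxy, h⟩), h2,
        fun h => h1 (hd.arrived_of_released hv h)⟩

omit hN hst hin hin' in
/-- In every slot the smallest waiting ID is released. -/
theorem released_succ_iff (hd : WaveDist N.SiteAdj N.ids N.idDist) {v : ℕ} (hv : v ∈ N.ids)
    (ha : Arrived N.SiteAdj N.ids N.idDist x v (t + 1))
    (hr : ¬ Released N.ids N.idDist x v t) :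
    Released N.ids N.idDist x v (t + 1) ↔ ∀ w ∈ N.ids,
      Arrived N.SiteAdj N.ids N.idDist x w (t + 1) → ¬ Released N.ids N.idDist x w t → v ≤ w := by
  constructor
  · intro h w hw haw hrw
    by_cases hrw' : Released N.ids N.idDist x w (t + 1)
    · exact (WaveDist.node_unique hv hw hr h hrw hrw').le
    · obtain ⟨w', hlt, hw', h1, h2⟩ := hd.node_busy hw haw hrw'
      exact (WaveDist.node_unique hv hw' hr h h1 h2).trans_lt hlt |>.le
  · intro h
    by_contra hcon
    obtain ⟨w, hlt, hw, h1, h2⟩ := hd.node_busy hv ha hcon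
    have := h w hw (hd.arrived_of_released hw h2) h1
    omega

/-- Inductive step of the closed form. Transmissions are governed by the edge assignment through the
description of successful receptions, and changes of `L_delay` by the site assignment through
`released_succ_iff`. -/
theorem Proportional.treeInv_step :
    N.TreeInv κ (t + 1) x (N.treeStep (t + 1) (st x) x inbox) := by
  classical
  have hd := hN.waveDist
  have hgot := fun y v => hN.mem_received_iff hst hin hin' (y := y) (v := v)
  have hR := fun v => hN.mem_receivedNew_iff hst hin hin' (v := v)
  have hsx := hst x
  set R := receivedNew (st x) inbox with hRdef
  have hsrc : ∀ v ∈ R, ∃ y, firstBy (N.sitePort x) (fun y => v ∈ received (st x) inbox y) = some y ∧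
      v ∈ received (st x) inbox y := fun v hv => exists_firstBy _ (mem_receivedNew.1 hv).1
  have hadj : ∀ v y, v ∈ R → v ∈ received (st x) inbox y →
      N.SiteAdj x y ∧ N.idDist x v = N.idDist y v + 1 ∧ Released N.ids N.idDist y v t := by
    intro v y hv hy
    obtain ⟨h1, h2, h3⟩ := (hR v).1 hv
    obtain ⟨hxy, -, h4, h5, h6⟩ := (hgot y v).1 hy
    -- Were `x` at least as near as `y`, it would have released `v` before the crossing. This is why
    -- first arrivals come along shortest paths.
    have hlt : ¬ N.idDist x v ≤ N.idDist y v := fun hle => h6 (hd.released_of_crossed hxy hle h5)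
    have := hd.le_succ (siteAdj_symm hxy) v h1
    exact ⟨hxy, by omega,
      hd.released_of_crossed (siteAdj_symm hxy) (by omega) (crossed_comm.1 h5)⟩
  have hRids : ∀ v ∈ N.ids, Arrived N.SiteAdj N.ids N.idDist x v (t + 1) → v ∉ R →
      Arrived N.SiteAdj N.ids N.idDist x v t := fun v hv h hvR =>
    by_contra fun h' => hvR ((hR v).2 ⟨hv, h', h⟩)
  -- Old delayed IDs and new arrivals together are exactly the IDs waiting for release in this slot.
  have hQ : ∀ v, v ∈ (st x).delay ∨ v ∈ R ↔
      v ∈ N.ids ∧ Arrived N.SiteAdj N.ids N.idDist x v (t + 1) ∧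
        ¬ Released N.ids N.idDist x v t := by
    intro v
    rw [hsx.delay, hR]
    constructor
    · rintro (⟨h1, h2, h3⟩ | ⟨h1, h2, h3⟩)
      · exact ⟨h1, h2.mono (by omega), h3⟩
      · exact ⟨h1, h3, fun h => h2 (hd.arrived_of_released h1 h)⟩
    · rintro ⟨h1, h2, h3⟩
      by_cases h : Arrived N.SiteAdj N.ids N.idDist x v t
      · exact .inl ⟨h1, h, h3⟩
      · exact .inr ⟨h1, h, h2⟩
  have hleast : ∀ v, v ∈ (st x).delay ∨ v ∈ R → (Released N.ids N.idDist x v (t + 1) ↔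
      (∀ w ∈ (st x).delay, v ≤ w) ∧ ∀ w ∈ R, v ≤ w) := by
    intro v hv
    obtain ⟨h1, h2, h3⟩ := (hQ v).1 hv
    rw [released_succ_iff hd h1 h2 h3]
    constructor
    · intro h
      exact ⟨fun w hw => by obtain ⟨a, b, c⟩ := (hQ w).1 (.inl hw); exact h w a b c,
        fun w hw => by obtain ⟨a, b, c⟩ := (hQ w).1 (.inr hw); exact h w a b c⟩
    · rintro ⟨h4, h5⟩ w a b c
      exact ((hQ w).2 ⟨a, b, c⟩).elim (h4 w) (h5 w)
  constructor
  · intro v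
    rw [mem_treeStep_L, hsx.L, hR]
    constructor
    · rintro (⟨h1, h2⟩ | ⟨h1, h2, h3⟩)
      · exact ⟨h1, h2.mono (by omega)⟩
      · exact ⟨h1, h3⟩
    · rintro ⟨h1, h2⟩
      by_cases h : Arrived N.SiteAdj N.ids N.idDist x v t
      · exact .inl ⟨h1, h⟩
      · exact .inr ⟨h1, h, h2⟩
  · intro y hxy v
    rw [mem_treeStep_todo, hgot, hsx.todo y hxy]
    have hoff : (v : WithTop ℕ) = offer (st x) y ↔ v ∈ (st x).todo y \ (st x).delay ∧
        ∀ w ∈ (st x).todo y \ (st x).delay, v ≤ w := Finset.coe_eq_min_iff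
    constructor
    · rintro ⟨⟨⟨hv, ha, hc⟩, hmin⟩ | hvR, hn⟩
      -- If `v` crosses now but is not received here, then `x` has released it and it is the ID that
      -- `x` itself sends. Nothing else can be received over the same step, so the rule deletes `v`.
      · refine ⟨hv, ha.mono (by omega), fun hc' => ?_⟩
        have hr : Released N.ids N.idDist x v t := by
          by_contra hr
          exact hn ⟨hxy, hv, hc, hc', hr⟩
        refine hmin (Finset.eq_empty_of_forall_notMem fun w hw => ?_) (hoff.2 ⟨?_, fun w hw => ?_⟩)
        · obtain ⟨-, h1, h2, h3, h4⟩ := (hgot y w).1 hw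
          exact h4 (WaveDist.edge_unique hv h1 hc hc' h2 h3 ▸ hr)
        · exact (hsx.mem_offer hd hxy).2 ⟨hv, hr, hc⟩
        · obtain ⟨h1, h2, h3⟩ := (hsx.mem_offer hd hxy).1 hw
          by_cases h4 : Crossed N.ids N.idDist x y w (t + 1)
          · exact (WaveDist.edge_unique hv h1 hc hc' h3 h4).le
          · obtain ⟨w', hlt, hw', h5, h6⟩ := hd.edge_busy hxy h1 h2 h4
            exact (WaveDist.edge_unique hv hw' hc hc' h5 h6).trans_lt hlt |>.le
      · obtain ⟨h1, h2, h3⟩ := (hR v).1 hvR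
        exact ⟨h1, h3, fun hc => hn ⟨hxy, h1, fun h => h2 (.inr ⟨y, hxy, h⟩), hc,
          fun h => h2 (hd.arrived_of_released h1 h)⟩⟩
    · rintro ⟨hv, ha, hc⟩
      refine ⟨?_, fun h => hc h.2.2.2.1⟩
      by_cases hvR : v ∈ R
      · exact .inr hvR
      · have hc' : ¬ Crossed N.ids N.idDist x y v t := fun h => hc (h.mono (by omega))
        -- If `x` sends `v` in vain, a smaller `w` owns the slot: either `x` receives `w`, or `x`
        -- has released `w` and would have offered it first.
        refine .inl ⟨⟨hv, hRids v hv ha hvR, hc'⟩, fun hempty he => ?_⟩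
        obtain ⟨h1, h2⟩ := hoff.1 he
        obtain ⟨-, hr, -⟩ := (hsx.mem_offer hd hxy).1 h1
        obtain ⟨w, hlt, hw, h3, h4⟩ := hd.edge_busy hxy hv hr hc
        have hrw : Released N.ids N.idDist x w t := by
          by_contra hrw
          have : w ∈ received (st x) inbox y := (hgot y w).2 ⟨hxy, hw, h3, h4, hrw⟩
          rw [hempty] at this
          exact Finset.notMem_empty _ this
        have := h2 w ((hsx.mem_offer hd hxy).2 ⟨hw, hrw, h3⟩)
        omega
  · intro v
    have hmr : ∀ w : ℕ, (w : WithTop ℕ) = (st x).delay.min →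
        ((st x).delay.min ≤ (receivedNew (st x) inbox).min ↔ ∀ w' ∈ R, w ≤ w') := by
      intro w hw
      rw [← hw, Finset.le_min_iff]
      simp [hRdef]
    rw [mem_treeStep_delay]
    constructor
    · rintro (⟨h1, h2⟩ | ⟨h1, h2⟩)
      · obtain ⟨a, b, c⟩ := (hQ v).1 (.inl h1)
        refine ⟨a, b, fun h => h2 ?_⟩
        obtain ⟨h3, h4⟩ := (hleast v (.inl h1)).1 h
        have := Finset.coe_eq_min_iff.2 ⟨h1, h3⟩
        exact ⟨this, (hmr v this).2 h4⟩
      · obtain ⟨a, b, c⟩ := (hQ v).1 (.inr h1)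
        refine ⟨a, b, fun h => ?_⟩
        obtain ⟨h3, h4⟩ := (hleast v (.inr h1)).1 h
        rw [Finset.min_lt_coe_iff, Finset.min_lt_coe_iff] at h2
        rcases h2 with ⟨w, hw, hlt⟩ | ⟨w, hw, hlt⟩
        · exact absurd (h4 w hw) (by omega)
        · exact absurd (h3 w hw) (by omega)
    · rintro ⟨h1, h2, h3⟩
      have hv : v ∈ (st x).delay ∨ v ∈ R :=
        (hQ v).2 ⟨h1, h2, fun h => h3 (h.mono (by omega))⟩
      have hl := mt (hleast v hv).2 h3
      rcases hv with hv | hv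
      · refine .inl ⟨hv, fun h => hl ?_⟩
        exact ⟨(Finset.coe_eq_min_iff.1 h.1).2, (hmr v h.1).1 h.2⟩
      · refine .inr ⟨hv, ?_⟩
        rw [Finset.min_lt_coe_iff, Finset.min_lt_coe_iff]
        by_contra! hcon
        exact hl ⟨hcon.2, hcon.1⟩
  · intro v hv ha
    rw [treeStep_tau]
    split_ifs with hvR
    · obtain ⟨h1, h2, h3⟩ := (hR v).1 hvR
      rw [arrival_eq_succ h3 h2]
    · exact hsx.tau v hv (hRids v hv ha hvR)
  · intro v hv ha
    rw [treeStep_om]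
    split_ifs with hvR
    · obtain ⟨y, hy, hvy⟩ := hsrc v hvR
      obtain ⟨hxy, h1, h2⟩ := hadj v y hvR hvy
      obtain ⟨⟨d, hm⟩, -⟩ := mem_received.1 hvy
      rw [hy, Option.bind_some, hm]
      rw [hin y hxy] at hm
      obtain ⟨v', -, -, h3⟩ := siteSend_tree hm
      simp only [Msg.wave.injEq] at h3
      obtain ⟨rfl, rfl⟩ := h3
      simp only
      rw [(hst y).om v hv (hd.arrived_of_released hv h2),
        hN.stepWeight_eq (stepEdge_mem (siteAdj_symm hxy)), h1, Nat.mul_succ]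
    · exact hsx.om v hv (hRids v hv ha hvR)
  · intro v hv h0
    rw [treeStep_par, if_neg fun hvR => ((hR v).1 hvR).2.1 (.inl h0)]
    exact hsx.par_none v hv h0
  · intro v hv ha h0
    rw [treeStep_par]
    split_ifs with hvR
    · obtain ⟨y, hy, hvy⟩ := hsrc v hvR
      obtain ⟨hxy, h1, h2⟩ := hadj v y hvR hvy
      obtain ⟨h3, h4, h5⟩ := (hR v).1 hvR
      have ha' := hd.arrived_of_released hv h2
      refine ⟨y, hy, hxy, h1, ?_, arrived_arrival ha', ?_⟩
      · rw [arrival_eq_succ h5 h4]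
        exact ((hgot y v).1 hvy).2.2.2.1
      · rw [arrival_eq_succ h5 h4]
        exact Nat.lt_succ_of_le (arrival_le ha')
    · exact hsx.par v hv (hRids v hv ha hvR) h0
  · exact hsx.rc
  · exact hsx.z

end Step

end Net

/-! ## Rooted forests given by parent pointers -/

/-- `x` lies in the subtree of `u`. -/
def Below {U : Type} (par : U → Option U) (x u : U) : Prop :=
  Relation.ReflTransGen (fun a b => par a = some b) x u

open Classical in
/-- The subtree of `u`. -/
noncomputable def subtree {U : Type} [Fintype U] (par : U → Option U) (u : U) : Finset U :=
  Finset.univ.filter fun x => Below par x u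

open Classical in
/-- The children of `u`. -/
noncomputable def kids {U : Type} [Fintype U] (par : U → Option U) (u : U) : Finset U :=
  Finset.univ.filter fun c => par c = some u

section Forest

variable {U : Type} [Fintype U] {par : U → Option U} {dep : U → ℕ}

@[simp] theorem mem_subtree {x u : U} : x ∈ subtree par u ↔ Below par x u := by
  simp [subtree]

@[simp] theorem mem_kids {c u : U} : c ∈ kids par u ↔ par c = some u := by
  simp [kids]

omit [Fintype U]

theorem Below.refl (x : U) : Below par x x := Relation.ReflTransGen.refl

theorem Below.dep_le (hdep : ∀ x y, par x = some y → dep y < dep x) {x u : U}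
    (h : Below par x u) : x = u ∨ dep u < dep x := by
  induction h with
  | refl => exact .inl rfl
  | tail _ h ih =>
    have := hdep _ _ h
    rcases ih with rfl | ih <;> right <;> omega

theorem Below.total {x u w : U} (h : Below par x u) (h' : Below par x w) :
    Below par u w ∨ Below par w u :=
  Relation.ReflTransGen.total_of_right_unique
    (fun _ _ _ hb hc => Option.some.inj (hb.symm.trans hc)) h h'

theorem Below.eq_or_par {x u : U} (h : Below par x u) :
    x = u ∨ ∃ y, par x = some y ∧ Below par y u :=
  h.cases_head

theorem below_par_iff {x y u : U}
    (h : par x = some y) : Below par x u ↔ x = u ∨ Below par y u := by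
  constructor
  · intro hx
    rcases hx.eq_or_par with rfl | ⟨z, hz, hzu⟩
    · exact .inl rfl
    · rw [h] at hz; cases hz; exact .inr hzu
  · rintro (rfl | hy)
    · exact .refl _
    · exact .head h hy

theorem not_below_of_par (hdep : ∀ x y, par x = some y → dep y < dep x) {x y : U}
    (h : par x = some y) : ¬ Below par y x := by
  intro hy
  have := hdep _ _ h
  rcases hy.dep_le hdep with rfl | h'
  · omega
  · omega

variable [Fintype U]

open Classical in
theorem subtree_eq (u : U) :
    subtree par u = insert u ((kids par u).biUnion (subtree par)) := by
  ext x
  simp only [mem_subtree, Finset.mem_insert, Finset.mem_biUnion, mem_kids]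
  constructor
  · intro h
    rcases Relation.ReflTransGen.cases_tail h with rfl | ⟨c, hc, hcu⟩
    · exact .inl rfl
    · exact .inr ⟨c, hcu, hc⟩
  · rintro (rfl | ⟨c, hc, hx⟩)
    · exact .refl _
    · exact Relation.ReflTransGen.tail hx hc

theorem mem_subtree_cases {x u : U} (h : x ∈ subtree par u) :
    x = u ∨ ∃ c ∈ kids par u, x ∈ subtree par c := by
  classical
  rwa [subtree_eq, Finset.mem_insert, Finset.mem_biUnion] at h

/-- Subtrees of different children are disjoint: the ancestors of a node form a chain, so a common
descendant would put one child below the other, and then `u` below its own child, against the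
decrease of `dep`. -/
theorem sum_subtree (hdep : ∀ x y, par x = some y → dep y < dep x) (f : U → ℕ) (u : U) :
    ∑ x ∈ subtree par u, f x = f u + ∑ c ∈ kids par u, ∑ x ∈ subtree par c, f x := by
  classical
  rw [subtree_eq, Finset.sum_insert, Finset.sum_biUnion]
  · intro c hc c' hc' hne
    rw [Function.onFun, Finset.disjoint_left]
    intro x hx hx'
    rw [mem_subtree] at hx hx'
    simp only [Finset.mem_coe, mem_kids] at hc hc'
    rcases hx.total hx' with h | h
    · rcases h.eq_or_par with rfl | ⟨y, hy, h⟩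
      · exact hne rfl
      · rw [hc] at hy; cases hy
        exact not_below_of_par hdep hc' h
    · rcases h.eq_or_par with rfl | ⟨y, hy, h⟩
      · exact hne rfl
      · rw [hc'] at hy; cases hy
        exact not_below_of_par hdep hc h
  · simp only [Finset.mem_biUnion, mem_kids, mem_subtree, not_exists, not_and]
    exact fun c hc => not_below_of_par hdep hc

theorem sup_subtree (f : U → ℕ) (u : U) :
    (subtree par u).sup f = max (f u) ((kids par u).sup fun c => (subtree par c).sup f) := by
  classical
  rw [subtree_eq, Finset.sup_insert, Finset.sup_biUnion]

omit [Fintype U] in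
theorem below_root (hdep : ∀ x y, par x = some y → dep y < dep x) {r : U}
    (h : ∀ x, x ≠ r → ∃ y, par x = some y) (x : U) : Below par x r := by
  induction hn : dep x using Nat.strong_induction_on generalizing x with
  | _ n ih =>
    by_cases hx : x = r
    · subst hx; exact .refl _
    · obtain ⟨y, hy⟩ := h x hx
      exact .head hy (ih (dep y) (hn ▸ hdep _ _ hy) y rfl)

end Forest

namespace Net

variable {V : Finset ℕ} {N : Net V} {κ : ℕ}

/-! ## The set-up -/

/-- The largest distance (in slots) from `o`. -/
noncomputable def ecc (N : Net V) (o : V) : ℕ := Finset.univ.sup (N.slotDist o)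

theorem slotDist_le_ecc (o a : V) : N.slotDist o a ≤ N.ecc o :=
  Finset.le_sup (f := N.slotDist o) (Finset.mem_univ a)

theorem sum_ind : ∑ x : V, N.ind (.inl x) = N.S.card := by
  simp only [ind]
  rw [Finset.sum_boole, Finset.filter_mem_eq_inter, Finset.univ_inter]
  rfl

open Classical in
/-- The parent in the tree which is constructed during the set-up from `o`. -/
noncomputable def leadPar (N : Net V) (o a : V) : Option V :=
  if a = o then none else
    firstBy (N.port a) fun b =>
      N.graph.Adj a b ∧ N.slotDist o b + N.slots s(a, b) = N.slotDist o a

/-- The largest distance from `o` of a processor in the subtree of `a`. -/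
noncomputable def subEcc (N : Net V) (κ : ℕ) (o a : V) : ℕ :=
  (subtree (N.leadPar o) a).sup fun x => κ * N.slotDist o x

/-- The number of elements of `S` in the subtree of `a`. -/
noncomputable def subCount (N : Net V) (o a : V) : ℕ :=
  ∑ x ∈ subtree (N.leadPar o) a, N.ind (.inl x)

/-- The memory (except for the plan) of `a` after `r` rounds of the set-up. -/
structure LeadInv (N : Net V) (κ : ℕ) (o : V) (r : ℕ) (a : V) (s : Lead V) : Prop where
  dist : s.dist = if N.slotDist o a ≤ r then some (κ * N.slotDist o a) else none
  up : s.up = if N.slotDist o a ≤ r then N.leadPar o a else none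
  sent : s.sent = true ↔ N.slotDist o a < r
  heard_none : ∀ b, ¬ (N.graph.Adj a b ∧ N.slotDist o b < r) → s.heard b = none
  heard_some : ∀ b, N.graph.Adj a b → N.slotDist o b < r →
    ∃ c, s.heard b = some (N.slotDist o b + N.slots s(a, b),
      κ * (N.slotDist o b + N.slots s(a, b)), c) ∧ (c = true ↔ N.leadPar o b = some a)
  echo : ∀ b q, s.echo b = some q → N.leadPar o b = some a ∧
    q = (N.subEcc κ o b, N.subCount o b) ∧ ∀ x ∈ subtree (N.leadPar o) b, N.slotDist o x < r

open Classical in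
/-- The memory of a processor after a round of the set-up, before the plan is updated. -/
noncomputable def leadMid (N : Net V) (r : ℕ) (s : Lead V) (a : V) (inbox : V → Option Msg) :
    Lead V :=
  let heard : V → Option (ℕ × ℕ × Bool) := fun b =>
    match inbox b with
    | some (.explore d c) => some (r + N.slots s(a, b), d + N.weight s(a, b), c)
    | _ => s.heard b
  let src : Option V := firstBy (N.port a) fun b => ∃ d c, heard b = some (r + 1, d, c)
  { dist := if s.dist = none then (src.bind heard).map (fun q => q.2.1) else s.dist
    up := if s.dist = none then src else s.up
    sent := s.sent || s.dist.isSome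
    heard := heard
    echo := fun b =>
      match inbox b with
      | some (.echo e c) => some (e, c)
      | _ => s.echo b
    plan := s.plan }

/-- The plan received from a neighbour. -/
noncomputable def planReceived (N : Net V) (a : V) (inbox : V → Option Msg) :
    Option (ℕ × ℕ × ℕ) :=
  (firstBy (N.port a) fun b => ∃ D k start, inbox b = some (.plan D k start)).bind fun b =>
    match inbox b with
    | some (.plan D k start) => some (D, k, start)
    | _ => none

-- Separating the plan from the other fields lets the invariant be proved for the intermediate
-- memory, which is also the memory on which the leader bases its decision.
open Classical in
theorem leadRecv_eq (r : ℕ) (s : Lead V) (a : V) (inbox : V → Option Msg) :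
    N.leadRecv r s a inbox = { N.leadMid r s a inbox with
      plan :=
        if s.plan ≠ none then s.plan
        else if (a : ℕ) = 1 ∧ N.leadReady (N.leadMid r s a inbox) a then
          some (N.leadEcc (N.leadMid r s a inbox) a, N.leadCount (N.leadMid r s a inbox) a,
            r + N.leadEcc (N.leadMid r s a inbox) a + 2)
        else N.planReceived a inbox } := by
  rfl

open Classical in
/-- The set-up messages received by `a` in the round after `r` completed rounds. -/
noncomputable def leadInbox (N : Net V) (r : ℕ) (a b : V) : Option Msg :=
  if N.graph.Adj a b then N.leadSend r (N.lead r b) b a else none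

theorem lead_succ (r : ℕ) (a : V) :
    N.lead (r + 1) a = N.leadRecv r (N.lead r a) a (N.leadInbox r a) := by
  rfl

theorem planReceived_eq_some {a : V} {inbox : V → Option Msg} {q : ℕ × ℕ × ℕ}
    (h : N.planReceived a inbox = some q) : ∃ b, inbox b = some (.plan q.1 q.2.1 q.2.2) := by
  unfold planReceived at h
  obtain ⟨b, hb, h⟩ := Option.bind_eq_some_iff.1 h
  obtain ⟨D, k, start, hm⟩ := firstBy_spec hb
  rw [hm] at h
  cases h
  exact ⟨b, hm⟩

theorem planReceived_ne_none {a b : V} {inbox : V → Option Msg} {D k start : ℕ}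
    (h : inbox b = some (.plan D k start)) : N.planReceived a inbox ≠ none := by
  unfold planReceived
  obtain ⟨b', hb, D', k', start', hm⟩ := exists_firstBy (N.port a)
    (p := fun b => ∃ D k start, inbox b = some (.plan D k start)) ⟨b, D, k, start, h⟩
  rw [hb, Option.bind_some, hm]
  simp

theorem leadSend_explore {r : ℕ} {s : Lead V} {a b : V} {d : ℕ} {c : Bool}
    (h : N.leadSend r s a b = some (.explore d c)) :
    s.plan = none ∧ s.sent = false ∧ s.dist = some d ∧ (c = true ↔ s.up = some b) := by
  unfold leadSend at h
  split at h
  · split_ifs at h; simp at h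
  · next hp =>
    split_ifs at h with h1 h2
    · simp only [Option.map_eq_some_iff, Msg.explore.injEq] at h
      obtain ⟨d', h3, rfl, rfl⟩ := h
      exact ⟨hp, h1, h3, by simp⟩
    · simp at h

theorem leadSend_echo {r : ℕ} {s : Lead V} {a b : V} {e c : ℕ}
    (h : N.leadSend r s a b = some (.echo e c)) :
    s.plan = none ∧ N.leadReady s a ∧ s.up = some b ∧ e = N.leadEcc s a ∧ c = N.leadCount s a := by
  unfold leadSend at h
  split at h
  · split_ifs at h; simp at h
  · next hp =>
    split_ifs at h with h1 h2
    · simp at h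
    · simp only [Option.some.injEq, Msg.echo.injEq] at h
      exact ⟨hp, h2.1, h2.2, h.1.symm, h.2.symm⟩

theorem leadSend_plan {r : ℕ} {s : Lead V} {a b : V} {D k start : ℕ}
    (h : N.leadSend r s a b = some (.plan D k start)) : s.plan = some (D, k, start) := by
  unfold leadSend at h
  split at h
  · next hp =>
    split_ifs at h
    cases h
    exact hp
  · split_ifs at h <;> simp at h

theorem leadInbox_eq_some {r : ℕ} {a b : V} {m : Msg} (h : N.leadInbox r a b = some m) :
    N.graph.Adj a b ∧ N.leadSend r (N.lead r b) b a = some m := by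
  unfold leadInbox at h
  split_ifs at h with hab
  exact ⟨hab, h⟩

theorem leadInbox_of_adj {r : ℕ} {a b : V} (h : N.graph.Adj a b) :
    N.leadInbox r a b = N.leadSend r (N.lead r b) b a := if_pos h

section

variable {o : V} (hN : N.Proportional κ)
include hN

omit hN in
theorem leadPar_spec {a b : V} (h : N.leadPar o a = some b) :
    N.graph.Adj a b ∧ N.slotDist o b + N.slots s(a, b) = N.slotDist o a := by
  unfold leadPar at h
  split_ifs at h
  exact firstBy_spec (p := fun b =>
    N.graph.Adj a b ∧ N.slotDist o b + N.slots s(a, b) = N.slotDist o a) h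

theorem Proportional.leadPar_lt (a b : V) (h : N.leadPar o a = some b) :
    N.slotDist o b < N.slotDist o a := by
  have := leadPar_spec h
  have := hN.slots_pos _ _ this.1
  omega

theorem Proportional.exists_leadPar {a : V} (h : a ≠ o) : ∃ b, N.leadPar o a = some b := by
  unfold leadPar
  rw [if_neg h]
  obtain ⟨b, hb, he⟩ := hN.exists_pred o h
  obtain ⟨b', h1, h2⟩ := exists_firstBy (N.port a)
    (p := fun b => N.graph.Adj a b ∧ N.slotDist o b + N.slots s(a, b) = N.slotDist o a)
    ⟨b, hb, he.symm⟩
  exact ⟨b', h1⟩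

theorem Proportional.subtree_leader : subtree (N.leadPar o) o = Finset.univ := by
  ext x
  simp only [mem_subtree, Finset.mem_univ, iff_true]
  exact below_root (dep := N.slotDist o) hN.leadPar_lt (fun x hx => hN.exists_leadPar hx) x

theorem Proportional.subEcc_leader : N.subEcc κ o o = κ * N.ecc o := by
  rw [subEcc, hN.subtree_leader, ecc]
  exact (Finset.apply_sup_eq_sup_comp_of_nonempty (s := (Finset.univ : Finset V))
    (g := fun x => κ * x) (fun a b h => Nat.mul_le_mul_left κ h) ⟨o, Finset.mem_univ o⟩).symm

theorem Proportional.subCount_leader : N.subCount o o = N.S.card := by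
  rw [subCount, hN.subtree_leader, sum_ind]

omit hN in
theorem subEcc_le (a : V) : N.subEcc κ o a ≤ κ * N.ecc o :=
  Finset.sup_le fun x _ => Nat.mul_le_mul_left κ (slotDist_le_ecc o x)

omit hN in
theorem subCount_le (a : V) : N.subCount o a ≤ N.S.card := by
  rw [← sum_ind]
  exact Finset.sum_le_sum_of_subset (Finset.subset_univ _)

/-- A processor which is ready knows its subtree. -/
theorem Proportional.leadReady_spec {r : ℕ} {a : V} {s : Lead V} (hs : N.LeadInv κ o r a s)
    (h : N.leadReady s a) : N.leadEcc s a = N.subEcc κ o a ∧ N.leadCount s a = N.subCount o a ∧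
      ∀ x ∈ subtree (N.leadPar o) a, N.slotDist o x < r := by
  classical
  obtain ⟨hsent, h⟩ := h
  have hkids : N.leadKids s a = kids (N.leadPar o) a := by
    ext b
    simp only [leadKids, Finset.mem_filter, Finset.mem_univ, true_and, mem_kids]
    constructor
    · rintro ⟨hab, t, d, hb⟩
      by_cases hlt : N.slotDist o b < r
      · obtain ⟨c, hc, hc'⟩ := hs.heard_some b hab hlt
        rw [hb] at hc
        cases hc
        exact hc'.1 rfl
      · rw [hs.heard_none b fun h => hlt h.2] at hb
        cases hb
    · intro hb
      have hab := (leadPar_spec hb).1.symm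
      refine ⟨hab, ?_⟩
      obtain ⟨t, d, c, hc, -⟩ := h b hab
      by_cases hlt : N.slotDist o b < r
      · obtain ⟨c, hc, hc'⟩ := hs.heard_some b hab hlt
        rw [hc'.2 hb] at hc
        exact ⟨_, _, hc⟩
      · rw [hs.heard_none b fun h => hlt h.2] at hc
        cases hc
  have hecho : ∀ b ∈ kids (N.leadPar o) a, s.echo b = some (N.subEcc κ o b, N.subCount o b) ∧
      ∀ x ∈ subtree (N.leadPar o) b, N.slotDist o x < r := by
    intro b hb
    have hb' := hb
    rw [← hkids, leadKids] at hb'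
    simp only [Finset.mem_filter, Finset.mem_univ, true_and] at hb'
    obtain ⟨hab, t, d, hd⟩ := hb'
    obtain ⟨t', d', c, hc, hc'⟩ := h b hab
    rw [hd] at hc
    cases hc
    obtain ⟨q, hq⟩ := Option.ne_none_iff_exists'.1 (hc' rfl)
    obtain ⟨h1, rfl, h3⟩ := hs.echo b q hq
    exact ⟨hq, h3⟩
  have hlt := hs.sent.1 hsent
  refine ⟨?_, ?_, ?_⟩
  · rw [leadEcc, subEcc, sup_subtree, hkids, hs.dist, if_pos hlt.le]
    simp only [Option.getD_some]
    congr 1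
    exact Finset.sup_congr rfl fun b hb => by rw [(hecho b hb).1]; rfl
  · rw [leadCount, subCount, sum_subtree (dep := N.slotDist o) hN.leadPar_lt, hkids]
    congr 1
    exact Finset.sum_congr rfl fun b hb => by rw [(hecho b hb).1]; rfl
  · intro x hx
    rcases mem_subtree_cases hx with rfl | ⟨b, hb, hx⟩
    · exact hlt
    · exact (hecho b hb).2 x hx

theorem Proportional.leadInv_init (ho : (o : ℕ) = 1) (a : V) :
    N.LeadInv κ o 0 a (N.lead 0 a) := by
  have hiff : (a : ℕ) = 1 ↔ N.slotDist o a ≤ 0 := by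
    rw [Nat.le_zero, hN.slotDist_eq_zero, ← ho, Subtype.ext_iff]
  constructor
  · simp only [lead, leadInit, hiff]
    split_ifs with h
    · rw [Nat.le_zero.1 h, mul_zero]
    · rfl
  · have : N.slotDist o a ≤ 0 → N.leadPar o a = none := by
      rw [Nat.le_zero, hN.slotDist_eq_zero]
      rintro rfl
      simp [leadPar]
    simp only [lead, leadInit]
    split_ifs with h
    · exact (this h).symm
    · rfl
  · simp [lead, leadInit]
  · intro b _; rfl
  · intro b _ h; omega
  · intro b q h; simp [lead, leadInit] at h

/-- A processor holding a plan no longer explores, which could spoil the search. The hypothesis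
`hplan` excludes this: plans exist only after the exploration has left every processor. -/
theorem Proportional.leadInv_step {r : ℕ} (hinv : ∀ a, N.LeadInv κ o r a (N.lead r a))
    (hplan : ∀ a, (N.lead r a).plan ≠ none → N.ecc o < r) (a : V) :
    N.LeadInv κ o (r + 1) a (N.leadMid r (N.lead r a) a (N.leadInbox r a)) := by
  have ha := hinv a
  set s' := N.leadMid r (N.lead r a) a (N.leadInbox r a) with hs'
  have hexp : ∀ b d c, N.leadInbox r a b = some (.explore d c) →
      N.graph.Adj a b ∧ N.slotDist o b = r ∧ d = κ * N.slotDist o b ∧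
        (c = true ↔ N.leadPar o b = some a) := by
    intro b d c h
    obtain ⟨hab, h⟩ := leadInbox_eq_some h
    obtain ⟨h1, h2, h3, h4⟩ := leadSend_explore h
    have hb := hinv b
    have h5 : ¬ N.slotDist o b < r := fun h => by simp [hb.sent.2 h] at h2
    rw [hb.dist] at h3
    split_ifs at h3 with h6
    rw [hb.up, if_pos h6] at h4
    simp only [Option.some.injEq] at h3
    exact ⟨hab, by omega, h3.symm, h4⟩
  have hexp' : ∀ b, N.graph.Adj a b → N.slotDist o b = r →
      ∃ d c, N.leadInbox r a b = some (.explore d c) := by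
    intro b hab hbr
    have hb := hinv b
    have h1 : (N.lead r b).plan = none := by
      by_contra h
      have := hplan b h
      have := slotDist_le_ecc (N := N) o b
      omega
    have h2 : (N.lead r b).sent = false := by
      rw [← Bool.not_eq_true, hb.sent]; omega
    rw [leadInbox_of_adj hab]
    unfold leadSend
    rw [h1]
    simp only [h2, if_true, hb.dist, if_pos hbr.le]
    exact ⟨_, _, rfl⟩
  have hheard : ∀ b, (∃ d c, N.leadInbox r a b = some (.explore d c) ∧
      s'.heard b = some (r + N.slots s(a, b), d + N.weight s(a, b), c)) ∨
      ((∀ d c, N.leadInbox r a b ≠ some (.explore d c)) ∧ s'.heard b = (N.lead r a).heard b) := by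
    intro b
    by_cases h : ∃ d c, N.leadInbox r a b = some (.explore d c)
    · obtain ⟨d, c, h⟩ := h
      refine .inl ⟨d, c, h, ?_⟩
      simp only [hs', leadMid, h]
    · push Not at h
      refine .inr ⟨h, ?_⟩
      simp only [hs', leadMid]
  have hnone : ∀ b, ¬ (N.graph.Adj a b ∧ N.slotDist o b < r + 1) → s'.heard b = none := by
    intro b h
    rcases hheard b with ⟨d, c, h1, h2⟩ | ⟨h1, h2⟩
    · obtain ⟨h3, h4, -⟩ := hexp b d c h1
      exact absurd ⟨h3, by omega⟩ h
    · rw [h2]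
      exact ha.heard_none b fun h' => h ⟨h'.1, by omega⟩
  have hsome : ∀ b, N.graph.Adj a b → N.slotDist o b < r + 1 →
      ∃ c, s'.heard b = some (N.slotDist o b + N.slots s(a, b),
        κ * (N.slotDist o b + N.slots s(a, b)), c) ∧ (c = true ↔ N.leadPar o b = some a) := by
    intro b hab hlt
    rcases hheard b with ⟨d, c, h1, h2⟩ | ⟨h1, h2⟩
    · obtain ⟨h3, h4, rfl, h5⟩ := hexp b d c h1
      refine ⟨c, ?_, h5⟩
      rw [h2, hN.weight_eq a b hab, h4, Nat.mul_add]
    · rw [h2]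
      refine ha.heard_some b hab ?_
      by_contra hcon
      obtain ⟨d, c, h⟩ := hexp' b hab (by omega)
      exact h1 d c h
  have hsrc : ∀ b, (∃ d c, s'.heard b = some (r + 1, d, c)) ↔
      (N.graph.Adj a b ∧ N.slotDist o b + N.slots s(a, b) = r + 1) := by
    intro b
    constructor
    · rintro ⟨d, c, h⟩
      by_cases h' : N.graph.Adj a b ∧ N.slotDist o b < r + 1
      · obtain ⟨c', h1, -⟩ := hsome b h'.1 h'.2
        rw [h] at h1
        simp only [Option.some.injEq, Prod.mk.injEq] at h1
        exact ⟨h'.1, h1.1.symm⟩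
      · rw [hnone b h'] at h
        cases h
    · rintro ⟨hab, h⟩
      have := hN.slots_pos a b hab
      obtain ⟨c, h1, -⟩ := hsome b hab (by omega)
      rw [h] at h1
      exact ⟨_, _, h1⟩
  have hdist' : s'.dist = if (N.lead r a).dist = none then
      ((firstBy (N.port a) fun b => ∃ d c, s'.heard b = some (r + 1, d, c)).bind s'.heard).map
        (fun q => q.2.1) else (N.lead r a).dist := rfl
  have hup' : s'.up = if (N.lead r a).dist = none then
      (firstBy (N.port a) fun b => ∃ d c, s'.heard b = some (r + 1, d, c))
        else (N.lead r a).up := rfl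
  have hdn : (N.lead r a).dist = none ↔ ¬ N.slotDist o a ≤ r := by
    rw [ha.dist]; split_ifs with h <;> simp [h]
  -- When the search reaches `a`, the predicate that selects its source is the one in `leadPar`, so
  -- both make the same choice among ties. Before that, no neighbour qualifies, by the triangle
  -- inequality.
  have hfst : ¬ N.slotDist o a ≤ r →
      (firstBy (N.port a) fun b => ∃ d c, s'.heard b = some (r + 1, d, c)) =
        if N.slotDist o a ≤ r + 1 then N.leadPar o a else none := by
    intro h
    simp only [hsrc]
    split_ifs with h1
    · have : a ≠ o := by
        rintro rfl
        rw [slotDist_self] at h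
        omega
      rw [leadPar, if_neg this, show N.slotDist o a = r + 1 by omega]
    · rw [Option.eq_none_iff_forall_ne_some]
      intro b hb
      obtain ⟨h2, h3⟩ := firstBy_spec hb
      have := hN.slotDist_le_add o h2.symm
      rw [Sym2.eq_swap] at this
      omega
  constructor
  · rw [hdist']
    split_ifs with h1 h2 h3
    · rw [hfst (hdn.1 h1), if_pos h2]
      have : a ≠ o := by
        rintro rfl
        exact hdn.1 h1 (by rw [slotDist_self]; omega)
      obtain ⟨b, hb⟩ := hN.exists_leadPar this
      obtain ⟨h4, h5⟩ := leadPar_spec hb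
      have := hN.slots_pos a b h4
      obtain ⟨c, h6, -⟩ := hsome b h4 (by omega)
      rw [hb, Option.bind_some, h6, Option.map_some, h5]
    · rw [hfst (hdn.1 h1), if_neg h2]
      rfl
    · rw [ha.dist, if_pos (not_not.1 (mt hdn.2 h1))]
    · exact absurd ((not_not.1 (mt hdn.2 h1)).trans (Nat.le_succ r)) h3
  · rw [hup']
    by_cases h1 : (N.lead r a).dist = none
    · rw [if_pos h1, hfst (hdn.1 h1)]
    · have h2 := not_not.1 (mt hdn.2 h1)
      rw [if_neg h1, ha.up, if_pos h2, if_pos (h2.trans (Nat.le_succ r))]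
  · have : s'.sent = ((N.lead r a).sent || (N.lead r a).dist.isSome) := rfl
    rw [this, Bool.or_eq_true, ha.sent, ha.dist]
    split_ifs with h <;> simp <;> omega
  · exact hnone
  · exact hsome
  · intro b q h
    by_cases he : ∃ e c, N.leadInbox r a b = some (.echo e c)
    · obtain ⟨e, c, he⟩ := he
      have : s'.echo b = some (e, c) := by simp only [hs', leadMid, he]
      rw [h] at this
      cases this
      obtain ⟨hab, he⟩ := leadInbox_eq_some he
      obtain ⟨h1, h2, h3, rfl, rfl⟩ := leadSend_echo he
      obtain ⟨h4, h5, h6⟩ := hN.leadReady_spec (hinv b) h2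
      have h7 := (hinv b).sent.1 h2.1
      rw [(hinv b).up, if_pos h7.le] at h3
      exact ⟨h3, by rw [h4, h5], fun x hx => (h6 x hx).trans (Nat.lt_succ_self r)⟩
    · have : s'.echo b = (N.lead r a).echo b := by
        simp only [hs', leadMid]
        split
        · next hm => exact absurd ⟨_, _, hm⟩ he
        · rfl
      rw [this] at h
      obtain ⟨h1, h2, h3⟩ := ha.echo b q h
      exact ⟨h1, h2, fun x hx => (h3 x hx).trans (Nat.lt_succ_self r)⟩

end

end Net

/-! ### Termination of the set-up and distribution of the plan -/

namespace Net

variable {V : Finset ℕ} {N : Net V} {κ : ℕ}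

section

variable {o : V} (hN : N.Proportional κ) (ho : (o : ℕ) = 1)

theorem LeadInv.congr {r : ℕ} {a : V} {s s' : Lead V} (h : N.LeadInv κ o r a s)
    (h1 : s'.dist = s.dist) (h2 : s'.up = s.up) (h3 : s'.sent = s.sent)
    (h4 : s'.heard = s.heard) (h5 : s'.echo = s.echo) : N.LeadInv κ o r a s' := by
  constructor
  · rw [h1]; exact h.dist
  · rw [h2]; exact h.up
  · rw [h3]; exact h.sent
  · rw [h4]; exact h.heard_none
  · rw [h4]; exact h.heard_some
  · rw [h5]; exact h.echo

/-- How the plan becomes known. -/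
theorem lead_plan_succ {r : ℕ} {a : V} {q : ℕ × ℕ × ℕ} (h : (N.lead (r + 1) a).plan = some q) :
    (N.lead r a).plan = some q ∨
    ((N.lead r a).plan = none ∧ (a : ℕ) = 1 ∧
      N.leadReady (N.leadMid r (N.lead r a) a (N.leadInbox r a)) a ∧
      q = (N.leadEcc (N.leadMid r (N.lead r a) a (N.leadInbox r a)) a,
        N.leadCount (N.leadMid r (N.lead r a) a (N.leadInbox r a)) a,
        r + N.leadEcc (N.leadMid r (N.lead r a) a (N.leadInbox r a)) a + 2)) ∨
    ((N.lead r a).plan = none ∧ ∃ b, N.graph.Adj a b ∧ (N.lead r b).plan = some q) := by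
  rw [lead_succ, leadRecv_eq] at h
  simp only at h
  split_ifs at h with h1 h2
  · exact .inl h
  · rw [not_not] at h1
    cases h
    exact .inr (.inl ⟨h1, h2.1, h2.2, rfl⟩)
  · rw [not_not] at h1
    obtain ⟨b, hb⟩ := planReceived_eq_some h
    obtain ⟨hab, hb⟩ := leadInbox_eq_some hb
    exact .inr (.inr ⟨h1, b, hab, leadSend_plan hb⟩)

theorem lead_plan_mono {r r' : ℕ} (hr : r ≤ r') {a : V} {q : ℕ × ℕ × ℕ}
    (h : (N.lead r a).plan = some q) : (N.lead r' a).plan = some q := by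
  induction r', hr using Nat.le_induction with
  | base => exact h
  | succ r' _ ih =>
    rw [lead_succ, leadRecv_eq]
    simp only
    rw [if_pos (by rw [ih]; simp)]
    exact ih

include hN ho

/-- The memory invariant and the facts about plans need each other: plans are late because the
leader is ready only after all of its subtree, that is everybody, has been explored; this lateness
in turn protects the exploration. -/
theorem Proportional.leadInv (r : ℕ) :
    (∀ a, N.LeadInv κ o r a (N.lead r a)) ∧
      ∀ a q, (N.lead r a).plan = some q →
        N.ecc o < r ∧ q.1 = κ * N.ecc o ∧ q.2.1 = N.S.card := by
  induction r with
  | zero => exact ⟨hN.leadInv_init ho, fun a q h => by simp [lead, leadInit] at h⟩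
  | succ r ih =>
    have hplan : ∀ a, (N.lead r a).plan ≠ none → N.ecc o < r := by
      intro a h
      obtain ⟨q, hq⟩ := Option.ne_none_iff_exists'.1 h
      exact (ih.2 a q hq).1
    have hmid := hN.leadInv_step ih.1 hplan
    refine ⟨fun a => (hmid a).congr rfl rfl rfl rfl rfl, fun a q h => ?_⟩
    rcases lead_plan_succ h with h | ⟨-, ha, hr, rfl⟩ | ⟨-, b, -, h⟩
    · have := ih.2 a q h
      exact ⟨by omega, this.2⟩
    · obtain rfl : a = o := Subtype.ext (ha.trans ho.symm)
      obtain ⟨h1, h2, h3⟩ := hN.leadReady_spec (hmid a) hr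
      refine ⟨?_, h1.trans hN.subEcc_leader, h2.trans hN.subCount_leader⟩
      rw [hN.subtree_leader] at h3
      exact (Finset.sup_lt_iff (Nat.succ_pos r)).2 h3
    · have := ih.2 b q h
      exact ⟨by omega, this.2⟩

omit hN in
/-- Every plan is the plan of the leader. -/
theorem lead_plan_leader (r : ℕ) (a : V) (q : ℕ × ℕ × ℕ) (h : (N.lead r a).plan = some q) :
    (N.lead r o).plan = some q := by
  induction r generalizing a with
  | zero => simp [lead, leadInit] at h
  | succ r ih =>
    rcases lead_plan_succ h with h' | ⟨-, ha, -⟩ | ⟨-, b, -, h'⟩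
    · exact lead_plan_mono (Nat.le_succ r) (ih a h')
    · obtain rfl : a = o := Subtype.ext (ha.trans ho.symm)
      exact h
    · exact lead_plan_mono (Nat.le_succ r) (ih b h')

/-- Echoes travel inwards: after `ecc + 1` rounds all neighbours have been heard, and a processor at
distance `s` is ready by round `2 ecc + 1 - s`. The induction starts with the farthest processors.
The absence of an earlier plan ensures that echoes are really sent. -/
theorem Proportional.leadReady_of_le {r : ℕ} {a : V}
    (hp : ∀ r < 2 * N.ecc o + 1, (N.lead r o).plan = none)
    (hr : r ≤ 2 * N.ecc o + 1) (ha : 2 * N.ecc o + 1 ≤ r + N.slotDist o a) :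
    N.leadReady (N.lead r a) a := by
  induction hn : N.ecc o - N.slotDist o a using Nat.strong_induction_on generalizing a r with
  | _ n ih =>
    have hle := fun b => slotDist_le_ecc (N := N) o b
    have hinv := fun r => (hN.leadInv ho r).1
    have := hle a
    refine ⟨((hinv r) a).sent.2 (by omega), fun b hab => ?_⟩
    have := hle b
    obtain ⟨c, h1, h2⟩ := (hinv r a).heard_some b hab (by omega)
    refine ⟨_, _, c, h1, fun hc => ?_⟩
    have hlt := hN.leadPar_lt b a (h2.1 hc)
    -- A child is at least one slot farther from the leader, so it was ready one round earlier and
    -- its report is in the current inbox.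
    obtain ⟨r, rfl⟩ : ∃ r', r = r' + 1 := ⟨r - 1, by omega⟩
    have hb := ih (N.ecc o - N.slotDist o b) (by omega) (r := r) (a := b) (by omega) (by omega) rfl
    have hbp : (N.lead r b).plan = none := by
      rw [Option.eq_none_iff_forall_ne_some]
      intro q hq
      have := lead_plan_leader ho r b q hq
      rw [hp r (by omega)] at this
      cases this
    have hm : N.leadInbox r a b = some (.echo (N.leadEcc (N.lead r b) b)
        (N.leadCount (N.lead r b) b)) := by
      rw [leadInbox_of_adj hab]
      unfold leadSend
      rw [hbp]
      simp only
      have hup : (N.lead r b).up = some a := by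
        rw [(hinv r b).up, if_pos (((hinv r b).sent.1 hb.1).le)]
        exact h2.1 hc
      rw [if_neg (by simp [hb.1]), if_pos ⟨hb, hup⟩]
    rw [lead_succ, leadRecv_eq]
    simp only [leadMid, hm]
    simp

theorem Proportional.exists_leader_plan : ∃ r ≤ 2 * N.ecc o,
    (∀ r' ≤ r, (N.lead r' o).plan = none) ∧
    (N.lead (r + 1) o).plan = some (κ * N.ecc o, N.S.card, r + κ * N.ecc o + 2) := by
  classical
  have hex : ∃ r ≤ 2 * N.ecc o + 1, (N.lead r o).plan ≠ none := by
    by_contra! hcon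
    have h1 := hcon (2 * N.ecc o + 1) le_rfl
    have h2 := hN.leadReady_of_le ho (r := 2 * N.ecc o + 1) (a := o)
      (fun r hr => hcon r hr.le) le_rfl (by omega)
    rw [lead_succ, leadRecv_eq] at h1 h2
    simp only at h1
    rw [if_neg (by rw [hcon _ (by omega)]; simp), if_pos ⟨ho, h2⟩] at h1
    cases h1
  have hex' : ∃ r, (N.lead r o).plan ≠ none := by
    obtain ⟨r, -, h⟩ := hex
    exact ⟨r, h⟩
  have hspec := Nat.find_spec hex'
  have hmin := fun r h => Nat.find_min hex' (m := r) h
  have hle : Nat.find hex' ≤ 2 * N.ecc o + 1 := by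
    obtain ⟨r, h1, h2⟩ := hex
    exact (Nat.find_min' hex' h2).trans h1
  generalize Nat.find hex' = R at *
  rcases R with _ | r
  · exact absurd rfl hspec
  · have hnone : ∀ r' ≤ r, (N.lead r' o).plan = none := fun r' h =>
      not_not.1 (hmin r' (by omega))
    refine ⟨r, by omega, hnone, ?_⟩
    obtain ⟨q, hq⟩ := Option.ne_none_iff_exists'.1 hspec
    have h1 := ((hN.leadInv ho (r + 1)).2 o q hq).2
    rw [hq]
    rcases lead_plan_succ hq with h | ⟨-, -, -, rfl⟩ | ⟨-, b, -, h⟩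
    · rw [hnone r le_rfl] at h; cases h
    · simp only at h1
      rw [h1.1, h1.2]
    · have := lead_plan_leader ho r b q h
      rw [hnone r le_rfl] at this; cases this

/-- The outcome of the set-up. -/
theorem Proportional.setup : ∃ start ≤ 2 * N.ecc o + κ * N.ecc o + 2,
    (∀ r a q, (N.lead r a).plan = some q → q = (κ * N.ecc o, N.S.card, start)) ∧
    ∀ r ≥ start, ∀ a, (N.lead r a).plan = some (κ * N.ecc o, N.S.card, start) := by
  obtain ⟨r₁, hr₁, hnone, hsome⟩ := hN.exists_leader_plan ho
  refine ⟨r₁ + κ * N.ecc o + 2, by omega, ?_, ?_⟩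
  · intro r a q h
    have h1 := lead_plan_leader ho r a q h
    have h2 : r₁ + 1 ≤ r := by
      by_contra hcon
      rw [hnone r (by omega)] at h1
      cases h1
    rw [lead_plan_mono h2 hsome] at h1
    cases h1
    rfl
  -- The plan advances one tree edge per round, and an edge takes at least one slot, so `slotDist o
  -- a` rounds suffice. The starting round allows `κ * ecc` of them, so parents are still
  -- broadcasting when needed.
  · have key : ∀ n, ∀ a, N.slotDist o a = n →
        (N.lead (r₁ + 1 + n) a).plan = some (κ * N.ecc o, N.S.card, r₁ + κ * N.ecc o + 2) := by
      intro n
      induction n using Nat.strong_induction_on with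
      | _ n ih =>
        intro a ha
        by_cases hao : a = o
        · subst hao
          exact lead_plan_mono (by omega) hsome
        · obtain ⟨b, hb⟩ := hN.exists_leadPar hao
          have hlt := hN.leadPar_lt a b hb
          have hab := (leadPar_spec hb).1
          obtain ⟨m, rfl⟩ : ∃ m, n = m + 1 := ⟨n - 1, by omega⟩
          have h1 := lead_plan_mono (r' := r₁ + 1 + m) (by omega) (ih _ (by omega) b rfl)
          have hm : m < κ * N.ecc o := by
            have h2 := slotDist_le_ecc (N := N) o a
            have h3 := Nat.mul_le_mul_right (N.ecc o) hN.factor_pos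
            omega
          have h2 : N.leadInbox (r₁ + 1 + m) a b =
              some (.plan (κ * N.ecc o) N.S.card (r₁ + κ * N.ecc o + 2)) := by
            rw [leadInbox_of_adj hab]
            unfold leadSend
            rw [h1]
            simp only
            rw [if_pos (by omega)]
          have h3 : (N.lead (r₁ + 1 + (m + 1)) a).plan ≠ none := by
            rw [← add_assoc, lead_succ, leadRecv_eq]
            simp only
            split_ifs with h4 h5
            · exact h4
            · simp
            · exact planReceived_ne_none h2
          obtain ⟨q, hq⟩ := Option.ne_none_iff_exists'.1 h3
          have h4 := lead_plan_leader ho _ _ _ hq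
          rw [lead_plan_mono (by omega) hsome] at h4
          rw [hq, ← h4]
    intro r hr a
    refine lead_plan_mono ?_ (key _ a rfl)
    have h2 := slotDist_le_ecc (N := N) o a
    have h3 := Nat.mul_le_mul_right (N.ecc o) hN.factor_pos
    omega

/-- The contents of the messages sent during the set-up. -/
theorem Proportional.leadSend_bound {start : ℕ}
    (hs : ∀ r a q, (N.lead r a).plan = some q → q = (κ * N.ecc o, N.S.card, start))
    {r : ℕ} {a b : V} {m : Msg} (h : N.leadSend r (N.lead r a) a b = some m) :
    (∃ d c, m = .explore d c ∧ d ≤ κ * N.ecc o) ∨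
    (∃ e c, m = .echo e c ∧ e ≤ κ * N.ecc o ∧ c ≤ N.S.card) ∨
    m = .plan (κ * N.ecc o) N.S.card start := by
  have hinv := (hN.leadInv ho r).1 a
  have h' := h
  unfold leadSend at h'
  split at h'
  · next D k st hp =>
    split_ifs at h'
    cases h'
    cases hs r a _ hp
    exact .inr (.inr rfl)
  · split_ifs at h' with h1 h2
    · obtain ⟨d, hd, rfl⟩ := Option.map_eq_some_iff.1 h'
      rw [hinv.dist] at hd
      split_ifs at hd
      cases hd
      exact .inl ⟨_, _, rfl, Nat.mul_le_mul_left κ (slotDist_le_ecc o a)⟩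
    · cases h'
      obtain ⟨h3, h4, -⟩ := hN.leadReady_spec hinv h2.1
      rw [h3, h4]
      exact .inr (.inl ⟨_, _, rfl, subEcc_le a, subCount_le a⟩)

end

end Net

namespace Net

variable {V : Finset ℕ} {N : Net V} {κ : ℕ}

/-! ## The run after the set-up -/

/-- Every processor starts both parts, each of which takes `K` slots, after `start` rounds. -/
structure Schedule (N : Net V) (K start : ℕ) : Prop where
  early : ∀ r < start, ∀ a, N.phase r a = .setup
  tree : ∀ t < K, ∀ a, N.phase (start + t) a = .tree (t + 1)
  cost : ∀ t < K, ∀ a, N.phase (start + K + t) a = .cost K N.S.card (t + 1)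
  late : ∀ r ≥ start + 2 * K, ∀ a, N.phase r a = .halted

theorem schedule_of_plan {D start : ℕ}
    (h : ∀ r a q, (N.lead r a).plan = some q → q = (D, N.S.card, start))
    (h' : ∀ r ≥ start, ∀ a, (N.lead r a).plan = some (D, N.S.card, start)) :
    N.Schedule (N.S.card + 2 * D) start where
  early := by
    intro r hr a
    unfold phase
    rcases hp : (N.lead r a).plan with _ | q
    · rfl
    · obtain rfl := h r a q hp
      simp only
      rw [if_pos hr]
  tree := by
    intro t ht a
    unfold phase
    rw [h' _ (by omega) a]
    simp only
    rw [if_neg (by omega), if_pos (by omega)]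
    congr 1
    omega
  cost := by
    intro t ht a
    unfold phase
    rw [h' _ (by omega) a]
    simp only
    rw [if_neg (by omega), if_neg (by omega), if_pos (by omega)]
    congr 1
    omega
  late := by
    intro r hr a
    unfold phase
    rw [h' _ (by omega) a]
    simp only
    rw [if_neg (by omega), if_neg (by omega), if_neg (by omega)]

/-- The parent pointers towards `v` of the sites at which `v` arrives before slot `K`. -/
noncomputable def sitePar (N : Net V) (K start v : ℕ) (x : N.Site) : Option N.Site :=
  open Classical in
  -- Aggregation slots start at `1`, so an ID that arrives in slot `K` is never reported. Under the
  -- bound on `K` in the final section this can happen only at relays, which then carry no element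
  -- of `S` below them.
  if Arrived N.SiteAdj N.ids N.idDist x v (K - 1) then (N.site (start + K) x).par v else none

/-- The number of elements of `S` in the subtree of `x` of the tree of `v`. -/
noncomputable def below (N : Net V) (K start v : ℕ) (x : N.Site) : ℕ :=
  ∑ u ∈ subtree (N.sitePar K start v) x, N.ind u

/-- The contribution to the routing cost of the unit step above `x` in the tree of `v`. -/
noncomputable def stepCost (N : Net V) (κ K start v : ℕ) (x : N.Site) : ℕ :=
  2 * κ * N.below K start v x * (N.S.card - N.below K start v x)

/-- The contribution to the routing cost of the unit steps in the subtree of `x`. -/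
noncomputable def partCost (N : Net V) (κ K start v : ℕ) (x : N.Site) : ℕ :=
  ∑ c ∈ kids (N.sitePar K start v) x, ∑ u ∈ subtree (N.sitePar K start v) c, N.stepCost κ K start v u

open Classical in
/-- The memory of a site after `t` slots of the aggregation of the costs. -/
structure CostInv (N : Net V) (κ K start t : ℕ) (x : N.Site) (s : N.SiteState) : Prop where
  L : s.L = (N.site (start + K) x).L
  tau : s.tau = (N.site (start + K) x).tau
  par : s.par = (N.site (start + K) x).par
  z : ∀ v ∈ N.ids, s.z v = N.ind x + ∑ y,
    if N.sitePar K start v y = some x ∧ K ≤ t + N.arrival y v then N.below K start v y else 0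
  rc : ∀ v ∈ N.ids, s.rc v = ∑ y,
    if N.sitePar K start v y = some x ∧ K ≤ t + N.arrival y v then
      N.stepCost κ K start v y + N.partCost κ K start v y else 0

open Classical in
theorem site_succ (r : ℕ) (x : N.Site) :
    N.site (r + 1) x =
      match N.phase r (N.host x) with
      | .tree t => N.treeStep t (N.site r x) x fun y =>
          if N.SiteAdj x y then N.siteSend (N.phase r (N.host y)) (N.site r y) y x else none
      | .cost _ k _ => N.costStep k (N.site r x) x fun y =>
          if N.SiteAdj x y then N.siteSend (N.phase r (N.host y)) (N.site r y) y x else none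
      | _ => N.site r x := by
  rfl

theorem costStep_z {k : ℕ} {s : N.SiteState} {x : N.Site} {inbox : N.Site → Option Msg} {v : ℕ} :
    (N.costStep k s x inbox).z v = s.z v + ∑ y, match inbox y with
      | some (.cost v' _ z) => if v' = v then z else 0
      | _ => 0 := rfl

theorem costStep_rc {k : ℕ} {s : N.SiteState} {x : N.Site} {inbox : N.Site → Option Msg} {v : ℕ} :
    (N.costStep k s x inbox).rc v = s.rc v + ∑ y, match inbox y with
      | some (.cost v' r z) => if v' = v then r + 2 * N.stepWeight x y * z * (k - z) else 0
      | _ => 0 := rfl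

theorem siteSend_cost {K k t : ℕ} {s : N.SiteState} {x y : N.Site} {m : Msg}
    (h : N.siteSend (.cost K k t) s x y = some m) :
    ∃ v ∈ s.L, s.par v = some y ∧ (t : ℕ∞) + s.tau v = K ∧ m = .cost v (s.rc v) (s.z v) := by
  classical
  unfold siteSend at h
  simp only at h
  split_ifs at h with hne
  have := Finset.min'_mem _ hne
  rw [Finset.mem_filter] at this
  cases h
  exact ⟨_, this.1, this.2.1, this.2.2, rfl⟩

theorem siteSend_cost_ne_none {K k t : ℕ} {s : N.SiteState} {x y : N.Site} {v : ℕ}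
    (h1 : v ∈ s.L) (h2 : s.par v = some y) (h3 : (t : ℕ∞) + s.tau v = K) :
    N.siteSend (.cost K k t) s x y ≠ none := by
  classical
  unfold siteSend
  simp only
  rw [dif_pos ⟨v, Finset.mem_filter.2 ⟨h1, h2, h3⟩⟩]
  simp

/-! ### The two parts of the run and their time reversal -/

section Run

variable {K start : ℕ} (hN : N.Proportional κ) (hs : N.Schedule K start)
include hs

theorem Schedule.site_early {r : ℕ} (hr : r ≤ start) (x : N.Site) :
    N.site r x = N.siteInit x := by
  induction r with
  | zero => rfl
  | succ r ih =>
    rw [site_succ, hs.early r (by omega)]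
    exact ih (by omega)

include hN

theorem Schedule.treeInv {t : ℕ} (ht : t ≤ K) (x : N.Site) :
    N.TreeInv κ t x (N.site (start + t) x) := by
  induction t generalizing x with
  | zero =>
    rw [add_zero, hs.site_early le_rfl]
    exact hN.treeInv_init x
  | succ t ih =>
    rw [← add_assoc, site_succ, hs.tree t (by omega)]
    simp only [hs.tree t (show t < K by omega)]
    refine hN.treeInv_step (fun x => ih (by omega) x) (t' := t + 1) ?_ ?_
    · intro y hy
      rw [if_pos hy]
    · intro y hy
      rw [if_neg hy]

theorem Schedule.sitePar_spec {v : ℕ} (hv : v ∈ N.ids) {x y : N.Site}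
    (h : N.sitePar K start v x = some y) :
    Arrived N.SiteAdj N.ids N.idDist x v (K - 1) ∧ (N.site (start + K) x).par v = some y ∧
      N.SiteAdj x y ∧ N.idDist x v = N.idDist y v + 1 ∧
      Crossed N.ids N.idDist x y v (N.arrival x v) ∧
      Arrived N.SiteAdj N.ids N.idDist y v (N.arrival y v) ∧ N.arrival y v < N.arrival x v := by
  have hx := hs.treeInv hN le_rfl x
  unfold sitePar at h
  split_ifs at h with ha
  have h0 : N.idDist x v ≠ 0 := fun h0 => by
    rw [hx.par_none v hv h0] at h; cases h
  obtain ⟨y', h1, h2⟩ := hx.par v hv (ha.mono (by omega)) h0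
  rw [h1] at h
  cases h
  exact ⟨ha, h1, h2⟩

theorem Schedule.exists_sitePar {v : ℕ} (hv : v ∈ N.ids) {x : N.Site} (h0 : N.idDist x v ≠ 0)
    (ha : Arrived N.SiteAdj N.ids N.idDist x v (K - 1)) :
    ∃ y, N.sitePar K start v x = some y := by
  obtain ⟨y, h1, -⟩ := (hs.treeInv hN le_rfl x).par v hv (ha.mono (by omega)) h0
  exact ⟨y, by rw [sitePar, if_pos ha, h1]⟩

theorem Schedule.sitePar_lt {v : ℕ} (hv : v ∈ N.ids) (x y : N.Site)
    (h : N.sitePar K start v x = some y) : N.idDist y v < N.idDist x v := by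
  have := (hs.sitePar_spec hN hv h).2.2.2.1
  omega

theorem Schedule.below_eq {v : ℕ} (hv : v ∈ N.ids) (x : N.Site) :
    N.below K start v x = N.ind x + ∑ c ∈ kids (N.sitePar K start v) x, N.below K start v c :=
  sum_subtree (dep := fun x => N.idDist x v) (hs.sitePar_lt hN hv) _ _

theorem Schedule.partCost_eq {v : ℕ} (hv : v ∈ N.ids) (x : N.Site) :
    N.partCost κ K start v x = ∑ c ∈ kids (N.sitePar K start v) x,
      (N.stepCost κ K start v c + N.partCost κ K start v c) :=
  Finset.sum_congr rfl fun _ _ =>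
    sum_subtree (dep := fun x => N.idDist x v) (hs.sitePar_lt hN hv) _ _

omit hs hN in
theorem sum_ite_kids {f : N.Site → ℕ} {v : ℕ} {x : N.Site} {p : N.Site → Prop}
    [∀ y, Decidable (N.sitePar K start v y = some x ∧ p y)]
    (h : ∀ y, N.sitePar K start v y = some x → p y) :
    (∑ y, if N.sitePar K start v y = some x ∧ p y then f y else 0) =
      ∑ c ∈ kids (N.sitePar K start v) x, f c := by
  classical
  rw [← Finset.sum_filter]
  refine Finset.sum_congr ?_ fun _ _ => rfl
  ext y
  simp only [Finset.mem_filter, Finset.mem_univ, true_and, mem_kids]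
  exact ⟨fun h => h.1, fun hy => ⟨hy, h y hy⟩⟩

/-- The messages sent in the aggregation of the costs. -/
theorem Schedule.siteSend_iff {t : ℕ} (ht : t < K) {x y : N.Site} {s : N.SiteState}
    (hy : N.CostInv κ K start t y s) :
    (∃ v ∈ N.ids, N.sitePar K start v y = some x ∧ K = t + 1 + N.arrival y v ∧
      N.siteSend (.cost K N.S.card (t + 1)) s y x =
        some (.cost v (N.partCost κ K start v y) (N.below K start v y)) ∧
      ∀ w ∈ N.ids, N.sitePar K start w y = some x → K = t + 1 + N.arrival y w → w = v) ∨
    (N.siteSend (.cost K N.S.card (t + 1)) s y x = none ∧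
      ∀ w ∈ N.ids, N.sitePar K start w y = some x → K ≠ t + 1 + N.arrival y w) := by
  classical
  have hT := hs.treeInv hN le_rfl y
  have huniq : ∀ v ∈ N.ids, ∀ w ∈ N.ids, N.sitePar K start v y = some x →
      N.sitePar K start w y = some x → K = t + 1 + N.arrival y v → K = t + 1 + N.arrival y w →
      w = v := by
    -- The arrival slot is exactly the slot in which the wave crossed the step to the parent, since
    -- an earlier crossing would be an earlier arrival. Two IDs to be reported over this step in one
    -- slot thus owned the same edge slot and coincide.
    have key : ∀ v ∈ N.ids, N.sitePar K start v y = some x → K = t + 1 + N.arrival y v →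
        ∃ n, K = t + 1 + (n + 1) ∧ ¬ Crossed N.ids N.idDist y x v n ∧
          Crossed N.ids N.idDist y x v (n + 1) := by
      intro v hv h1 h2
      obtain ⟨-, -, hadj, -, h3, -, h4⟩ := hs.sitePar_spec hN hv h1
      refine ⟨N.arrival y v - 1, by omega, fun hc => ?_, ?_⟩
      · have := arrival_le (x := y) (v := v) (.inr ⟨x, hadj, hc⟩)
        omega
      · rwa [Nat.sub_add_cancel (by omega)]
    intro v hv w hw h1 h2 h3 h4
    obtain ⟨n, hn, h5, h6⟩ := key v hv h1 h3
    obtain ⟨m, hm, h7, h8⟩ := key w hw h2 h4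
    obtain rfl : n = m := by omega
    exact WaveDist.edge_unique hw hv h7 h8 h5 h6
  rcases hm : N.siteSend (.cost K N.S.card (t + 1)) s y x with _ | m
  · refine .inr ⟨rfl, fun w hw hp hK => ?_⟩
    obtain ⟨h1, h2, -⟩ := hs.sitePar_spec hN hw hp
    have ha : Arrived N.SiteAdj N.ids N.idDist y w K := h1.mono (by omega)
    refine siteSend_cost_ne_none (v := w) ?_ ?_ ?_ hm
    · rw [hy.L, hT.L]; exact ⟨hw, ha⟩
    · rw [hy.par]; exact h2
    · rw [hy.tau, hT.tau w hw ha]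
      exact_mod_cast hK.symm
  · left
    obtain ⟨v, h1, h2, h3, rfl⟩ := siteSend_cost hm
    rw [hy.L, hT.L] at h1
    rw [hy.par] at h2
    rw [hy.tau, hT.tau v h1.1 h1.2] at h3
    have hK : K = t + 1 + N.arrival y v := by exact_mod_cast h3.symm
    have hp : N.sitePar K start v y = some x := by
      rw [sitePar, if_pos ((arrived_arrival h1.2).mono (by omega)), h2]
    refine ⟨v, h1.1, hp, hK, ?_, fun w hw h4 h5 => huniq v h1.1 w hw hp h4 hK h5⟩
    -- Children were reached later than `y`, hence have all reported before; the partial sums in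
    -- memory are complete.
    have hall : ∀ c, N.sitePar K start v c = some y → K ≤ t + N.arrival c v := by
      intro c hc
      have := (hs.sitePar_spec hN h1.1 hc).2.2.2.2.2.2
      omega
    rw [hy.z v h1.1, hy.rc v h1.1, sum_ite_kids hall, sum_ite_kids hall,
      ← hs.below_eq hN h1.1, ← hs.partCost_eq hN h1.1]

/-- Slot `t + 1` adds exactly the children with `K = t + 1 + arrival`, so the summation ranges for
consecutive slots differ by the messages received. -/
theorem Schedule.costInv {t : ℕ} (ht : t ≤ K) (x : N.Site) :
    N.CostInv κ K start t x (N.site (start + K + t) x) := by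
  classical
  induction t generalizing x with
  | zero =>
    have hx := hs.treeInv hN le_rfl x
    have hnot : ∀ v ∈ N.ids, ∀ y, ¬ (N.sitePar K start v y = some x ∧ K ≤ 0 + N.arrival y v) := by
      rintro v hv y ⟨h1, h2⟩
      have h3 := hs.sitePar_spec hN hv h1
      have := arrival_le h3.1
      have := h3.2.2.2.2.2.2
      omega
    refine ⟨rfl, rfl, rfl, fun v hv => ?_, fun v hv => ?_⟩
    · rw [add_zero, hx.z, Finset.sum_eq_zero fun y _ => if_neg (hnot v hv y), add_zero]
    · rw [add_zero, hx.rc, Finset.sum_eq_zero fun y _ => if_neg (hnot v hv y)]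
  | succ t ih =>
    have ih := fun x => ih (by omega) x
    have hx := ih x
    rw [← add_assoc, site_succ, hs.cost t (by omega)]
    simp only [hs.cost t (show t < K by omega)]
    have hmsg : ∀ v ∈ N.ids, ∀ y,
        (if N.SiteAdj x y then
          N.siteSend (.cost K N.S.card (t + 1)) (N.site (start + K + t) y) y x else none) =
            some (.cost v (N.partCost κ K start v y) (N.below K start v y)) ∧
          N.SiteAdj x y ∧ N.sitePar K start v y = some x ∧ K = t + 1 + N.arrival y v ∨
        ((∀ r z, (if N.SiteAdj x y then
          N.siteSend (.cost K N.S.card (t + 1)) (N.site (start + K + t) y) y x else none) ≠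
            some (.cost v r z)) ∧
          ¬ (N.sitePar K start v y = some x ∧ K = t + 1 + N.arrival y v)) := by
      intro v hv y
      by_cases hadj : N.SiteAdj x y
      · rw [if_pos hadj]
        rcases hs.siteSend_iff hN (x := x) (by omega) (ih y) with
          ⟨w, hw, h1, h2, h3, h4⟩ | ⟨h1, h2⟩
        · by_cases hwv : w = v
          · subst hwv
            exact .inl ⟨h3, hadj, h1, h2⟩
          · refine .inr ⟨fun r z h => ?_, fun h => hwv (h4 v hv h.1 h.2).symm⟩
            rw [h3] at h
            simp only [Option.some.injEq, Msg.cost.injEq] at h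
            exact hwv h.1
        · exact .inr ⟨fun r z h => by simp [h1] at h, fun h => h2 v hv h.1 h.2⟩
      · rw [if_neg hadj]
        refine .inr ⟨fun r z => by simp, fun h => hadj ?_⟩
        exact siteAdj_symm (hs.sitePar_spec hN hv h.1).2.2.1
    refine ⟨hx.L, hx.tau, hx.par, fun v hv => ?_, fun v hv => ?_⟩
    · rw [costStep_z, hx.z v hv, add_assoc, ← Finset.sum_add_distrib]
      congr 1
      refine Finset.sum_congr rfl fun y _ => ?_
      rcases hmsg v hv y with ⟨h1, h2, h3, h4⟩ | ⟨h1, h2⟩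
      · rw [h1]
        simp only
        rw [if_neg (by omega), if_pos trivial, if_pos ⟨h3, by omega⟩, zero_add]
      · have : (match (if N.SiteAdj x y then
            N.siteSend (.cost K N.S.card (t + 1)) (N.site (start + K + t) y) y x else none) with
          | some (.cost v' _ z) => if v' = v then z else 0
          | _ => 0) = 0 := by
          split
          · next hm => rw [if_neg]; rintro rfl; exact h1 _ _ hm
          · rfl
        rw [this, add_zero]
        congr 1
        apply propext
        constructor
        · rintro ⟨h3, h4⟩; exact ⟨h3, by omega⟩
        · rintro ⟨h3, h4⟩
          have : K ≠ t + 1 + N.arrival y v := fun h => h2 ⟨h3, h⟩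
          exact ⟨h3, by omega⟩
    · rw [costStep_rc, hx.rc v hv, ← Finset.sum_add_distrib]
      refine Finset.sum_congr rfl fun y _ => ?_
      rcases hmsg v hv y with ⟨h1, h2, h3, h4⟩ | ⟨h1, h2⟩
      · rw [h1]
        simp only
        rw [if_neg (by omega), if_pos trivial, if_pos ⟨h3, by omega⟩, zero_add,
          hN.stepWeight_eq (stepEdge_mem h2), stepCost, add_comm]
      · have : (match (if N.SiteAdj x y then
            N.siteSend (.cost K N.S.card (t + 1)) (N.site (start + K + t) y) y x else none) with
          | some (.cost v' r z) =>
            if v' = v then r + 2 * N.stepWeight x y * z * (N.S.card - z) else 0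
          | _ => 0) = 0 := by
          split
          · next hm => rw [if_neg]; rintro rfl; exact h1 _ _ hm
          · rfl
        rw [this, add_zero]
        congr 1
        apply propext
        constructor
        · rintro ⟨h3, h4⟩; exact ⟨h3, by omega⟩
        · rintro ⟨h3, h4⟩
          have : K ≠ t + 1 + N.arrival y v := fun h => h2 ⟨h3, h⟩
          exact ⟨h3, by omega⟩

end Run

end Net

/-! ## Trees given by parent pointers -/

section Pointers

variable {U : Type} {par : U → Option U} {dep : U → ℕ}

/-- Pointers lead to the root, so the graph is connected; each edge is the pointer of some non-root
vertex, so there are fewer edges than vertices. -/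
theorem isTree_of_par [Finite U] (hdep : ∀ x y, par x = some y → dep y < dep x) {r : U}
    (h : ∀ x, x ≠ r → ∃ y, par x = some y) {T : SimpleGraph U}
    (hT : ∀ a b, T.Adj a b ↔ par a = some b ∨ par b = some a) (hr : par r = none) : T.IsTree := by
  classical
  have := Fintype.ofFinite U
  have hbelow : ∀ {x y}, Below par x y → T.Reachable x y := by
    intro x y hxy
    induction hxy with
    | refl => exact .refl _
    | tail _ h ih => exact ih.trans ((hT _ _).2 (.inl h)).reachable
  have hreach : ∀ x, T.Reachable x r := fun x => hbelow (below_root hdep h x)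
  have hconn : T.Connected :=
    { preconnected := fun x y => (hreach x).trans (hreach y).symm
      nonempty := ⟨r⟩ }
  rw [SimpleGraph.isTree_iff_connected_and_card]
  refine ⟨hconn, le_antisymm ?_ hconn.card_vert_le_card_edgeSet_add_one⟩
  have hsub : T.edgeSet ⊆
      (((Finset.univ.erase r).image fun x => s(x, (par x).getD x) : Finset (Sym2 U)) :
        Set (Sym2 U)) := by
    intro e he
    induction e with
    | _ a b =>
      simp only [Finset.coe_image, Set.mem_image, Finset.mem_coe, Finset.mem_erase,
        Finset.mem_univ, and_true]
      rcases (hT a b).1 he with h' | h'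
      · exact ⟨a, fun hc => by simp [hc, hr] at h', by rw [h']; rfl⟩
      · exact ⟨b, fun hc => by simp [hc, hr] at h', by rw [h']; exact Sym2.eq_swap⟩
  have h1 := Set.ncard_le_ncard hsub (Finset.finite_toSet _)
  rw [Set.ncard_coe_finset] at h1
  have h2 := h1.trans Finset.card_image_le
  rw [Finset.card_erase_of_mem (Finset.mem_univ r), Finset.card_univ] at h2
  have h3 : 0 < Fintype.card U := Fintype.card_pos_iff.2 ⟨r⟩
  rw [Nat.card_coe_set_eq, Nat.card_eq_fintype_card]
  omega

/-! ### Distance in a tree as the number of nodes separating two nodes -/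

variable [Fintype U]

open Classical in
/-- The number of nodes which are ancestors of exactly one of the nodes `x` and `y`. -/
noncomputable def ancDist (par : U → Option U) (x y : U) : ℕ :=
  ∑ s, if Below par x s ↔ Below par y s then 0 else 1

theorem ancDist_self (x : U) : ancDist par x x = 0 := by
  simp [ancDist]

theorem ancDist_comm (x y : U) : ancDist par x y = ancDist par y x := by
  classical exact Finset.sum_congr rfl fun s _ => if_congr Iff.comm rfl rfl

theorem ancDist_triangle (x y z : U) : ancDist par x z ≤ ancDist par x y + ancDist par y z := by
  unfold ancDist
  rw [← Finset.sum_add_distrib]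
  refine Finset.sum_le_sum fun s _ => ?_
  split_ifs <;> first | omega | tauto

/-- The hypothesis says that the paths from `x` and from `z` to the root do not meet before `y`, so
moving from `x` up to `y` only removes nodes that are not ancestors of `z`. -/
theorem ancDist_add {x y z : U} (hxy : Below par x y)
    (h : ∀ s, Below par x s → Below par z s → Below par y s) :
    ancDist par x z = ancDist par x y + ancDist par y z := by
  unfold ancDist
  rw [← Finset.sum_add_distrib]
  refine Finset.sum_congr rfl fun s _ => ?_
  have h1 : Below par y s → Below par x s := fun h => hxy.trans h
  have h2 := h s
  by_cases hx : Below par x s <;> by_cases hy : Below par y s <;> by_cases hz : Below par z s <;>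
    simp_all

theorem ancDist_of_below (hdep : ∀ x y, par x = some y → dep x = dep y + 1) {x y : U}
    (h : Below par x y) : dep x = dep y + ancDist par x y := by
  have hdep' : ∀ x y, par x = some y → dep y < dep x := fun x y h => by
    have := hdep x y h; omega
  induction h using Relation.ReflTransGen.head_induction_on with
  | refl => simp [ancDist_self]
  | @head x z hxz hzy ih =>
    have h1 : ancDist par x z = 1 := by
      unfold ancDist
      rw [Finset.sum_eq_single x]
      · rw [if_neg]
        intro h
        exact not_below_of_par hdep' hxz (h.1 (.refl x))
      · intro s _ hs
        rw [if_pos]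
        rw [below_par_iff hxz]
        exact or_iff_right (Ne.symm hs)
      · intro h; exact absurd (Finset.mem_univ x) h
    have h2 := ancDist_add (par := par) (x := x) (y := z) (z := y) (.single hxz)
      fun s _ hy => hzy.trans hy
    have := hdep x z hxz
    omega

open Classical in
/-- Summing over all pairs, every node counts with the number of pairs which it separates. -/
theorem sum_ancDist (S : Finset U) :
    ∑ x ∈ S, ∑ y ∈ S, ancDist par x y =
      ∑ s, 2 * (S.filter fun x => Below par x s).card *
        (S.card - (S.filter fun x => Below par x s).card) := by
  unfold ancDist
  have h1 : ∀ x ∈ S, ∑ y ∈ S, ∑ s, (if Below par x s ↔ Below par y s then 0 else 1) =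
      ∑ s, ∑ y ∈ S, (if Below par x s ↔ Below par y s then 0 else 1) :=
    fun x _ => Finset.sum_comm
  rw [Finset.sum_congr rfl h1, Finset.sum_comm]
  refine Finset.sum_congr rfl fun s _ => ?_
  set A := S.filter fun x => Below par x s with hA
  have hc : (S \ A).card = S.card - A.card := Finset.card_sdiff_of_subset (Finset.filter_subset _ _)
  have hfil' : S.filter (fun x => ¬ Below par x s) = S \ A := by
    ext; simp only [hA, Finset.mem_filter, Finset.mem_sdiff]; tauto
  have h2 : ∀ x ∈ S, ∑ y ∈ S, (if Below par x s ↔ Below par y s then 0 else 1) =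
      if Below par x s then (S \ A).card else A.card := by
    intro x _
    split_ifs with hx
    · rw [← hfil', Finset.card_filter]
      exact Finset.sum_congr rfl fun y _ => by by_cases hy : Below par y s <;> simp [hx, hy]
    · rw [hA, Finset.card_filter]
      exact Finset.sum_congr rfl fun y _ => by by_cases hy : Below par y s <;> simp [hx, hy]
  rw [Finset.sum_congr rfl h2, Finset.sum_ite, ← hA, hfil', Finset.sum_const, Finset.sum_const, hc]
  simp only [smul_eq_mul]
  ring

end Pointers

namespace Net

variable {V : Finset ℕ} {N : Net V} {κ : ℕ}

theorem inf_mem (e : Sym2 V) : e.inf ∈ e := by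
  have h := Sym2.mem_mk_left e.inf e.sup
  rwa [mk_inf_sup] at h

theorem sup_mem (e : Sym2 V) : e.sup ∈ e := by
  have h := Sym2.mem_mk_right e.inf e.sup
  rwa [mk_inf_sup] at h

/-! ## Trees of sites -/

/-- The pointers `p` of the sites form a shortest-path tree rooted in `v` which contains all
processors. -/
structure SiteTree (N : Net V) (v : V) (p : N.Site → Option N.Site) : Prop where
  adj : ∀ x y, p x = some y → N.SiteAdj x y
  dist : ∀ x y, p x = some y → N.siteDist v x = N.siteDist v y + 1
  root : ∀ a : V, Below p (.inl a) (.inl v)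

namespace SiteTree

variable {v : V} {p : N.Site → Option N.Site} (hN : N.Proportional κ) (hp : N.SiteTree v p)

/-- The processor to which the pointer of `a` leads. -/
noncomputable def procPar (p : N.Site → Option N.Site) (a : V) : Option V :=
  (p (.inl a)).map (N.across a)

include hp

theorem lt (x y : N.Site) (h : p x = some y) : N.siteDist v y < N.siteDist v x := by
  have := hp.dist x y h; omega

theorem par_root : p (.inl v) = none := by
  rw [Option.eq_none_iff_forall_ne_some]
  intro y h
  have := hp.dist _ _ h
  have h0 : N.siteDist v (.inl v) = 0 := slotDist_self v
  omega

theorem procPar_root : procPar p v = none := by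
  rw [procPar, hp.par_root]; rfl

theorem exists_procPar {a : V} (h : a ≠ v) : ∃ b, procPar p a = some b := by
  rcases (hp.root a).eq_or_par with h' | ⟨y, hy, -⟩
  · exact absurd (Sum.inl_injective h') h
  · exact ⟨N.across a y, by rw [procPar, hy]; rfl⟩

include hN

theorem procPar_spec {a b : V} (h : procPar p a = some b) :
    N.graph.Adj a b ∧ N.slotDist v a = N.slotDist v b + N.slots s(a, b) := by
  obtain ⟨y, hy, rfl⟩ := Option.map_eq_some_iff.1 h
  have h1 := hp.adj _ _ hy
  have h2 := hp.dist _ _ hy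
  obtain ⟨h3, h4⟩ := across_spec h1
  refine ⟨h3, ?_⟩
  rcases y with b | ⟨e, i⟩
  · have h5 : N.slots s(a, b) = 1 := h1.2
    change N.slotDist v a = N.slotDist v b + N.slots s(a, b)
    rw [h5]
    exact h2
  · rw [← h4]
    have h5 := hN.slotDist_inf_sup v e
    have hi := i.2
    simp only [siteDist, across, stepEdge] at h2 ⊢
    rcases h1 with ⟨rfl, h1⟩ | ⟨rfl, h1⟩
    · rw [if_pos rfl]
      omega
    · rw [if_neg (inf_ne_sup e).symm]
      omega

theorem procPar_lt (a b : V) (h : procPar p a = some b) : N.slotDist v b < N.slotDist v a := by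
  obtain ⟨h1, h2⟩ := hp.procPar_spec hN h
  have := hN.slots_pos a b h1
  omega

omit hN in
/-- The ancestors of a processor are itself, relays on the edge towards its parent and the
ancestors of its parent. -/
theorem below_cases {a b : V} (h : procPar p a = some b) {s : N.Site} (hs : Below p (.inl a) s) :
    s = .inl a ∨ (∃ r, s = .inr r ∧ (r.1 : Sym2 V) = s(a, b)) ∨
      (Below p (.inl b) s ∧ Below p (.inl a) (.inl b)) := by
  obtain ⟨y, hy, hyb⟩ := Option.map_eq_some_iff.1 h
  induction hs with
  | refl => exact .inl rfl
  | @tail s s₂ hs h2 ih =>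
    have hs₂ : Below p (.inl a) s₂ := Relation.ReflTransGen.tail hs h2
    have hd : N.siteDist v s₂ < N.siteDist v (.inl a) := by
      have := hp.lt _ _ h2
      rcases Below.dep_le hp.lt hs with rfl | h
      · exact this
      · omega
    rcases ih with rfl | ⟨r, rfl, hr⟩ | ⟨h3, h4⟩
    · rw [hy] at h2
      cases h2
      rcases y with b' | r
      · obtain rfl : b' = b := hyb
        exact .inr (.inr ⟨.refl _, hs₂⟩)
      · refine .inr (.inl ⟨r, rfl, ?_⟩)
        rw [← hyb]
        exact (across_spec (hp.adj _ _ hy)).2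
    · obtain ⟨e, i⟩ := r
      -- Distances to `v` decrease along pointers, so the chain cannot return to `a` and must leave
      -- the edge at `b`.
      have hend : ∀ c ∈ (e : Sym2 V), s₂ = .inl c → s₂ = .inl b := by
        intro c hc he
        have hc' : c ∈ s(a, b) := hr ▸ hc
        rcases Sym2.mem_iff.1 hc' with rfl | rfl
        · rw [he] at hd
          exact absurd hd (lt_irrefl _)
        · exact he
      have hb : s₂ = .inl b → s₂ = .inl a ∨ (∃ r, s₂ = .inr r ∧ (r.1 : Sym2 V) = s(a, b)) ∨
          (Below p (.inl b) s₂ ∧ Below p (.inl a) (.inl b)) := by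
        rintro rfl
        exact .inr (.inr ⟨.refl _, hs₂⟩)
      rcases relay_adj (hp.adj _ _ h2) with h3 | h3 | ⟨j, h3⟩
      · exact hb (hend _ (inf_mem _) h3)
      · exact hb (hend _ (sup_mem _) h3)
      · exact .inr (.inl ⟨⟨e, j⟩, h3, hr⟩)
    · exact .inr (.inr ⟨Relation.ReflTransGen.tail h3 h2, h4⟩)

omit hN in
theorem below_procPar {a b : V} (h : procPar p a = some b) : Below p (.inl a) (.inl b) := by
  rcases hp.below_cases h (hp.root a) with h1 | ⟨r, h1, -⟩ | ⟨-, h1⟩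
  · rw [← Sum.inl_injective h1, hp.procPar_root] at h
    cases h
  · cases h1
  · exact h1

/-- A relay has at most one child. -/
theorem below_child {a : V} {r : Σ e : N.graph.edgeSet, Fin (N.slots e - 1)} {s : N.Site}
    (hs : p s = some (.inr r)) (h : Below p (.inl a) (.inr r)) : Below p (.inl a) s := by
  rcases Relation.ReflTransGen.cases_tail h with h | ⟨c, hc, hcr⟩
  · cases h
  · have h0 : N.siteDist v (.inr r) ≠ 0 := by
      rw [Ne, hN.siteDist_eq_zero]; simp
    obtain ⟨q, hq, hd⟩ := hN.exists_siteAdj_lt v h0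
    have h1 := hp.dist _ _ hs
    have h2 := hp.dist _ _ hcr
    -- One of the at most two neighbours, `q`, is nearer to `v` and hence no child; both `c` and `s`
    -- are the other one.
    have : c = s := relay_adj_third hq (siteAdj_symm (hp.adj _ _ hcr))
      (siteAdj_symm (hp.adj _ _ hs)) (by rintro rfl; omega) (by rintro rfl; omega)
    rwa [← this]

/-- Two branches cannot merge at a relay, as a relay has at most one child. A common ancestor on the
edge from `a` to its parent is therefore traced back to `a` itself. -/
theorem below_of_common {a b a' : V} (h : procPar p a = some b) {s : N.Site}
    (hs : Below p (.inl a) s) (hs' : Below p (.inl a') s) :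
    Below p (.inl b) s ∨ Below p (.inl a') (.inl a) := by
  induction hs with
  | refl => exact .inr hs'
  | @tail s s₂ hs h2 ih =>
    rcases hp.below_cases h (Relation.ReflTransGen.tail hs h2) with rfl | ⟨r, rfl, -⟩ | ⟨h3, -⟩
    · exact .inr hs'
    · rcases ih (hp.below_child hN h2 hs') with h3 | h3
      · exact .inl (Relation.ReflTransGen.tail h3 h2)
      · exact .inr h3
    · exact .inl h3

theorem ancDist_procPar {a b : V} (h : procPar p a = some b) :
    κ * ancDist p (.inl a) (.inl b) = N.weight s(a, b) := by
  obtain ⟨h1, h2⟩ := hp.procPar_spec hN h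
  have h3 := ancDist_of_below (dep := N.siteDist v) hp.dist (hp.below_procPar h)
  simp only [siteDist] at h3
  rw [hN.weight_eq a b h1, show ancDist p (.inl a) (.inl b) = N.slots s(a, b) by omega]

/-- Since `a` is at least as far from `v` as `a'` and different from it, `a'` is not below `a`; so
the path from `a` to `a'` starts with the edge to the parent. -/
theorem ancDist_split {a b a' : V} (h : procPar p a = some b) (hne : a ≠ a')
    (hle : N.slotDist v a' ≤ N.slotDist v a) :
    ancDist p (.inl a) (.inl a') = ancDist p (.inl a) (.inl b) + ancDist p (.inl b) (.inl a') := by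
  refine ancDist_add (hp.below_procPar h) fun s hs hs' => ?_
  rcases hp.below_of_common hN h hs hs' with h1 | h1
  · exact h1
  · rcases h1.dep_le hp.lt with h2 | h2
    · exact absurd (Sum.inl_injective h2).symm hne
    · simp only [siteDist] at h2
      omega

variable {T : SimpleGraph V} (hT : ∀ a b, T.Adj a b ↔ procPar p a = some b ∨ procPar p b = some a)
include hT

theorem ancDist_adj {a b : V} (h : T.Adj a b) :
    κ * ancDist p (.inl a) (.inl b) = N.weight s(a, b) := by
  rcases (hT a b).1 h with h | h
  · exact hp.ancDist_procPar hN h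
  · rw [ancDist_comm, Sym2.eq_swap]
    exact hp.ancDist_procPar hN h

theorem le_graph : T ≤ N.graph := by
  intro a b h
  rcases (hT a b).1 h with h | h
  · exact (hp.procPar_spec hN h).1
  · exact (hp.procPar_spec hN h).1.symm

theorem isSPTree : IsSPTree N.graph N.weight T v := by
  refine ⟨hp.le_graph hN hT, isTree_of_par (dep := N.slotDist v) (hp.procPar_lt hN)
    (fun x hx => hp.exists_procPar hx) hT hp.procPar_root, fun u => ?_⟩
  have hle := hp.le_graph hN hT
  rw [hN.wdist_weight]
  refine wdist_eq_of_potential (f := fun v' => κ * N.slotDist v v') (by simp [slotDist_self])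
    ?_ ?_ ?_ u
  · intro a b h
    rw [hN.weight_eq a b (hle h)]
    exact Nat.mul_pos hN.factor_pos (hN.slots_pos a b (hle h))
  · intro a b h
    rw [hN.weight_eq a b (hle h), ← Nat.mul_add]
    exact Nat.mul_le_mul_left _ (hN.slotDist_le_add v (hle h))
  · intro a ha
    obtain ⟨b, hb⟩ := hp.exists_procPar ha
    obtain ⟨h1, h2⟩ := hp.procPar_spec hN hb
    exact ⟨b, (hT a b).2 (.inl hb), by rw [hN.weight_eq a b h1, ← Nat.mul_add, h2]⟩

/-- Repeatedly moving the end farther from `v` to its parent shortens the problem until both ends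
meet. -/
theorem exists_tree_walk (a a' : V) : ∃ q : T.Walk a a',
    (q.edges.map N.weight).sum = κ * ancDist p (.inl a) (.inl a') := by
  induction hn : N.slotDist v a + N.slotDist v a' using Nat.strong_induction_on
    generalizing a a' with
  | _ n ih =>
    by_cases hne : a = a'
    · subst hne
      exact ⟨.nil, by simp [ancDist_self]⟩
    · have key : ∀ a a' : V, a ≠ a' → N.slotDist v a' ≤ N.slotDist v a →
          ∃ b, procPar p a = some b := by
        intro a a' hne hle
        refine hp.exists_procPar ?_
        rintro rfl
        rw [slotDist_self, Nat.le_zero, hN.slotDist_eq_zero] at hle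
        exact hne hle.symm
      rcases le_total (N.slotDist v a') (N.slotDist v a) with hle | hle
      · obtain ⟨b, hb⟩ := key a a' hne hle
        have hlt := hp.procPar_lt hN a b hb
        obtain ⟨q, hq⟩ := ih _ (by omega) b a' rfl
        refine ⟨.cons ((hT a b).2 (.inl hb)) q, ?_⟩
        rw [hp.ancDist_split hN hb hne hle, Nat.mul_add, hp.ancDist_procPar hN hb]
        simp [hq]
      · obtain ⟨b, hb⟩ := key a' a (Ne.symm hne) hle
        have hlt := hp.procPar_lt hN a' b hb
        obtain ⟨q, hq⟩ := ih _ (by omega) a b rfl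
        refine ⟨q.append (.cons ((hT b a').2 (.inr hb)) .nil), ?_⟩
        rw [ancDist_comm, hp.ancDist_split hN hb (Ne.symm hne) hle, Nat.mul_add,
          hp.ancDist_procPar hN hb, ancDist_comm (par := p) (.inl b), add_comm]
        simp [hq, Sym2.eq_swap]

/-- No walk is shorter, because the scaled separation count is a potential: along a tree edge it
changes by at most the weight. -/
theorem wdist_tree (a a' : V) :
    wdist T N.weight a a' = ((κ * ancDist p (.inl a) (.inl a') : ℕ) : ℕ∞) := by
  apply le_antisymm
  · obtain ⟨q, hq⟩ := hp.exists_tree_walk hN hT a a'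
    rw [← hq]
    exact wdist_le_walk q
  · refine le_iInf fun q => ?_
    have := le_add_walk (f := fun b => κ * ancDist p (.inl a) (.inl b)) (ω := N.weight) ?_ q
    · simp only [ancDist_self, mul_zero, zero_add] at this
      exact_mod_cast this
    · intro b c h
      rw [← hp.ancDist_adj hN hT h, ← Nat.mul_add]
      exact Nat.mul_le_mul_left κ (ancDist_triangle _ _ _)

theorem routingCost_tree : routingCost T N.weight N.S =
    ((κ * ∑ a ∈ N.S, ∑ b ∈ N.S, ancDist p (.inl a) (.inl b) : ℕ) : ℕ∞) := by
  unfold routingCost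
  simp only [hp.wdist_tree hN hT, Finset.mul_sum]
  push_cast
  rfl

end SiteTree

end Net

namespace Net

variable {V : Finset ℕ} {N : Net V} {κ : ℕ}

/-! ## The result of the run -/

section Result

variable {K start : ℕ} (hN : N.Proportional κ) (hs : N.Schedule K start)
  (hK : ∀ u v : V, N.slotDist u v + N.S.card ≤ K) {v : V} (hv : v ∈ N.S)
include hN hs hK hv

omit hs in
theorem Proportional.arrived_of_bound (a : V) :
    Arrived N.SiteAdj N.ids N.idDist (.inl a) v (K - 1) := by
  have hv' := coe_mem_ids.2 hv
  refine hN.waveDist.arrived_of_released hv' (WaveDist.released_of_le hv' ?_)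
  have := hK v a
  rw [card_ids, idDist_coe]
  simp only [siteDist]
  omega

theorem Schedule.siteTree : N.SiteTree v (N.sitePar K start v) where
  adj x y h := (hs.sitePar_spec hN (coe_mem_ids.2 hv) h).2.2.1
  dist x y h := by simpa using (hs.sitePar_spec hN (coe_mem_ids.2 hv) h).2.2.2.1
  root a := by
    have hv' := coe_mem_ids.2 hv
    -- The induction runs over sites, as pointers pass through relays; early arrival is inherited by
    -- the parent.
    have key : ∀ n, ∀ x, N.idDist x v = n → Arrived N.SiteAdj N.ids N.idDist x v (K - 1) →
        Below (N.sitePar K start v) x (.inl v) := by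
      intro n
      induction n using Nat.strong_induction_on with
      | _ n ih =>
        intro x hx ha
        by_cases h0 : N.idDist x v = 0
        · rw [idDist_coe, hN.siteDist_eq_zero] at h0
          rw [h0]
          exact .refl _
        · obtain ⟨y, hy⟩ := hs.exists_sitePar hN hv' h0 ha
          obtain ⟨-, -, -, h1, -, h2, h3⟩ := hs.sitePar_spec hN hv' hy
          refine .head hy (ih _ (by omega) y rfl (h2.mono ?_))
          have := arrival_le ha
          omega
    exact key _ _ rfl (hN.arrived_of_bound hK hv a)

theorem Schedule.builtTree_adj (a b : V) : (N.builtTree (start + 2 * K) v).Adj a b ↔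
    SiteTree.procPar (N.sitePar K start v) a = some b ∨
      SiteTree.procPar (N.sitePar K start v) b = some a := by
  have hpar : ∀ a, ((N.site (start + 2 * K) (.inl a)).par v).map (N.across a) =
      SiteTree.procPar (N.sitePar K start v) a := by
    intro a
    rw [SiteTree.procPar, sitePar, if_pos (hN.arrived_of_bound hK hv a), two_mul, ← add_assoc,
      (hs.costInv hN le_rfl _).par]
  rw [builtTree, SimpleGraph.fromRel_adj, hpar, hpar, and_iff_right_iff_imp]
  have hlt := (hs.siteTree hN hK hv).procPar_lt hN
  rintro (h | h) rfl <;> exact lt_irrefl _ (hlt _ _ h)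

omit hN hs hK hv in
open Classical in
theorem below_eq_card (K start v : ℕ) (s : N.Site) : N.below K start v s =
    ((N.S.map .inl).filter fun x => Below (N.sitePar K start v) x s).card := by
  rw [below, Finset.card_eq_sum_ones, Finset.sum_filter, subtree, Finset.sum_filter,
    ← Finset.sum_filter_add_sum_filter_not Finset.univ (· ∈ N.S.map .inl)]
  rw [Finset.filter_mem_eq_inter, Finset.univ_inter]
  rw [Finset.sum_eq_zero (s := Finset.univ.filter fun x => x ∉ N.S.map .inl), add_zero]
  · refine Finset.sum_congr rfl fun x hx => ?_
    obtain ⟨a, ha, rfl⟩ := Finset.mem_map.1 hx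
    simp [ind, ha]
  · intro x hx
    rw [Finset.mem_filter] at hx
    rcases x with a | r
    · have : a ∉ N.S := fun h => hx.2 (Finset.mem_map.2 ⟨a, h, rfl⟩)
      simp [ind, this]
    · simp [ind]

omit hN hs hK hv in
theorem sum_stepCost (κ K start v : ℕ) : ∑ s, N.stepCost κ K start v s =
    κ * ∑ a ∈ N.S, ∑ b ∈ N.S, ancDist (N.sitePar K start v) (.inl a) (.inl b) := by
  classical
  have h := sum_ancDist (par := N.sitePar K start v) (N.S.map .inl)
  simp only [Finset.sum_map, Function.Embedding.inl_apply, Finset.card_map] at h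
  rw [h, Finset.mul_sum]
  refine Finset.sum_congr rfl fun s _ => ?_
  rw [stepCost, below_eq_card]
  ring

/-- The sum over all sites differs from the one at the root only by zero terms: the root has all of
`S` below it, so its cofactor vanishes, and sites outside its subtree have no element of `S` below
them. -/
theorem Schedule.partCost_root : N.partCost κ K start v (.inl v) =
    κ * ∑ a ∈ N.S, ∑ b ∈ N.S, ancDist (N.sitePar K start v) (.inl a) (.inl b) := by
  classical
  have hp := hs.siteTree hN hK hv
  have hall : (N.S.map .inl).filter (fun x => Below (N.sitePar K start v) x (.inl v)) =
      N.S.map .inl := by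
    refine Finset.filter_true_of_mem fun x hx => ?_
    obtain ⟨a, -, rfl⟩ := Finset.mem_map.1 hx
    exact hp.root a
  have h0 : N.stepCost κ K start v (.inl v) = 0 := by
    rw [stepCost, below_eq_card, hall, Finset.card_map, Nat.sub_self, mul_zero]
  have h1 := sum_subtree (dep := N.siteDist v) hp.lt (N.stepCost κ K start v) (.inl v)
  rw [h0, zero_add] at h1
  rw [← sum_stepCost, partCost, ← h1]
  refine Finset.sum_subset (Finset.subset_univ _) fun s _ hs' => ?_
  rw [stepCost, below_eq_card, Finset.filter_false_of_mem, Finset.card_empty]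
  · simp
  · intro x hx hxs
    obtain ⟨a, -, rfl⟩ := Finset.mem_map.1 hx
    rw [mem_subtree] at hs'
    -- Ancestors of a processor form a chain containing `v`, and nothing lies strictly above `v`.
    rcases hxs.total (hp.root a) with h | h
    · exact hs' h
    · rcases h.eq_or_par with rfl | ⟨y, hy, -⟩
      · exact hs' (.refl _)
      · rw [hp.par_root] at hy
        cases hy

omit hK in
theorem Schedule.output_eq :
    N.output (start + 2 * K) v = N.partCost κ K start v (.inl v) := by
  classical
  have hv' := coe_mem_ids.2 hv
  rw [output, two_mul, ← add_assoc, (hs.costInv hN le_rfl _).rc v hv',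
    sum_ite_kids (fun y _ => Nat.le_add_right _ _), ← hs.partCost_eq hN hv']

/-- At the end the trees and the routing costs are correct. -/
theorem Schedule.correct : IsSPTree N.graph N.weight (N.builtTree (start + 2 * K) v) v ∧
    (N.output (start + 2 * K) v : ℕ∞) =
      routingCost (N.builtTree (start + 2 * K) v) N.weight N.S := by
  have hp := hs.siteTree hN hK hv
  have hT := hs.builtTree_adj hN hK hv
  refine ⟨hp.isSPTree hN hT, ?_⟩
  rw [hp.routingCost_tree hN hT, hs.output_eq hN hv, hs.partCost_root hN hK hv]

/-- A partial cost is at most the total, and two processors are joined in the tree through the root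
at cost at most `2 * M`. -/
theorem Schedule.partCost_le {M : ℕ} (hM : ∀ a : V, κ * N.slotDist v a ≤ M) (x : N.Site) :
    N.partCost κ K start v x ≤ 2 * N.S.card * N.S.card * M := by
  have hp := hs.siteTree hN hK hv
  have h1 := sum_subtree (dep := N.siteDist v) hp.lt (N.stepCost κ K start v) x
  have h2 : ∑ u ∈ subtree (N.sitePar K start v) x, N.stepCost κ K start v u ≤
      ∑ u, N.stepCost κ K start v u := Finset.sum_le_sum_of_subset (Finset.subset_univ _)
  rw [sum_stepCost, Finset.mul_sum] at h2
  have h3 : ∀ a b : V, κ * ancDist (N.sitePar K start v) (.inl a) (.inl b) ≤ 2 * M := by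
    intro a b
    have h4 := ancDist_triangle (par := N.sitePar K start v) (.inl a) (.inl v) (.inl b)
    have h5 := ancDist_of_below (dep := N.siteDist v) hp.dist (hp.root a)
    have h6 := ancDist_of_below (dep := N.siteDist v) hp.dist (hp.root b)
    rw [ancDist_comm (Sum.inl v)] at h4
    simp only [siteDist] at h5 h6
    calc κ * ancDist (N.sitePar K start v) (.inl a) (.inl b)
        ≤ κ * (N.slotDist v a + N.slotDist v b) := Nat.mul_le_mul_left κ (by omega)
      _ ≤ 2 * M := by rw [Nat.mul_add]; have := hM a; have := hM b; omega
  have h4 : ∑ a ∈ N.S, κ * ∑ b ∈ N.S, ancDist (N.sitePar K start v) (.inl a) (.inl b) ≤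
      ∑ _a ∈ N.S, ∑ _b ∈ N.S, 2 * M := by
    refine Finset.sum_le_sum fun a _ => ?_
    rw [Finset.mul_sum]
    exact Finset.sum_le_sum fun b _ => h3 a b
  simp only [Finset.sum_const, smul_eq_mul] at h4
  have h5 : 2 * N.S.card * N.S.card * M = N.S.card * (N.S.card * (2 * M)) := by ring
  rw [h5]
  have h6 : N.partCost κ K start v x ≤
      ∑ u ∈ subtree (N.sitePar K start v) x, N.stepCost κ K start v u := by
    rw [h1]; exact Nat.le_add_left _ _
  exact h6.trans (h2.trans h4)

end Result

/-! ## The messages -/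

theorem Proportional.gate_adj (hN : N.Proportional κ) {a b : V} (h : N.graph.Adj a b) :
    N.SiteAdj (N.gate a b) (N.gate b a) := by
  have key : ∀ a b : V, N.graph.Adj a b → a < b → N.SiteAdj (N.gate a b) (N.gate b a) := by
    intro a b h hlt
    have h1 := hN.slots_pos a b h
    have hb : N.gate b a = .inl b := dif_neg fun h => absurd h.2.1 hlt.not_gt
    rw [hb]
    by_cases h2 : 2 ≤ N.slots s(a, b)
    · rw [gate, dif_pos ⟨h, hlt, h2⟩]
      refine .inr ⟨?_, ?_⟩
      · simp [hlt.le]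
      · simp only; omega
    · rw [gate, dif_neg fun h => h2 h.2.2]
      exact ⟨h, by omega⟩
  rcases lt_or_gt_of_ne h.ne with hlt | hlt
  · exact key a b h hlt
  · exact siteAdj_symm (key b a h.symm hlt)

theorem Proportional.siteDist_mul_le (hN : N.Proportional κ) {M W : ℕ} {v : V}
    (hM : ∀ a : V, κ * N.slotDist v a ≤ M) (hW : ∀ e ∈ N.graph.edgeSet, N.weight e ≤ W)
    (x : N.Site) : κ * N.siteDist v x ≤ M + W := by
  rcases x with a | ⟨e, i⟩
  · exact (hM a).trans (Nat.le_add_right _ _)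
  · have h1 : N.weight e = κ * N.slots e := by
      have := hN.weight_eq _ _ (adj_inf_sup e)
      rwa [mk_inf_sup] at this
    have h2 : N.siteDist v (.inr ⟨e, i⟩) ≤ N.slotDist v (e : Sym2 V).inf + N.slots e := by
      have := i.2
      simp only [siteDist]
      omega
    refine (Nat.mul_le_mul_left κ h2).trans ?_
    rw [Nat.mul_add, ← h1]
    exact Nat.add_le_add (hM _) (hW e e.2)

/-- Additive constants are absorbed using `1 ≤ Nat.log 2 M`; this lets all field lengths be compared
as multiples of one logarithm. -/
theorem size_le_mul_log {M i j x : ℕ} (hM : 2 ≤ M) (hx : x ≤ 2 ^ i * M ^ j) :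
    Nat.size x ≤ (1 + i + 2 * j) * Nat.log 2 M := by
  have hl : 1 ≤ Nat.log 2 M := Nat.log_pos one_lt_two hM
  have h1 : M ^ j ≤ 2 ^ ((Nat.log 2 M + 1) * j) := by
    rw [pow_mul]
    exact Nat.pow_le_pow_left (Nat.lt_pow_succ_log_self one_lt_two M).le j
  have h2 : Nat.size x ≤ 1 + i + (Nat.log 2 M + 1) * j := by
    rw [Nat.size_le]
    calc x ≤ 2 ^ i * M ^ j := hx
      _ ≤ 2 ^ i * 2 ^ ((Nat.log 2 M + 1) * j) := Nat.mul_le_mul_left _ h1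
      _ = 2 ^ (i + (Nat.log 2 M + 1) * j) := (pow_add _ _ _).symm
      _ < 2 ^ (1 + i + (Nat.log 2 M + 1) * j) := Nat.pow_lt_pow_right one_lt_two (by omega)
  refine h2.trans ?_
  nlinarith

/-- Every message is short. -/
theorem Proportional.bits_le (hN : N.Proportional κ) {o : V} (ho : (o : ℕ) = 1) {start K : ℕ}
    (hstart : start ≤ 2 * N.ecc o + κ * N.ecc o + 2)
    (hplan : ∀ r a q, (N.lead r a).plan = some q → q = (κ * N.ecc o, N.S.card, start))
    (hs : N.Schedule K start) (hK : ∀ u v : V, N.slotDist u v + N.S.card ≤ K)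
    {c W : ℕ} (hV : ∀ v ∈ V, v ≤ V.card ^ c) (hW : ∀ e ∈ N.graph.edgeSet, N.weight e ≤ W)
    {r : ℕ} {a b : V} (hab : N.graph.Adj a b) {m : Msg} (hm : N.transmission r a b = some m) :
    m.bits ≤ (15 + 2 * c) * Nat.log 2 (V.card * W) := by
  have hκ := hN.factor_pos
  have hW1 : 1 ≤ W := by
    refine le_trans ?_ (hW s(a, b) hab)
    rw [hN.weight_eq a b hab]
    exact Nat.mul_pos hκ (hN.slots_pos a b hab)
  have hκW : κ ≤ W := by
    refine le_trans ?_ (hW s(a, b) hab)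
    rw [hN.weight_eq a b hab]
    exact Nat.le_mul_of_pos_right κ (hN.slots_pos a b hab)
  have hn : 2 ≤ V.card := by
    rw [← Fintype.card_coe]
    exact Fintype.one_lt_card_iff.2 ⟨a, b, hab.ne⟩
  set M := V.card * W with hMdef
  have hWM : 2 * W ≤ M := Nat.mul_le_mul_right W hn
  have hnM : V.card ≤ M := Nat.le_mul_of_pos_right _ hW1
  have hM2 : 2 ≤ M := hn.trans hnM
  have hl : 1 ≤ Nat.log 2 M := Nat.log_pos one_lt_two hM2
  have hd : ∀ u v : V, κ * N.slotDist u v ≤ M := hN.slotDist_mul_le hW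
  have hE : κ * N.ecc o ≤ M := by
    obtain ⟨x, -, hx⟩ := Finset.exists_mem_eq_sup Finset.univ ⟨o, Finset.mem_univ o⟩ (N.slotDist o)
    rw [ecc, hx]
    exact hd o x
  have hE' : N.ecc o ≤ κ * N.ecc o := Nat.le_mul_of_pos_left _ hκ
  have hk : N.S.card ≤ V.card := by
    rw [← Fintype.card_coe V]
    exact Finset.card_le_univ _
  have size1 : ∀ x ≤ M, Nat.size x ≤ 3 * Nat.log 2 M := fun x hx =>
    size_le_mul_log (i := 0) (j := 1) hM2 (by simpa using hx)
  have size2 : ∀ x ≤ 4 * M, Nat.size x ≤ 5 * Nat.log 2 M := fun x hx =>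
    size_le_mul_log (i := 2) (j := 1) hM2 (by simpa using hx)
  have sizeV : ∀ x ∈ V, Nat.size x ≤ (1 + 2 * c) * Nat.log 2 M := fun x hx =>
    size_le_mul_log (i := 0) (j := c) hM2
      (by simpa using (hV x hx).trans (Nat.pow_le_pow_left hnM c))
  have hB : (15 + 2 * c) * Nat.log 2 M = 15 * Nat.log 2 M + 2 * c * Nat.log 2 M := by ring
  have hB' : (1 + 2 * c) * Nat.log 2 M = Nat.log 2 M + 2 * c * Nat.log 2 M := by ring
  rw [hB]
  rw [hB'] at sizeV
  rcases lt_or_ge r start with h1 | h1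
  · rw [transmission, hs.early r h1] at hm
    rcases hN.leadSend_bound ho hplan hm with ⟨d, ch, rfl, hd⟩ | ⟨e, n, rfl, he, hn⟩ | rfl
    · have := size1 d (hd.trans hE)
      simp only [Msg.bits]
      omega
    · have := size1 e (he.trans hE)
      have := size1 n (by omega)
      simp only [Msg.bits]
      omega
    · have := size1 _ hE
      have := size1 N.S.card (by omega)
      have := size2 start (by omega)
      simp only [Msg.bits]
      omega
  obtain ⟨t, rfl⟩ := Nat.exists_eq_add_of_le h1
  have hadj := hN.gate_adj hab
  rcases lt_or_ge t K with h2 | h2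
  · rw [transmission, hs.tree t h2] at hm
    obtain ⟨v, hv, -, rfl⟩ := siteSend_tree hm
    have hT := hs.treeInv hN h2.le (N.gate a b)
    obtain ⟨hv', hr, -⟩ := (hT.mem_offer hN.waveDist hadj).1 hv
    have hom := hT.om v hv' (hN.waveDist.arrived_of_released hv' hr)
    obtain ⟨v, hvS, rfl⟩ := mem_ids.1 hv'
    rw [idDist_coe] at hom
    have h3 := hN.siteDist_mul_le (hd v) hW (N.gate a b)
    have := size2 (κ * N.siteDist v (N.gate a b) + κ) (by omega)
    have := sizeV v v.2
    rw [hom, hN.stepWeight_eq (stepEdge_mem hadj)]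
    simp only [Msg.bits]
    omega
  obtain ⟨t, rfl⟩ := Nat.exists_eq_add_of_le h2
  rw [← add_assoc] at hm
  rcases lt_or_ge t K with h3 | h3
  · rw [transmission, hs.cost t h3] at hm
    simp only at hm
    rcases hs.siteSend_iff hN (x := N.gate b a) h3 (hs.costInv hN h3.le (N.gate a b)) with
      ⟨v, hv, -, -, h4, -⟩ | ⟨h4, -⟩
    · rw [h4] at hm
      cases hm
      obtain ⟨v, hvS, rfl⟩ := mem_ids.1 hv
      have h5 := hs.partCost_le hN hK hvS (hd v) (N.gate a b)
      have h6 : N.below K start v (N.gate a b) ≤ N.S.card := by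
        classical
        rw [below_eq_card]
        exact (Finset.card_filter_le _ _).trans (Finset.card_map _).le
      have h7 : 2 * N.S.card * N.S.card * M ≤ 2 ^ 1 * M ^ 3 := by
        have h8 : N.S.card * N.S.card ≤ M * M := Nat.mul_le_mul (by omega) (by omega)
        calc 2 * N.S.card * N.S.card * M = 2 * (N.S.card * N.S.card) * M := by ring
          _ ≤ 2 * (M * M) * M := Nat.mul_le_mul_right _ (Nat.mul_le_mul_left _ h8)
          _ = 2 ^ 1 * M ^ 3 := by ring
      have := size_le_mul_log hM2 (h5.trans h7)
      have := size1 (N.below K start v (N.gate a b)) (by omega)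
      have := sizeV v v.2
      simp only [Msg.bits]
      omega
    · rw [h4] at hm
      cases hm
  · rw [transmission, hs.late _ (by omega)] at hm
    cases hm

end Net

/-! ### Assembly -/

theorem mainTheorem5 :
    ∃ C : ℕ, ∀ c : ℕ, ∃ B : ℕ, ∀ (V : Finset ℕ) (N : Net V),
      N.graph.Connected →
      1 ∈ V →
      (∀ v ∈ V, 1 ≤ v ∧ v ≤ V.card ^ c) →
      (∀ e ∈ N.graph.edgeSet, 1 ≤ N.weight e) →
      ((∀ e ∈ N.graph.edgeSet, N.slots e = N.weight e) ∨
        ((∃ w, ∀ e ∈ N.graph.edgeSet, N.weight e = w) ∧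
          ∀ e ∈ N.graph.edgeSet, N.slots e = 1)) →
      (∀ a, Set.InjOn (N.port a) (N.graph.neighborSet a)) →
      N.S.Nonempty →
      ∃ T : ℕ,
        (T : ℕ∞) ≤ C * ((N.S.card : ℕ∞) + wdiam N.graph N.weight) ∧
        N.Halted T ∧
        (∀ v ∈ N.S,
          IsSPTree N.graph N.weight (N.builtTree T v) v ∧
          (N.output T v : ℕ∞) = routingCost (N.builtTree T v) N.weight N.S) ∧
        (∀ W : ℕ, (∀ e ∈ N.graph.edgeSet, N.weight e ≤ W) →
          ∀ (r : ℕ) (a b : V), N.graph.Adj a b → ∀ m ∈ N.transmission r a b,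
            m.bits ≤ B * Nat.log 2 (V.card * W)) := by
  -- With `D' = κ * ecc`, the set-up takes at most `3 D' + 2` rounds and the two parts `2 |S| + 4
  -- D'`; the summand `2` is absorbed by `1 ≤ |S|`. The constant `15 + 2 * c` comes from cost
  -- messages: `3` for the kind, `1 + 2 * c` for the ID, `8` for the cost and `3` for the count.
  refine ⟨7, fun c => ⟨15 + 2 * c, fun V N hconn h1V hV hweight hslots _ hS => ?_⟩⟩
  obtain ⟨κ, hN⟩ : ∃ κ, N.Proportional κ := by
    rcases hslots with h | ⟨⟨w, hw⟩, h⟩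
    · refine ⟨1, hconn, le_rfl, fun a b hab => ?_, fun a b hab => ?_⟩
      · rw [h _ hab]; exact hweight s(a, b) hab
      · rw [h _ hab, one_mul]
    -- The maximum matters only for a graph without edges, where `w` is arbitrary and could be `0`.
    · refine ⟨max w 1, hconn, le_max_right _ _, fun a b hab => (h _ hab).ge, fun a b hab => ?_⟩
      have := hweight s(a, b) hab
      rw [hw _ hab] at this
      rw [h _ hab, hw _ hab, mul_one, max_eq_left this]
  set o : V := ⟨1, h1V⟩
  have ho : (o : ℕ) = 1 := rfl
  have hκ := hN.factor_pos
  obtain ⟨start, hstart, hplan, hplan'⟩ := hN.setup ho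
  have hs := Net.schedule_of_plan hplan hplan'
  set K := N.S.card + 2 * (κ * N.ecc o) with hKdef
  have hE' : N.ecc o ≤ κ * N.ecc o := Nat.le_mul_of_pos_left _ hκ
  have hcard : 1 ≤ N.S.card := hS.card_pos
  -- Any two processors are joined through the leader within `2 ecc` slots, which is at most `2 D'`.
  have hK : ∀ u v : V, N.slotDist u v + N.S.card ≤ K := by
    intro u v
    have h1 := hN.slotDist_triangle u o v
    have h2 := Net.slotDist_le_ecc (N := N) o u
    have h3 := Net.slotDist_le_ecc (N := N) o v
    rw [Net.slotDist_comm u o] at h1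
    omega
  refine ⟨start + 2 * K, ?_, hs.late _ le_rfl, fun v hv => hs.correct hN hK hv, ?_⟩
  · obtain ⟨x, -, hx⟩ :=
      Finset.exists_mem_eq_sup Finset.univ ⟨o, Finset.mem_univ o⟩ (N.slotDist o)
    have h1 := hN.le_wdiam o x
    rw [← hx] at h1
    have h2 : start + 2 * K ≤ 7 * (N.S.card + κ * N.ecc o) := by omega
    calc ((start + 2 * K : ℕ) : ℕ∞) ≤ ((7 * (N.S.card + κ * N.ecc o) : ℕ) : ℕ∞) := by
          exact_mod_cast h2
      _ = 7 * ((N.S.card : ℕ∞) + ((κ * N.ecc o : ℕ) : ℕ∞)) := by push_cast; rfl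
      _ ≤ 7 * ((N.S.card : ℕ∞) + wdiam N.graph N.weight) := by
          gcongr
          exact h1
  · intro W hW r a b hab m hm
    exact hN.bits_le ho hstart hplan hs hK (fun v hv => (hV v hv).2) hW hab hm
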